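/- Let $d\ge 1$. A tile is a non-empty compact connected subset of $\mathbb{R}^d$ equal to the closure of its interior; a patch is a collection of tiles with pairwise disjoint interiors, its support $\mathrm{supp}$ is the union of its tiles, and a tiling is a patch with support $\mathbb{R}^d$. For tilings $x,y$ let $d_T(x,y)$ be the infimum of $\sqrt2/2$ and all $0<r<\sqrt2/2$ for which there are patches $x'\subset x$, $y'\subset y$ of bounded support containing $\{\|v\|\le 1/r\}$ and a vector $t$, $\|t\|\le r$, with $t+x'=y'$. Let $X$ be a translation-invariant, $d_T$-closed space of tilings; let $\mathcal P^N(X)$ be the set of patches with connected support consisting of $N$ tiles of a tiling in $X$, and $\mathcal P(X)=\bigcup_N\mathcal P^N(X)$. Assume $X$ has finite local complexity ($\mathcal P^2(X)$ is finite up to translation), and let $D_1,\dots,D_l$ represent the translation classes of tiles of $X$. Let $J$ be finite and non-empty and, for $j\in J$, let $S_j:\mathcal P^1(X)\to\mathcal P(X)$ be a substitution with dilatation factor $\lambda_j>1$: $\mathrm{supp}(S_j(P))=\lambda_j P$ and $S_j(t+Q)=\lambda_j t+S_j(Q)$. Assume that $S_j$ extends, by $S_j(x)=\bigcup_{D\in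 x}S_j(D)$, to maps $\mathcal P(X)\to\mathcal P(X)$ and $X\to X$. Let $A_j$ be the $l\times l$ matrix whose $(i,k)$ entry is the number of translates of $D_i$ in $S_j(D_k)$. Assume that $\{S_j\}$ is primitive: for every $\bar a=(a_1,a_2,\dots)\in\Sigma=J^{\mathbb N}$ and every $n$, some product $A_{a_n}A_{a_{n+1}}\cdots A_{a_{n+m}}$ is entrywise positive. Put $S^n_{\bar a}=S_{a_1}\circ\cdots\circ S_{a_n}$, and $d_\Sigma(\bar a,\bar b)=1/L$ with $L$ the least index such that $a_L\ne b_L$ (and $0$ if $\bar a=\bar b$). Fix a tile $D$ of $X$; let $X_{\bar a}$ be the set of $x\in X$ each of whose finite patches has a translate contained in some $S^n_{\bar a}(D)$. For a patch $x'$ and $U\subset\mathbb{R}^d$ let $X^{\bar a}_{x',U}=\{x\in X_{\bar a}: t+x'\subset x \text{ for some } t\in U\}$. Call $\theta\in(0,1)$ a *tile frequency rate* if the limits $$c_{\bar a}(D_i)=\lim_{n}\frac{\#\{\text{translates of } D_i \text{ in } S^n_{\bar a}(D_j)\}}{\mathrm{vol}(\mathrm{supp}\,S^n_{\bar a}(D_j))}$$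 exist, do not depend on $j$, and there is $C>0$ such that $|c_{\bar a}(D_i)-c_{\bar b}(D_i)|<C\theta^{1/\delta}$ for all $i$, all $\delta>0$ and all $\bar a,\bar b\in\Sigma$ with $d_\Sigma(\bar a,\bar b)<\delta$. Let $\lambda=\min_j\lambda_j$, let $\mathcal D$ be the largest upper Minkowski dimension of the boundaries $\partial D_i$, where the upper Minkowski dimension of $H$ is $\inf\{\beta:\mathrm{vol}(H^{+r})=O(r^{d-\beta})\text{ as } r\to0^+\}$ with $H^{+r}$ the closed $r$-neighbourhood of $H$, and put $$\theta_0=\theta^{\frac{\mathcal D-d}{\mathcal D-d+\log_\lambda\theta}} .$$ Then tile frequency rates exist, and each $X_{\bar a}$ carries exactly one translation-invariant Borel probability measure $\mu_{\bar a}$. Moreover, for every tile frequency rate $\theta$ we have $\theta_0<1$, and for each $N>0$ there is $C_N>0$ such that, for all $\delta>0$ and all $\bar a,\bar b\in\Sigma$ with $d_\Sigma(\bar a,\bar b)<\delta$, $$|\mu_{\bar a}(X^{\bar a}_{x',U})-\mu_{\bar b}(X^{\bar b}_{x',U})|<C_N\,\theta_0^{1/\delta}$$ for all $x'\in\mathcal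 P^N(X)$ and all sufficiently small Borel sets $U\subset\mathbb{R}^d$, namely all $U$ with $\mathrm{diam}(U)<\eta$ for some $\eta>0$ such that every tile of $X$ contains a ball of radius $\eta$. -/

import Mathlib

open Set Filter Topology MeasureTheory
open scoped Pointwise

namespace MultiSubst

noncomputable section

/-- Euclidean `d`-space. -/
abbrev E (d : ℕ) := EuclideanSpace ℝ (Fin d)

/-- A tile: a (non-empty) compact connected set which is the closure of its interior. -/
def IsTile {d : ℕ} (D : Set (E d)) : Prop :=
  IsCompact D ∧ IsConnected D ∧ closure (interior D) = D

/-- A patch: a collection of tiles with pairwise disjoint interiors. -/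
def IsPatch {d : ℕ} (x : Set (Set (E d))) : Prop :=
  (∀ D ∈ x, IsTile D) ∧
    ∀ D ∈ x, ∀ D' ∈ x, D ≠ D' → interior D ∩ interior D' = ∅

/-- The support of a patch. -/
def supp {d : ℕ} (x : Set (Set (E d))) : Set (E d) := ⋃₀ x

/-- The translated collection `t + x`. -/
def translate {d : ℕ} (t : E d) (x : Set (Set (E d))) : Set (Set (E d)) :=
  (fun D => t +ᵥ D) '' x

theorem IsTile.vadd {d : ℕ} {D : Set (E d)} (h : IsTile D) (t : E d) : IsTile (t +ᵥ D) := by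
  obtain ⟨h1, h2, h3⟩ := h
  have hc : Continuous (fun v : E d => t +ᵥ v) := continuous_const_vadd t
  refine ⟨h1.image hc, h2.image _ hc.continuousOn, ?_⟩
  rw [interior_vadd, closure_vadd, h3]

/-- A tiling of `ℝ^d`: a patch whose support is all of `ℝ^d`. -/
structure Tiling (d : ℕ) where
  tiles : Set (Set (E d))
  isPatch : IsPatch tiles
  covers : supp tiles = univ

/-- The action of `ℝ^d` on tilings by translations. -/
def Tiling.shift {d : ℕ} (t : E d) (x : Tiling d) : Tiling d where
  tiles := translate t x.tiles
  isPatch := by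
    refine ⟨?_, ?_⟩
    · rintro _ ⟨D, hD, rfl⟩
      exact (x.isPatch.1 D hD).vadd t
    · rintro _ ⟨D, hD, rfl⟩ _ ⟨D', hD', rfl⟩ hne
      have hne' : D ≠ D' := fun h => hne (by rw [h])
      simp only [interior_vadd]
      rw [← vadd_set_inter, x.isPatch.2 D hD D' hD' hne', vadd_set_empty]
  covers := by
    refine eq_univ_of_forall fun v => ?_
    have hv : -t + v ∈ supp x.tiles := by rw [x.covers]; trivial
    obtain ⟨D, hD, hvD⟩ := hv
    exact ⟨t +ᵥ D, ⟨D, hD, rfl⟩, ⟨-t + v, hvD, by simp⟩⟩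

/-- `x[[K]]`: the subpatches of `x` with bounded support which cover `K`. -/
def coveringPatches {d : ℕ} (x : Set (Set (E d))) (K : Set (E d)) : Set (Set (Set (E d))) :=
  {x' | x' ⊆ x ∧ Bornology.IsBounded (supp x') ∧ K ⊆ supp x'}

/-- The tiling distance `d_T`. -/
def distT {d : ℕ} (x y : Tiling d) : ℝ :=
  sInf ({√2 / 2} ∪ {r : ℝ | 0 < r ∧ r < √2 / 2 ∧
    ∃ x' ∈ coveringPatches x.tiles (Metric.closedBall 0 (1 / r)),
    ∃ y' ∈ coveringPatches y.tiles (Metric.closedBall 0 (1 / r)),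
    ∃ t : E d, ‖t‖ ≤ r ∧ translate t x' = y'})

/-- The topology of `d_T`. -/
instance (d : ℕ) : TopologicalSpace (Tiling d) where
  IsOpen V := ∀ x ∈ V, ∃ ε > 0, ∀ y, distT x y < ε → y ∈ V
  isOpen_univ := fun _ _ => ⟨1, one_pos, fun _ _ => trivial⟩
  isOpen_inter := by
    rintro V W hV hW x ⟨hxV, hxW⟩
    obtain ⟨ε, hε, h⟩ := hV x hxV
    obtain ⟨ε', hε', h'⟩ := hW x hxW
    exact ⟨min ε ε', lt_min hε hε', fun y hy =>
      ⟨h y (hy.trans_le (min_le_left _ _)), h' y (hy.trans_le (min_le_right _ _))⟩⟩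
  isOpen_sUnion := by
    rintro 𝒱 h𝒱 x ⟨V, hV, hx⟩
    obtain ⟨ε, hε, h⟩ := h𝒱 V hV x hx
    exact ⟨ε, hε, fun y hy => ⟨V, hV, h y hy⟩⟩

/-- The Borel σ-algebra of `d_T`. -/
instance (d : ℕ) : MeasurableSpace (Tiling d) := borel (Tiling d)

instance (d : ℕ) : BorelSpace (Tiling d) := ⟨rfl⟩

/-- `𝒫^N(X)`: the patches with connected support consisting of exactly `N` tiles of a tiling
in `X`. -/
def patchesOf {d : ℕ} (X : Set (Tiling d)) (N : ℕ) : Set (Set (Set (E d))) :=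
  {x' | x'.Finite ∧ x'.ncard = N ∧ IsConnected (supp x') ∧ ∃ x ∈ X, x' ⊆ x.tiles}

/-- `𝒫^1(X)`, a one-tile patch being identified with its tile. -/
def tilesOf {d : ℕ} (X : Set (Tiling d)) : Set (Set (E d)) :=
  {D | ∃ x ∈ X, D ∈ x.tiles}

/-- A space of tilings: `T`-invariant, closed (equivalently, complete) for `d_T`, and of finite
local complexity, i.e. with finitely many connected two-tile patches up to translation. -/
structure IsTilingSpace {d : ℕ} (X : Set (Tiling d)) : Prop where
  invariant : ∀ x ∈ X, ∀ t : E d, x.shift t ∈ X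
  closed : IsClosed X
  flc : ∃ F : Set (Set (Set (E d))), F.Finite ∧
    ∀ x' ∈ patchesOf X 2, ∃ y' ∈ F, ∃ t : E d, x' = translate t y'

/-- `D_1, …, D_l` are prototiles of `X`: pairwise inequivalent tiles of `X` representing all
translation classes of tiles of `X`. -/
structure IsPrototileFamily {d l : ℕ} (X : Set (Tiling d)) (D : Fin l → Set (E d)) : Prop where
  mem : ∀ i, D i ∈ tilesOf X
  inequivalent : ∀ i j, i ≠ j → ∀ t : E d, D i ≠ t +ᵥ D j
  complete : ∀ P ∈ tilesOf X, ∃ i, ∃ t : E d, P = t +ᵥ D i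

/-- The extension of a map on tiles to collections of tiles: `S(x) = ⋃_{D ∈ x} S(D)`. -/
def extend {d : ℕ} (S : Set (E d) → Set (Set (E d))) (x : Set (Set (E d))) : Set (Set (E d)) :=
  ⋃ D ∈ x, S D

/-- `S` is a self-similar substitution on `X` with dilatation factor `lam`, which extends to maps
`𝒫(X) → 𝒫(X)` and `X → X`. -/
structure IsSubstitution {d : ℕ} (X : Set (Tiling d)) (S : Set (E d) → Set (Set (E d)))
    (lam : ℝ) : Prop where
  one_lt : 1 < lam
  maps_tile : ∀ P ∈ tilesOf X, ∃ N, S P ∈ patchesOf X N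
  supp_eq : ∀ P ∈ tilesOf X, supp (S P) = lam • P
  equivariant : ∀ P ∈ tilesOf X, ∀ Q ∈ tilesOf X, ∀ t : E d, P = t +ᵥ Q →
    S P = translate (lam • t) (S Q)
  maps_patch : ∀ N, ∀ x' ∈ patchesOf X N, ∃ N', extend S x' ∈ patchesOf X N'
  maps_tiling : ∀ x ∈ X, ∃ y ∈ X, y.tiles = extend S x.tiles

/-- `L_{x'}(y')`: the number of distinct translated copies of `x'` contained in `y'`. -/
def copies {d : ℕ} (x' y' : Set (Set (E d))) : ℕ :=
  {p : Set (Set (E d)) | p ⊆ y' ∧ ∃ t : E d, p = translate t x'}.ncard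

/-- The structure matrix of `S`: the `(i,j)` entry is the number of tiles equivalent to `D_i`
in `S(D_j)`. -/
def structureMatrix {d l : ℕ} (D : Fin l → Set (E d)) (S : Set (E d) → Set (Set (E d))) :
    Matrix (Fin l) (Fin l) ℕ :=
  Matrix.of fun i j => copies {D i} (S (D j))

/-- The set `{S_j}` is primitive: for every sequence `a` and every `n`, some product
`A_{a_n} A_{a_{n+1}} ⋯ A_{a_{n+m}}` has only positive entries. -/
def IsPrimitive {d l : ℕ} {J : Type*} (D : Fin l → Set (E d))
    (S : J → Set (E d) → Set (Set (E d))) : Prop :=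
  ∀ (a : ℕ → J) (n : ℕ), ∃ m : ℕ, ∀ i k : Fin l,
    0 < ((List.range (m + 1)).map fun r => structureMatrix D (S (a (n + r)))).prod i k

/-- `S_a^n(D) = S_{a_1} ∘ ⋯ ∘ S_{a_n} (D)`; sequences are indexed from `0`, so `a_1` is `a 0`. -/
def superTile {d : ℕ} {J : Type*} (S : J → Set (E d) → Set (Set (E d))) :
    (ℕ → J) → ℕ → Set (E d) → Set (Set (E d))
  | _, 0, D => {D}
  | a, n + 1, D => extend (S (a 0)) (superTile S (fun r => a (r + 1)) n D)

/-- The multi-substitution tiling space `X_a`, built from the initial tile `D₀`. -/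
def tilingSpace {d : ℕ} {J : Type*} (X : Set (Tiling d)) (S : J → Set (E d) → Set (Set (E d)))
    (D₀ : Set (E d)) (a : ℕ → J) : Set (Tiling d) :=
  {x | x ∈ X ∧ ∀ x' : Set (Set (E d)), x' ⊆ x.tiles → x'.Finite →
    ∃ (n : ℕ) (t : E d), translate t x' ⊆ superTile S a n D₀}

/-- The metric `d_Σ` on sequences: `1 / L`, with `L` the first (one-based) place where the
sequences differ. -/
def distSeq {J : Type*} (a b : ℕ → J) : ℝ :=
  open Classical in if a = b then 0 else 1 / ((sInf {n : ℕ | a n ≠ b n} : ℕ) + 1)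

/-- The cylinder set of a patch `x'` and a set `U` of vectors inside a space `Y` of tilings. -/
def cylinder {d : ℕ} (Y : Set (Tiling d)) (x' : Set (Set (E d))) (U : Set (E d)) :
    Set (Tiling d) :=
  {x | x ∈ Y ∧ ∃ t ∈ U, translate t x' ⊆ x.tiles}

/-- `μ` is a translation-invariant Borel probability measure on the space `Y` of tilings. -/
structure IsInvariantProb {d : ℕ} (Y : Set (Tiling d)) (μ : Measure (Tiling d)) : Prop where
  prob : IsProbabilityMeasure μ
  carried : μ Yᶜ = 0
  invariant : ∀ (t : E d) (V : Set (Tiling d)), MeasurableSet V → μ (Tiling.shift t ⁻¹' V) = μ V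

/-- `θ` is an exponential rate, with constant `C`, for the dependence on the sequence `a` of the
tile frequencies `c_a(D_i) = lim_n L_{D_i}(S_a^n(D_j)) / vol(S_a^n(D_j))`. -/
def IsTileFrequencyRate {d l : ℕ} {J : Type*} (D : Fin l → Set (E d))
    (S : J → Set (E d) → Set (Set (E d))) (θ C : ℝ) : Prop :=
  0 < θ ∧ θ < 1 ∧ 0 < C ∧ ∃ c : (ℕ → J) → Fin l → ℝ,
    (∀ a i j, Tendsto (fun n : ℕ => (copies {D i} (superTile S a n (D j)) : ℝ) /
      volume.real (supp (superTile S a n (D j)))) atTop (𝓝 (c a i))) ∧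
    ∀ δ > 0, ∀ a b, distSeq a b < δ → ∀ i, |c a i - c b i| < C * θ ^ (1 / δ)

/-- The upper Minkowski dimension
`inf {β : vol(H^{+r}) = O(r^{d-β}) as r → 0⁺}` of a (non-empty bounded) set `H`. -/
def upperMinkowskiDim {d : ℕ} (H : Set (E d)) : ℝ :=
  sInf {β : ℝ | (fun r : ℝ => volume.real (Metric.cthickening r H))
    =O[𝓝[>] 0] (fun r : ℝ => r ^ ((d : ℝ) - β))}

/-- The largest upper Minkowski dimension of the boundary of a prototile. -/
def boundaryDim {d l : ℕ} (D : Fin l → Set (E d)) : ℝ :=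
  ⨆ i, upperMinkowskiDim (frontier (D i))

/-- The rate `θ₀ = θ ^ ((𝒟 - d) / (𝒟 - d + log_lam θ))`, with `𝒟` the boundary dimension and
`lam` the smallest dilatation factor. -/
def theta₀ {d l : ℕ} {J : Type*} (D : Fin l → Set (E d)) (lam : J → ℝ) (θ : ℝ) : ℝ :=
  θ ^ ((boundaryDim D - d) / (boundaryDim D - d + Real.logb (⨅ j, lam j) θ))

end

end MultiSubst

namespace MultiSubst

/-! For an invariant probability measure on `X_a`, a small cylinder over a patch `q` has measure
`f_a(q) * vol(U)`, where `f_a(q)` is the limit of the number of positions of `q` in `S_a^n(D_i)` per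
unit of volume. Existence, uniqueness and dependence on `a` are thereby reduced to the frequencies
`f_a(q)`.

Tiles. Boundaries have volume zero, so the volume fractions of the tile types in `S_a^n(D_k)` sum to
one, and passing from level `n` to level `n + m` replaces densities by weighted averages.
Compactness of the sequence space makes primitivity uniform (`exists_forall_cnt_pos`): some fixed
number of letters gives weights bounded below. A Doeblin contraction (`exists_density_tile_sub_le`)
then shows that tile densities converge exponentially fast to a limit independent of `k`. As `S_a^n`
involves only the first `n` letters, sequences agreeing on them have exponentially close tile
frequencies.

Patches. A position of `q` in an inflated patch lies over a unique smallest patch of parents, which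
is connected and has no more tiles than `q` (`cnt_extend`). If there is one parent, `q` lies in an
inflated tile. If there are several, `q` crosses the boundary of an inflated tile, and such
positions have density at most a constant times the volume of the `R / lam ^ n`-neighborhoods of the
prototile boundaries. This volume decays because the boundary dimension is below `d`: iterates of a
substitution leave tiles in the interior of every inflated tile, so the tiles along its boundary
lose a fixed proportion of volume per step (`sum_outer_le`). Patch frequencies therefore exist and
satisfy `patchFrequency_eq`, which expresses `f_a(q)` by frequencies of the shifted sequence: a main
term in the tile frequencies and a small term in patches of at most the same size.

Rate. Fix a level `n₀` at which the crossing coefficients sum to at most `θ₀ ^ n₀ / 2`. For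
sequences agreeing on more than `n₀` letters the coefficients coincide, the main term contributes a
power of `θ`, and the crossing term is controlled by induction on the number of common letters
(`exists_patchFrequency_sub_le`). This works for any rate `θ' ≤ 1` that is at least `θ` and exceeds
`lam ^ (-γ)` for some `γ < d - boundaryDim D`. By `theta₀_spec` the number `θ₀` qualifies: if `θ =
lam ^ (-y)` and `x = d - boundaryDim D`, then `θ₀ = lam ^ (-x * y / (x + y))`, and `x * y / (x + y)`
is below both `x` and `y`.

Measures. Finite local complexity makes `X` compact, so `X_a` is nonempty and compact, and averaging
over balls yields an invariant measure. Every ball of a tiling in `X_a` occurs in an inflation of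
level `n` of some patch, so patch counts in balls are uniform in the tiling. Tonelli's theorem and
invariance turn these counts into the measures of cylinders (`measureReal_cyl`), and small cylinders
determine the measure (`measure_ext`). -/

/-! ### Translations, tiles and patches -/

theorem translate_eq_vadd {d : ℕ} (t : E d) (x : Set (Set (E d))) : translate t x = t +ᵥ x := rfl

theorem mem_translate {d : ℕ} {t : E d} {x : Set (Set (E d))} {Q : Set (E d)} :
    Q ∈ translate t x ↔ -t +ᵥ Q ∈ x := by
  rw [translate_eq_vadd, mem_vadd_set_iff_neg_vadd_mem]

theorem vadd_mem_translate {d : ℕ} {t : E d} {x : Set (Set (E d))} {Q : Set (E d)} :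
    t +ᵥ Q ∈ translate t x ↔ Q ∈ x := by
  rw [translate_eq_vadd, vadd_mem_vadd_set_iff]

theorem translate_zero {d : ℕ} (x : Set (Set (E d))) : translate 0 x = x := by
  rw [translate_eq_vadd, zero_vadd]

theorem translate_translate {d : ℕ} (s t : E d) (x : Set (Set (E d))) :
    translate s (translate t x) = translate (s + t) x := by
  simp only [translate_eq_vadd, add_vadd]

theorem translate_subset_translate {d : ℕ} {t : E d} {x y : Set (Set (E d))} :
    translate t x ⊆ translate t y ↔ x ⊆ y := by
  simp only [translate_eq_vadd, vadd_set_subset_vadd_set_iff]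

theorem translate_subset_iff {d : ℕ} {t : E d} {x y : Set (Set (E d))} :
    translate t x ⊆ y ↔ x ⊆ translate (-t) y := by
  simp only [translate_eq_vadd, vadd_set_subset_iff_subset_neg_vadd_set]

theorem translate_mono {d : ℕ} (t : E d) {x y : Set (Set (E d))} (h : x ⊆ y) :
    translate t x ⊆ translate t y := translate_subset_translate.2 h

theorem ncard_translate {d : ℕ} (t : E d) (x : Set (Set (E d))) :
    (translate t x).ncard = x.ncard :=
  Set.ncard_image_of_injective _ (AddAction.injective t)

theorem supp_translate {d : ℕ} (t : E d) (x : Set (Set (E d))) :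
    supp (translate t x) = t +ᵥ supp x := by
  ext v
  simp only [supp, mem_sUnion, mem_translate, mem_vadd_set_iff_neg_vadd_mem]
  constructor
  · rintro ⟨Q, hQ, hv⟩
    exact ⟨_, hQ, vadd_mem_vadd_set_iff.2 hv⟩
  · rintro ⟨Q, hQ, hv⟩
    exact ⟨t +ᵥ Q, by simpa using hQ, by simpa [mem_vadd_set_iff_neg_vadd_mem] using hv⟩

theorem supp_mono {d : ℕ} {x y : Set (Set (E d))} (h : x ⊆ y) : supp x ⊆ supp y :=
  sUnion_subset_sUnion h

theorem subset_supp {d : ℕ} {x : Set (Set (E d))} {P : Set (E d)} (h : P ∈ x) : P ⊆ supp x :=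
  subset_sUnion_of_mem h

/-- A period `t` carries a point `v` of `K` to all points `v + n • t`, which leave every ball unless
`t = 0`. -/
theorem eq_zero_of_vadd_eq_self {d : ℕ} {K : Set (E d)} (hne : K.Nonempty)
    (hb : Bornology.IsBounded K) {t : E d} (h : t +ᵥ K = K) : t = 0 := by
  obtain ⟨v, hv⟩ := hne
  obtain ⟨R, hR⟩ := hb.subset_closedBall 0
  have hmem : ∀ n : ℕ, v + (n : ℝ) • t ∈ K := by
    intro n
    induction n with
    | zero => simpa using hv
    | succ n ih =>
      rw [← h]
      refine ⟨_, ih, ?_⟩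
      simp only [vadd_eq_add]
      push_cast
      module
  by_contra hne
  obtain ⟨n, hn⟩ := exists_nat_gt ((R + ‖v‖) / ‖t‖)
  have h1 := hR (hmem n)
  rw [mem_closedBall_zero_iff] at h1
  have ht : 0 < ‖t‖ := norm_pos_iff.2 hne
  rw [div_lt_iff₀ ht] at hn
  have h2 : ‖(n : ℝ) • t‖ ≤ ‖v + (n : ℝ) • t‖ + ‖v‖ := by
    have := norm_sub_le (v + (n : ℝ) • t) v
    simpa using this
  rw [norm_smul, Real.norm_natCast] at h2
  linarith

theorem eq_of_vadd_eq_vadd {d : ℕ} {K : Set (E d)} (hne : K.Nonempty)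
    (hb : Bornology.IsBounded K) {s t : E d} (h : s +ᵥ K = t +ᵥ K) : s = t := by
  have : (-t + s) +ᵥ K = K := by rw [add_vadd, h, neg_vadd_vadd]
  have := eq_zero_of_vadd_eq_self hne hb this
  rw [neg_add_eq_zero] at this
  exact this.symm

theorem eq_of_translate_eq {d : ℕ} {q : Set (Set (E d))} (hne : (supp q).Nonempty)
    (hb : Bornology.IsBounded (supp q)) {s t : E d} (h : translate s q = translate t q) :
    s = t := by
  apply eq_of_vadd_eq_vadd hne hb
  rw [← supp_translate, ← supp_translate, h]

theorem IsTile.isBounded {d : ℕ} {P : Set (E d)} (h : IsTile P) : Bornology.IsBounded P :=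
  h.1.isBounded

theorem IsTile.nonempty {d : ℕ} {P : Set (E d)} (h : IsTile P) : P.Nonempty := h.2.1.nonempty

theorem IsTile.inter_interior_nonempty {d : ℕ} {P U : Set (E d)} (h : IsTile P) (hU : IsOpen U)
    (hne : (U ∩ P).Nonempty) : (U ∩ interior P).Nonempty := by
  obtain ⟨v, hvU, hvP⟩ := hne
  rw [← h.2.2] at hvP
  exact mem_closure_iff.1 hvP U hU hvU

theorem IsTile.interior_nonempty {d : ℕ} {P : Set (E d)} (h : IsTile P) :
    (interior P).Nonempty := by
  simpa using h.inter_interior_nonempty isOpen_univ (by simpa using h.nonempty)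

theorem IsPatch.mono {d : ℕ} {x y : Set (Set (E d))} (h : IsPatch y) (hxy : x ⊆ y) : IsPatch x :=
  ⟨fun D hD => h.1 D (hxy hD), fun D hD D' hD' => h.2 D (hxy hD) D' (hxy hD')⟩

theorem IsPatch.translate {d : ℕ} {x : Set (Set (E d))} (h : IsPatch x) (t : E d) :
    IsPatch (translate t x) := by
  refine ⟨?_, ?_⟩
  · rintro _ ⟨D, hD, rfl⟩
    exact (h.1 D hD).vadd t
  · rintro _ ⟨D, hD, rfl⟩ _ ⟨D', hD', rfl⟩ hne
    have hne' : D ≠ D' := fun h => hne (by rw [h])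
    simp only [interior_vadd]
    rw [← vadd_set_inter, h.2 D hD D' hD' hne', vadd_set_empty]

theorem IsPatch.eq_of_interior {d : ℕ} {x : Set (Set (E d))} (h : IsPatch x) {P Q : Set (E d)}
    (hP : P ∈ x) (hQ : Q ∈ x) (hPQ : (interior P ∩ interior Q).Nonempty) : P = Q := by
  by_contra hne
  exact hPQ.ne_empty (h.2 P hP Q hQ hne)

theorem IsPatch.eq_of_interior_inter {d : ℕ} {x : Set (Set (E d))} (h : IsPatch x)
    {P Q : Set (E d)} (hP : P ∈ x) (hQ : Q ∈ x) (hPQ : (interior P ∩ Q).Nonempty) : P = Q :=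
  h.eq_of_interior hP hQ ((h.1 Q hQ).inter_interior_nonempty isOpen_interior hPQ)

/-- A subpatch of a patch which covers an interior point of a tile contains this tile. -/
theorem IsPatch.mem_of_interior_inter_supp {d : ℕ} {x y : Set (Set (E d))} (h : IsPatch x)
    (hy : y ⊆ x) {P : Set (E d)} (hP : P ∈ x) (hPy : (interior P ∩ supp y).Nonempty) : P ∈ y := by
  obtain ⟨v, hvP, Q, hQ, hvQ⟩ := hPy
  rwa [h.eq_of_interior_inter hP (hy hQ) ⟨v, hvP, hvQ⟩]

theorem isBounded_supp {d : ℕ} {x : Set (Set (E d))} (hx : x.Finite)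
    (h : ∀ P ∈ x, IsTile P) : Bornology.IsBounded (supp x) :=
  (Bornology.isBounded_sUnion hx).2 fun P hP => (h P hP).isBounded

theorem isClosed_supp {d : ℕ} {x : Set (Set (E d))} (hx : x.Finite)
    (h : ∀ P ∈ x, IsTile P) : IsClosed (supp x) := by
  rw [supp, sUnion_eq_biUnion]
  exact hx.isClosed_biUnion fun P hP => (h P hP).1.isClosed

/-- The interiors of the tiles of a finite patch have total volume at most that of any bounded set
containing them. -/
theorem IsPatch.sum_volume_interior_le {d : ℕ} {x : Finset (Set (E d))}
    (h : IsPatch (x : Set (Set (E d)))) {K : Set (E d)} (hK : Bornology.IsBounded K)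
    (hx : ∀ P ∈ x, interior P ⊆ K) :
    ∑ P ∈ x, volume.real (interior P) ≤ volume.real K := by
  have hfin : ∀ P ∈ x, volume (interior P) ≠ ⊤ := fun P hP =>
    ((hK.subset (hx P hP)).measure_lt_top).ne
  rw [← measureReal_biUnion_finset (fun P hP Q hQ hne => disjoint_iff_inter_eq_empty.2
    (h.2 P hP Q hQ hne)) (fun P _ => isOpen_interior.measurableSet) hfin]
  exact measureReal_mono (iUnion₂_subset hx) hK.measure_lt_top.ne

/-- A patch of tiles with interiors of volume at least `v` inside a bounded set is finite, with a
bound on its number of tiles. -/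
theorem IsPatch.finite_and_ncard_le {d : ℕ} {x : Set (Set (E d))}
    (h : IsPatch x) {K : Set (E d)} (hK : Bornology.IsBounded K)
    (hx : ∀ P ∈ x, interior P ⊆ K) {v : ℝ} (hv : 0 < v)
    (hvx : ∀ P ∈ x, v ≤ volume.real (interior P)) :
    x.Finite ∧ x.ncard * v ≤ volume.real K := by
  -- The bound is proved for finite subfamilies first; finiteness of `x` follows, because
  -- arbitrarily large subfamilies would violate it.
  have key : ∀ F : Finset (Set (E d)), (F : Set (Set (E d))) ⊆ x → F.card * v ≤ volume.real K := by
    intro F hF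
    refine le_trans ?_ ((h.mono hF).sum_volume_interior_le hK fun P hP => hx P (hF hP))
    rw [← nsmul_eq_mul]
    exact Finset.card_nsmul_le_sum _ _ _ fun P hP => hvx P (hF hP)
  have hfin : x.Finite := by
    by_contra hinf
    obtain ⟨n, hn⟩ := exists_nat_gt (volume.real K / v)
    obtain ⟨F, hF, hcard⟩ := Set.Infinite.exists_subset_card_eq hinf n
    have := key F hF
    rw [div_lt_iff₀ hv] at hn
    rw [hcard] at this
    linarith
  refine ⟨hfin, ?_⟩
  have := key hfin.toFinset (by simp)
  rwa [← Set.ncard_eq_toFinset_card x hfin] at this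

/-! ### Tilings with finitely many prototiles -/

/-- A tiling space all of whose tiles are translates of finitely many prototiles. -/
structure HasPrototiles {d l : ℕ} (X : Set (Tiling d)) (D : Fin l → Set (E d)) : Prop where
  space : IsTilingSpace X
  isTile : ∀ i, IsTile (D i)
  complete : ∀ P ∈ tilesOf X, ∃ i, ∃ t : E d, P = t +ᵥ D i

theorem isTile_of_mem_tilesOf {d : ℕ} {X : Set (Tiling d)} {P : Set (E d)} (hP : P ∈ tilesOf X) :
    IsTile P := by
  obtain ⟨x, _, hPx⟩ := hP
  exact x.isPatch.1 P hPx

theorem HasPrototiles.of_isPrototileFamily {d l : ℕ} {X : Set (Tiling d)} {D : Fin l → Set (E d)}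
    (hX : IsTilingSpace X) (hD : IsPrototileFamily X D) : HasPrototiles X D :=
  ⟨hX, fun i => isTile_of_mem_tilesOf (hD.mem i), hD.complete⟩

theorem volumeReal_interior_vadd {d : ℕ} (t : E d) (P : Set (E d)) :
    volume.real (interior (t +ᵥ P)) = volume.real (interior P) := by
  rw [interior_vadd, measureReal_def, measureReal_def, measure_vadd]

theorem IsTile.volume_interior_pos {d : ℕ} {P : Set (E d)} (h : IsTile P) :
    0 < volume.real (interior P) := by
  rw [measureReal_def, ENNReal.toReal_pos_iff]
  exact ⟨isOpen_interior.measure_pos _ h.interior_nonempty,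
    (h.isBounded.subset interior_subset).measure_lt_top⟩

theorem IsTilingSpace.vadd_mem_tilesOf {d : ℕ} {X : Set (Tiling d)} (hX : IsTilingSpace X)
    {P : Set (E d)} (hP : P ∈ tilesOf X) (t : E d) : t +ᵥ P ∈ tilesOf X := by
  obtain ⟨x, hx, hPx⟩ := hP
  exact ⟨x.shift t, hX.invariant x hx t, vadd_mem_translate.2 hPx⟩

/-- A finite collection of tiles of one tiling in `X`. -/
def IsSubpatch {d : ℕ} (X : Set (Tiling d)) (y : Set (Set (E d))) : Prop :=
  y.Finite ∧ ∃ x ∈ X, y ⊆ x.tiles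

theorem IsSubpatch.isPatch {d : ℕ} {X : Set (Tiling d)} {y : Set (Set (E d))}
    (h : IsSubpatch X y) : IsPatch y := by
  obtain ⟨_, x, _, hyx⟩ := h
  exact x.isPatch.mono hyx

theorem IsSubpatch.mem_tilesOf {d : ℕ} {X : Set (Tiling d)} {y : Set (Set (E d))}
    (h : IsSubpatch X y) {P : Set (E d)} (hP : P ∈ y) : P ∈ tilesOf X := by
  obtain ⟨_, x, hx, hyx⟩ := h
  exact ⟨x, hx, hyx hP⟩

theorem IsSubpatch.mono {d : ℕ} {X : Set (Tiling d)} {y z : Set (Set (E d))}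
    (h : IsSubpatch X y) (hz : z ⊆ y) : IsSubpatch X z := by
  obtain ⟨hf, x, hx, hyx⟩ := h
  exact ⟨hf.subset hz, x, hx, hz.trans hyx⟩

theorem IsTilingSpace.isSubpatch_translate {d : ℕ} {X : Set (Tiling d)} (hX : IsTilingSpace X)
    {y : Set (Set (E d))} (h : IsSubpatch X y) (t : E d) : IsSubpatch X (translate t y) := by
  obtain ⟨hf, x, hx, hyx⟩ := h
  exact ⟨hf.image _, x.shift t, hX.invariant x hx t, translate_mono t hyx⟩

theorem isSubpatch_singleton {d : ℕ} {X : Set (Tiling d)} {P : Set (E d)} (hP : P ∈ tilesOf X) :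
    IsSubpatch X {P} := by
  obtain ⟨x, hx, hPx⟩ := hP
  exact ⟨finite_singleton _, x, hx, singleton_subset_iff.2 hPx⟩

theorem isSubpatch_of_mem_patchesOf {d N : ℕ} {X : Set (Tiling d)} {q : Set (Set (E d))}
    (h : q ∈ patchesOf X N) : IsSubpatch X q := ⟨h.1, h.2.2.2⟩

theorem IsTilingSpace.translate_mem_patchesOf {d N : ℕ} {X : Set (Tiling d)}
    (hX : IsTilingSpace X) {q : Set (Set (E d))} (h : q ∈ patchesOf X N) (t : E d) :
    translate t q ∈ patchesOf X N := by
  have h' := hX.isSubpatch_translate (isSubpatch_of_mem_patchesOf h) t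
  refine ⟨h'.1, by rw [ncard_translate, h.2.1], ?_, h'.2⟩
  rw [supp_translate]
  exact h.2.2.1.image _ (continuous_const_vadd t).continuousOn

theorem nonempty_of_mem_patchesOf {d N : ℕ} {X : Set (Tiling d)} {q : Set (Set (E d))}
    (h : q ∈ patchesOf X N) : q.Nonempty := by
  obtain ⟨v, P, hP, _⟩ := h.2.2.1.nonempty
  exact ⟨P, hP⟩

theorem singleton_mem_patchesOf {d : ℕ} {X : Set (Tiling d)} {P : Set (E d)}
    (hP : P ∈ tilesOf X) : {P} ∈ patchesOf X 1 := by
  refine ⟨finite_singleton _, ncard_singleton _, ?_, (isSubpatch_singleton hP).2⟩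
  rw [supp, sUnion_singleton]
  exact (isTile_of_mem_tilesOf hP).2.1

theorem IsSubpatch.isBounded_supp {d : ℕ} {X : Set (Tiling d)} {y : Set (Set (E d))}
    (h : IsSubpatch X y) : Bornology.IsBounded (supp y) :=
  MultiSubst.isBounded_supp h.1 h.isPatch.1

theorem eq_of_translate_eq_of_mem_patchesOf {d N : ℕ} {X : Set (Tiling d)} {q : Set (Set (E d))}
    (h : q ∈ patchesOf X N) {s t : E d} (hst : translate s q = translate t q) : s = t :=
  eq_of_translate_eq h.2.2.1.nonempty (isSubpatch_of_mem_patchesOf h).isBounded_supp hst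

theorem HasPrototiles.exists_diam_le {d l : ℕ} {X : Set (Tiling d)} {D : Fin l → Set (E d)}
    (h : HasPrototiles X D) :
    ∃ δ : ℝ, 0 < δ ∧ ∀ P ∈ tilesOf X, ∀ u ∈ P, ∀ v ∈ P, dist u v ≤ δ := by
  have h1 : ∀ i, ∃ C : ℝ, ∀ u ∈ D i, ∀ v ∈ D i, dist u v ≤ C := fun i => by
    obtain ⟨C, hC⟩ := Metric.isBounded_iff.1 (h.isTile i).isBounded
    exact ⟨C, fun u hu v hv => hC hu hv⟩
  choose C hC using h1
  obtain ⟨M, hM⟩ := (Set.finite_range C).bddAbove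
  refine ⟨max M 1, by positivity, fun P hP u hu v hv => ?_⟩
  obtain ⟨i, t, rfl⟩ := h.complete P hP
  obtain ⟨u, hu, rfl⟩ := hu
  obtain ⟨v, hv, rfl⟩ := hv
  simp only [dist_vadd_cancel_left]
  exact (hC i u hu v hv).trans ((hM (mem_range_self i)).trans (le_max_left _ _))

theorem HasPrototiles.exists_le_volume {d l : ℕ} {X : Set (Tiling d)} {D : Fin l → Set (E d)}
    (h : HasPrototiles X D) :
    ∃ v : ℝ, 0 < v ∧ ∀ P ∈ tilesOf X, v ≤ volume.real (interior P) := by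
  obtain ⟨v, hv, hvD⟩ : ∃ v : ℝ, 0 < v ∧ ∀ i, v ≤ volume.real (interior (D i)) := by
    rcases isEmpty_or_nonempty (Fin l) with hl | hl
    · exact ⟨1, one_pos, fun i => hl.elim i⟩
    · obtain ⟨i, hi⟩ := Finite.exists_min fun i => volume.real (interior (D i))
      exact ⟨_, (h.isTile i).volume_interior_pos, hi⟩
  refine ⟨v, hv, fun P hP => ?_⟩
  obtain ⟨i, t, rfl⟩ := h.complete P hP
  rw [volumeReal_interior_vadd]
  exact hvD i

/-! ### Finite local complexity -/

/-- The tiles touching a given tile in some tiling of `X`. -/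
def neighbors {d : ℕ} (X : Set (Tiling d)) (P : Set (E d)) : Set (Set (E d)) :=
  {Q | ∃ x ∈ X, P ∈ x.tiles ∧ Q ∈ x.tiles ∧ (P ∩ Q).Nonempty}

/-- A two-tile patch through `P` is a translate of one of finitely many patterns, and the
translation is fixed once it is known which tile of the pattern goes to `P`. -/
theorem IsTilingSpace.finite_neighbors {d : ℕ} {X : Set (Tiling d)} (hX : IsTilingSpace X)
    (P : Set (E d)) : (neighbors X P).Finite := by
  by_cases hPX : P ∈ tilesOf X
  swap
  · convert Set.finite_empty
    refine eq_empty_of_forall_notMem fun Q hQ => hPX ?_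
    obtain ⟨x, hx, hP, _⟩ := hQ
    exact ⟨x, hx, hP⟩
  have hP := isTile_of_mem_tilesOf hPX
  obtain ⟨F, hF, hFX⟩ := hX.flc
  -- The finite list `F` may contain irrelevant infinite collections, hence the restriction to its
  -- finite members.
  have hfin : (⋃ y ∈ {y ∈ F | y.Finite}, ⋃ P₁ ∈ y,
      ⋃ s ∈ {s : E d | P = s +ᵥ P₁}, translate s y).Finite := by
    refine (hF.subset (sep_subset _ _)).biUnion fun y hy => ?_
    refine Set.Finite.biUnion hy.2 fun P₁ _ => ?_
    refine Set.Finite.biUnion (Set.Subsingleton.finite ?_) fun s _ => hy.2.image _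
    rintro s (hs : P = _) t (ht : P = _)
    have h1 : -s +ᵥ P = P₁ := by rw [hs, neg_vadd_vadd]
    have h2 : -t +ᵥ P = P₁ := by rw [ht, neg_vadd_vadd]
    exact neg_injective (eq_of_vadd_eq_vadd hP.nonempty hP.isBounded (h1.trans h2.symm))
  refine (hfin.insert P).subset ?_
  rintro Q ⟨x, hx, hPx, hQx, hPQ⟩
  rcases eq_or_ne P Q with rfl | hne
  · exact mem_insert _ _
  refine mem_insert_of_mem _ ?_
  have hpair : ({P, Q} : Set (Set (E d))) ∈ patchesOf X 2 := by
    refine ⟨toFinite _, ncard_pair hne, ?_, x, hx, ?_⟩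
    · rw [supp, sUnion_pair]
      exact IsConnected.union hPQ hP.2.1 (x.isPatch.1 Q hQx).2.1
    · exact insert_subset hPx (singleton_subset_iff.2 hQx)
  obtain ⟨y, hy, t, ht⟩ := hFX _ hpair
  have hPy : P ∈ translate t y := by rw [← ht]; simp
  have hQy : Q ∈ translate t y := by rw [← ht]; simp
  have hyf : y.Finite := by
    have : (translate (-t) {P, Q}).Finite := (toFinite {P, Q}).image _
    rwa [ht, translate_translate, neg_add_cancel, translate_zero] at this
  simp only [mem_iUnion]
  exact ⟨y, ⟨hy, hyf⟩, -t +ᵥ P, mem_translate.1 hPy, t, by simp, hQy⟩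

/-- The tiles reachable from `P` by chains of `n` neighbors. -/
def reach {d : ℕ} (X : Set (Tiling d)) (P : Set (E d)) : ℕ → Set (Set (E d))
  | 0 => {P}
  | n + 1 => reach X P n ∪ ⋃ Q ∈ reach X P n, neighbors X Q

theorem IsTilingSpace.finite_reach {d : ℕ} {X : Set (Tiling d)} (hX : IsTilingSpace X)
    (P : Set (E d)) (n : ℕ) : (reach X P n).Finite := by
  induction n with
  | zero => exact finite_singleton _
  | succ n ih => exact ih.union (ih.biUnion fun Q _ => hX.finite_neighbors Q)

/-- While `q` is not exhausted, the tiles already reached and the remaining ones have closed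
supports covering the connected support of `q`. These meet, so the next step gains a tile. -/
theorem subset_reach {d N : ℕ} {X : Set (Tiling d)} {q : Set (Set (E d))} (hq : q ∈ patchesOf X N)
    {P : Set (E d)} (hP : P ∈ q) : q ⊆ reach X P N := by
  have hPmem : ∀ n, P ∈ reach X P n := fun n => by
    induction n with
    | zero => exact rfl
    | succ n ih => exact Or.inl ih
  have key : ∀ n, q ⊆ reach X P n ∨ n < (q ∩ reach X P n).ncard := by
    intro n
    induction n with
    | zero =>
      right
      rw [Set.ncard_pos (hq.1.inter_of_left _)]
      exact ⟨P, hP, hPmem 0⟩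
    | succ n ih =>
      rcases ih with ih | ih
      · exact Or.inl fun Q hQ => Or.inl (ih hQ)
      by_cases hsub : q ⊆ reach X P n
      · exact Or.inl fun Q hQ => Or.inl (hsub hQ)
      right
      obtain ⟨hfin, -, hconn, x, hx, hqx⟩ := hq
      have htile : ∀ Q ∈ q, IsTile Q := fun Q hQ => x.isPatch.1 Q (hqx hQ)
      obtain ⟨Q, hQ, hQn⟩ := not_subset.1 hsub
      have h1 := isPreconnected_closed_iff.1 hconn.isPreconnected (supp (q ∩ reach X P n))
        (supp (q \ reach X P n))
        (isClosed_supp (hfin.inter_of_left _) fun R hR => htile R hR.1)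
        (isClosed_supp hfin.sdiff fun R hR => htile R hR.1)
        (by
          rintro v ⟨R, hR, hv⟩
          by_cases hRn : R ∈ reach X P n
          · exact Or.inl ⟨R, ⟨hR, hRn⟩, hv⟩
          · exact Or.inr ⟨R, ⟨hR, hRn⟩, hv⟩)
        (by
          obtain ⟨v, hv⟩ := (htile P hP).nonempty
          exact ⟨v, ⟨P, hP, hv⟩, ⟨P, ⟨hP, hPmem n⟩, hv⟩⟩)
        (by
          obtain ⟨v, hv⟩ := (htile Q hQ).nonempty
          exact ⟨v, ⟨Q, hQ, hv⟩, ⟨Q, ⟨hQ, hQn⟩, hv⟩⟩)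
      obtain ⟨v, -, ⟨R, hR, hvR⟩, ⟨R', hR', hvR'⟩⟩ := h1
      refine lt_of_le_of_lt (Nat.succ_le_of_lt ih) (Set.ncard_lt_ncard ?_ (hfin.inter_of_left _))
      refine (ssubset_iff_of_subset
        (inter_subset_inter_right _ subset_union_left)).2 ⟨R', ⟨hR'.1, Or.inr ?_⟩, ?_⟩
      · simp only [mem_iUnion]
        exact ⟨R, hR.2, x, hx, hqx hR.1, hqx hR'.1, v, hvR, hvR'⟩
      · exact fun h => hR'.2 h.2
  rcases key N with h | h
  · exact h
  · have := Set.ncard_le_ncard (inter_subset_left (s := q) (t := reach X P N)) hq.1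
    rw [hq.2.1] at this
    omega

/-- A canonical representative of the translation class of a collection of tiles. -/
noncomputable def rep {d : ℕ} (q : Set (Set (E d))) : Set (Set (E d)) :=
  Quotient.out (Quotient.mk (AddAction.orbitRel (E d) (Set (Set (E d)))) q)

theorem exists_rep_eq_translate {d : ℕ} (q : Set (Set (E d))) : ∃ t, rep q = translate t q := by
  have h := Quotient.mk_out (s := AddAction.orbitRel (E d) (Set (Set (E d)))) q
  obtain ⟨t, ht⟩ := AddAction.orbitRel_apply.1 h
  exact ⟨t, ht.symm⟩

theorem rep_translate {d : ℕ} (t : E d) (q : Set (Set (E d))) : rep (translate t q) = rep q := by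
  unfold rep
  congr 1
  apply Quotient.sound
  exact AddAction.orbitRel_apply.2 ⟨t, rfl⟩

theorem exists_eq_translate_rep {d : ℕ} (q : Set (Set (E d))) : ∃ t, q = translate t (rep q) := by
  obtain ⟨t, ht⟩ := exists_rep_eq_translate q
  exact ⟨-t, by rw [ht, translate_translate, neg_add_cancel, translate_zero]⟩

theorem rep_rep {d : ℕ} (q : Set (Set (E d))) : rep (rep q) = rep q := by
  obtain ⟨t, ht⟩ := exists_rep_eq_translate q
  rw [ht, rep_translate, ht]

/-- Representatives of the connected patches with at most `N` tiles. -/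
def patchReps {d : ℕ} (X : Set (Tiling d)) (N : ℕ) : Set (Set (Set (E d))) :=
  rep '' {q | ∃ k ≤ N, q ∈ patchesOf X k}

/-- After a translation the patch contains a prototile, and is then a subset of the finite set of
tiles reachable from it. -/
theorem HasPrototiles.finite_patchReps {d l : ℕ} {X : Set (Tiling d)} {D : Fin l → Set (E d)}
    (h : HasPrototiles X D) (N : ℕ) : (patchReps X N).Finite := by
  have hfin : (rep '' ⋃ k ∈ Iic N, ⋃ i, 𝒫 (reach X (D i) k)).Finite := by
    refine Set.Finite.image _ ((finite_Iic N).biUnion fun k _ => ?_)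
    exact finite_iUnion fun i => (h.space.finite_reach (D i) k).finite_subsets
  refine hfin.subset ?_
  rintro _ ⟨q, ⟨k, hk, hq⟩, rfl⟩
  obtain ⟨P, hP⟩ := nonempty_of_mem_patchesOf hq
  obtain ⟨i, t, rfl⟩ := h.complete P ((isSubpatch_of_mem_patchesOf hq).mem_tilesOf hP)
  refine ⟨translate (-t) q, ?_, rep_translate _ _⟩
  simp only [mem_iUnion]
  refine ⟨k, hk, i, ?_⟩
  apply subset_reach (h.space.translate_mem_patchesOf hq (-t))
  rw [mem_translate]
  simpa using hP

theorem IsTilingSpace.exists_mem_patchesOf_of_mem_patchReps {d N : ℕ} {X : Set (Tiling d)}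
    (hX : IsTilingSpace X) {q : Set (Set (E d))} (hq : q ∈ patchReps X N) :
    ∃ k ≤ N, q ∈ patchesOf X k := by
  obtain ⟨p, ⟨k, hk, hp⟩, rfl⟩ := hq
  obtain ⟨t, ht⟩ := exists_rep_eq_translate p
  exact ⟨k, hk, ht ▸ hX.translate_mem_patchesOf hp t⟩

theorem rep_eq_of_mem_patchReps {d N : ℕ} {X : Set (Tiling d)} {q : Set (Set (E d))}
    (hq : q ∈ patchReps X N) : rep q = q := by
  obtain ⟨p, -, rfl⟩ := hq
  exact rep_rep p

/-! ### Patches covering balls -/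

/-- The tiles of `x` meeting the ball of radius `R`. -/
def ballPatch {d : ℕ} (x : Tiling d) (R : ℝ) : Set (Set (E d)) :=
  {P | P ∈ x.tiles ∧ (P ∩ Metric.closedBall 0 R).Nonempty}

theorem ballPatch_subset {d : ℕ} (x : Tiling d) (R : ℝ) : ballPatch x R ⊆ x.tiles :=
  fun _ h => h.1

theorem closedBall_subset_supp_ballPatch {d : ℕ} (x : Tiling d) (R : ℝ) :
    Metric.closedBall 0 R ⊆ supp (ballPatch x R) := by
  intro v hv
  obtain ⟨P, hP, hvP⟩ : v ∈ supp x.tiles := by rw [x.covers]; trivial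
  exact ⟨P, ⟨hP, v, hvP, hv⟩, hvP⟩

theorem ballPatch_mono {d : ℕ} (x : Tiling d) {R R' : ℝ} (h : R ≤ R') :
    ballPatch x R ⊆ ballPatch x R' := fun _ hP =>
  ⟨hP.1, hP.2.mono (inter_subset_inter_right _ (Metric.closedBall_subset_closedBall h))⟩

/-- All tiles involved lie in the ball of radius `R + δ`, so volumes bound their number. The support
is connected because it contains the ball and each tile meets the ball. -/
theorem HasPrototiles.exists_ballPatch_mem {d l : ℕ} {X : Set (Tiling d)} {D : Fin l → Set (E d)}
    (h : HasPrototiles X D) {R : ℝ} (hR : 0 ≤ R) :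
    ∃ N, ∀ x ∈ X, ∃ k ≤ N, ballPatch x R ∈ patchesOf X k := by
  obtain ⟨δ, hδ, hdiam⟩ := h.exists_diam_le
  obtain ⟨v, hv, hvol⟩ := h.exists_le_volume
  refine ⟨⌊volume.real (Metric.closedBall (0 : E d) (R + δ)) / v⌋₊, fun x hx => ?_⟩
  have hmem : ∀ P ∈ ballPatch x R, P ∈ tilesOf X := fun P hP => ⟨x, hx, hP.1⟩
  have hb : ∀ P ∈ ballPatch x R, interior P ⊆ Metric.closedBall 0 (R + δ) := by
    rintro P hP u hu
    obtain ⟨w, hwP, hw⟩ := hP.2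
    have h1 := hdiam P (hmem P hP) u (interior_subset hu) w hwP
    rw [Metric.mem_closedBall] at hw ⊢
    linarith [dist_triangle u w 0]
  obtain ⟨hfin, hcard⟩ := (x.isPatch.mono (ballPatch_subset x R)).finite_and_ncard_le
    Metric.isBounded_closedBall hb hv fun P hP => hvol P (hmem P hP)
  refine ⟨_, ?_, hfin, rfl, ?_, x, hx, ballPatch_subset x R⟩
  · apply Nat.le_floor
    rwa [le_div_iff₀ hv]
  · have heq : supp (ballPatch x R) = ⋃ P : Option (ballPatch x R),
        (P.elim (Metric.closedBall 0 R) fun P => (P : Set (E d)) ∪ Metric.closedBall 0 R) := by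
      apply Subset.antisymm
      · rintro u ⟨P, hP, hu⟩
        exact mem_iUnion.2 ⟨some ⟨P, hP⟩, Or.inl hu⟩
      · refine iUnion_subset fun P => ?_
        rcases P with _ | P
        · exact closedBall_subset_supp_ballPatch x R
        · exact union_subset (subset_supp P.2) (closedBall_subset_supp_ballPatch x R)
    have hball : IsConnected (Metric.closedBall (0 : E d) R) :=
      (convex_closedBall _ _).isConnected ⟨0, Metric.mem_closedBall_self hR⟩
    rw [heq]
    refine ⟨⟨0, mem_iUnion.2 ⟨none, Metric.mem_closedBall_self hR⟩⟩, ?_⟩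
    refine isPreconnected_iUnion ⟨0, ?_⟩ ?_
    · rw [mem_iInter]
      rintro (_ | P)
      · exact Metric.mem_closedBall_self hR
      · exact Or.inr (Metric.mem_closedBall_self hR)
    · rintro (_ | P)
      · exact hball.isPreconnected
      · exact (IsConnected.union P.2.2 (isTile_of_mem_tilesOf (hmem P P.2)).2.1 hball).isPreconnected

theorem HasPrototiles.finite_ballPatch {d l : ℕ} {X : Set (Tiling d)} {D : Fin l → Set (E d)}
    (h : HasPrototiles X D) {x : Tiling d} (hx : x ∈ X) (R : ℝ) : (ballPatch x R).Finite := by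
  obtain ⟨N, hN⟩ := h.exists_ballPatch_mem (le_max_right R 0)
  obtain ⟨k, -, hk⟩ := hN x hx
  exact hk.1.subset (ballPatch_mono x (le_max_left R 0))

/-! ### Inflations and their compositions -/

/-- A substitution rule `T` with dilatation factor `Λ ≥ 1` acting on the tilings in `X`. -/
structure IsInflation {d : ℕ} (X : Set (Tiling d)) (T : Set (E d) → Set (Set (E d)))
    (Λ : ℝ) : Prop where
  one_le : 1 ≤ Λ
  finite : ∀ P ∈ tilesOf X, (T P).Finite
  supp_eq : ∀ P ∈ tilesOf X, supp (T P) = Λ • P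
  equivariant : ∀ P ∈ tilesOf X, ∀ t : E d, T (t +ᵥ P) = translate (Λ • t) (T P)
  maps_tiling : ∀ x ∈ X, ∃ y ∈ X, y.tiles = extend T x.tiles

theorem IsSubstitution.isInflation {d : ℕ} {X : Set (Tiling d)} {T : Set (E d) → Set (Set (E d))}
    {Λ : ℝ} (hX : IsTilingSpace X) (h : IsSubstitution X T Λ) : IsInflation X T Λ where
  one_le := h.one_lt.le
  finite P hP := by
    obtain ⟨N, hN⟩ := h.maps_tile P hP
    exact hN.1
  supp_eq := h.supp_eq
  equivariant P hP t := h.equivariant _ (hX.vadd_mem_tilesOf hP t) P hP t rfl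
  maps_tiling := h.maps_tiling

theorem mem_extend {d : ℕ} {T : Set (E d) → Set (Set (E d))} {y : Set (Set (E d))}
    {Q : Set (E d)} : Q ∈ extend T y ↔ ∃ P ∈ y, Q ∈ T P := by
  simp [extend]

theorem extend_mono {d : ℕ} {T : Set (E d) → Set (Set (E d))} {y z : Set (Set (E d))}
    (h : y ⊆ z) : extend T y ⊆ extend T z :=
  biUnion_subset_biUnion_left h

theorem subset_extend {d : ℕ} {T : Set (E d) → Set (Set (E d))} {y : Set (Set (E d))}
    {P : Set (E d)} (h : P ∈ y) : T P ⊆ extend T y := fun _ hQ => mem_extend.2 ⟨P, h, hQ⟩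

theorem extend_singleton {d : ℕ} (T : Set (E d) → Set (Set (E d))) (P : Set (E d)) :
    extend T {P} = T P := by simp [extend]

theorem extend_singletons {d : ℕ} (y : Set (Set (E d))) :
    extend (fun P => {P}) y = y := by simp [extend]

theorem extend_extend {d : ℕ} (T₁ T₂ : Set (E d) → Set (Set (E d))) (y : Set (Set (E d))) :
    extend T₁ (extend T₂ y) = extend (fun P => extend T₁ (T₂ P)) y := by
  ext Q
  simp only [mem_extend]
  constructor
  · rintro ⟨P, ⟨R, hR, hPR⟩, hQ⟩
    exact ⟨R, hR, P, hPR, hQ⟩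
  · rintro ⟨R, hR, P, hPR, hQ⟩
    exact ⟨P, ⟨R, hR, hPR⟩, hQ⟩

theorem isInflation_singletons {d : ℕ} (X : Set (Tiling d)) :
    IsInflation X (fun P => {P}) 1 where
  one_le := le_rfl
  finite _ _ := finite_singleton _
  supp_eq P _ := by simp [supp]
  equivariant P _ t := by simp [translate]
  maps_tiling x hx := ⟨x, hx, (extend_singletons _).symm⟩

section

variable {d : ℕ} {X : Set (Tiling d)} {T : Set (E d) → Set (Set (E d))} {Λ : ℝ}

theorem IsInflation.pos (h : IsInflation X T Λ) : 0 < Λ := one_pos.trans_le h.one_le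

theorem IsInflation.mem_tilesOf (h : IsInflation X T Λ) {P Q : Set (E d)} (hP : P ∈ tilesOf X)
    (hQ : Q ∈ T P) : Q ∈ tilesOf X := by
  obtain ⟨x, hx, hPx⟩ := hP
  obtain ⟨y, hy, hyx⟩ := h.maps_tiling x hx
  exact ⟨y, hy, hyx ▸ subset_extend hPx hQ⟩

theorem IsInflation.subset_smul (h : IsInflation X T Λ) {P Q : Set (E d)} (hP : P ∈ tilesOf X)
    (hQ : Q ∈ T P) : Q ⊆ Λ • P := h.supp_eq P hP ▸ subset_supp hQ

theorem IsInflation.nonempty (h : IsInflation X T Λ) {P : Set (E d)} (hP : P ∈ tilesOf X) :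
    (T P).Nonempty := by
  obtain ⟨v, hv⟩ := (isTile_of_mem_tilesOf hP).nonempty
  have : Λ • v ∈ supp (T P) := by
    rw [h.supp_eq P hP]
    exact smul_mem_smul_set hv
  obtain ⟨Q, hQ, _⟩ := this
  exact ⟨Q, hQ⟩

theorem IsInflation.supp_extend (h : IsInflation X T Λ) {y : Set (Set (E d))}
    (hy : ∀ P ∈ y, P ∈ tilesOf X) : supp (extend T y) = Λ • supp y := by
  ext v
  simp only [supp, mem_sUnion, mem_extend]
  constructor
  · rintro ⟨Q, ⟨P, hP, hQ⟩, hv⟩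
    obtain ⟨w, hw, rfl⟩ := h.subset_smul (hy P hP) hQ hv
    exact smul_mem_smul_set ⟨P, hP, hw⟩
  · rintro ⟨w, ⟨P, hP, hw⟩, rfl⟩
    have : Λ • w ∈ supp (T P) := by
      rw [h.supp_eq P (hy P hP)]
      exact smul_mem_smul_set hw
    obtain ⟨Q, hQ, hQw⟩ := this
    exact ⟨Q, ⟨P, hP, hQ⟩, hQw⟩

theorem IsInflation.isSubpatch_extend (h : IsInflation X T Λ) {y : Set (Set (E d))}
    (hy : IsSubpatch X y) : IsSubpatch X (extend T y) := by
  have hfin : (extend T y).Finite := hy.1.biUnion fun P hP => h.finite P (hy.mem_tilesOf hP)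
  obtain ⟨x, hx, hyx⟩ := hy.2
  obtain ⟨z, hz, hzx⟩ := h.maps_tiling x hx
  exact ⟨hfin, z, hz, hzx ▸ extend_mono hyx⟩

theorem IsInflation.isSubpatch (h : IsInflation X T Λ) {P : Set (E d)}
    (hP : P ∈ tilesOf X) : IsSubpatch X (T P) := by
  rw [← extend_singleton T P]
  exact h.isSubpatch_extend (isSubpatch_singleton hP)

theorem IsInflation.extend_translate (h : IsInflation X T Λ) {y : Set (Set (E d))}
    (hy : ∀ P ∈ y, P ∈ tilesOf X) (t : E d) :
    extend T (translate t y) = translate (Λ • t) (extend T y) := by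
  ext Q
  rw [mem_translate, mem_extend, mem_extend]
  constructor
  · rintro ⟨_, ⟨P, hP, rfl⟩, hQ⟩
    rw [h.equivariant P (hy P hP)] at hQ
    exact ⟨P, hP, mem_translate.1 hQ⟩
  · rintro ⟨P, hP, hQ⟩
    refine ⟨t +ᵥ P, ⟨P, hP, rfl⟩, ?_⟩
    rwa [h.equivariant P (hy P hP), mem_translate]

theorem IsInflation.interior_subset_smul (h : IsInflation X T Λ) {P Q : Set (E d)}
    (hP : P ∈ tilesOf X) (hQ : Q ∈ T P) : interior Q ⊆ Λ • interior P := by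
  rw [← interior_smul₀ h.pos.ne']
  exact interior_mono (h.subset_smul hP hQ)

/-- Tiles of `T P` have their interiors in `Λ • interior P`, and these sets are disjoint for
distinct `P` of a patch. So a tile of an inflated patch has a unique parent. -/
theorem IsInflation.eq_of_mem (h : IsInflation X T Λ) {y : Set (Set (E d))}
    (hy : IsSubpatch X y) {P P' Q : Set (E d)} (hP : P ∈ y) (hP' : P' ∈ y) (hQ : Q ∈ T P)
    (hQ' : Q ∈ T P') : P = P' := by
  apply hy.isPatch.eq_of_interior hP hP'
  obtain ⟨v, hv⟩ :=
    (isTile_of_mem_tilesOf (h.mem_tilesOf (hy.mem_tilesOf hP) hQ)).interior_nonempty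
  obtain ⟨w, hw, rfl⟩ := h.interior_subset_smul (hy.mem_tilesOf hP) hQ hv
  have := h.interior_subset_smul (hy.mem_tilesOf hP') hQ' hv
  rw [smul_mem_smul_set_iff₀ h.pos.ne'] at this
  exact ⟨w, hw, this⟩

theorem IsInflation.comp {T' : Set (E d) → Set (Set (E d))} {Λ' : ℝ} (h : IsInflation X T Λ)
    (h' : IsInflation X T' Λ') : IsInflation X (fun P => extend T (T' P)) (Λ * Λ') where
  one_le := one_le_mul_of_one_le_of_one_le h.one_le h'.one_le
  finite P hP := (h.isSubpatch_extend (h'.isSubpatch hP)).1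
  supp_eq P hP := by
    rw [h.supp_extend fun Q hQ => h'.mem_tilesOf hP hQ, h'.supp_eq P hP, smul_smul]
  equivariant P hP t := by
    rw [h'.equivariant P hP, h.extend_translate fun Q hQ => h'.mem_tilesOf hP hQ, smul_smul]
  maps_tiling x hx := by
    obtain ⟨y, hy, hyx⟩ := h'.maps_tiling x hx
    obtain ⟨z, hz, hzy⟩ := h.maps_tiling y hy
    exact ⟨z, hz, by rw [hzy, hyx, extend_extend]⟩

end

/-- The dilatation factor of `S_a^n`. -/
def dil {J : Type*} (lam : J → ℝ) (a : ℕ → J) (n : ℕ) : ℝ := ∏ r ∈ Finset.range n, lam (a r)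

theorem superTile_succ {d : ℕ} {J : Type*} (S : J → Set (E d) → Set (Set (E d))) (a : ℕ → J)
    (n : ℕ) (P : Set (E d)) :
    superTile S a (n + 1) P = extend (S (a 0)) (superTile S (fun r => a (r + 1)) n P) := rfl

/-- The first letter acts last, so the final `m` letters, which form the shifted sequence, act first
on the tile. This is why renormalization shifts the sequence. -/
theorem superTile_add {d : ℕ} {J : Type*} (S : J → Set (E d) → Set (Set (E d))) (a : ℕ → J)
    (n m : ℕ) (P : Set (E d)) :
    superTile S a (n + m) P = extend (superTile S a n) (superTile S (fun r => a (n + r)) m P) := by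
  induction n generalizing a with
  | zero =>
    have : superTile S a 0 = fun P => {P} := rfl
    rw [this, extend_singletons]
    simp
  | succ n ih =>
    rw [show n + 1 + m = n + m + 1 by ring, superTile_succ, ih, extend_extend]
    simp only [← superTile_succ]
    congr 2
    ext r
    congr 1
    ring

theorem superTile_congr {d : ℕ} {J : Type*} (S : J → Set (E d) → Set (Set (E d))) {a b : ℕ → J}
    {n : ℕ} (h : ∀ r < n, a r = b r) : superTile S a n = superTile S b n := by
  induction n generalizing a b with
  | zero => rfl
  | succ n ih =>
    ext1 P
    rw [superTile_succ, superTile_succ, h 0 (Nat.succ_pos n),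
      ih fun r hr => h (r + 1) (Nat.succ_lt_succ hr)]

theorem dil_congr {J : Type*} (lam : J → ℝ) {a b : ℕ → J} {n : ℕ} (h : ∀ r < n, a r = b r) :
    dil lam a n = dil lam b n :=
  Finset.prod_congr rfl fun r hr => by rw [h r (Finset.mem_range.1 hr)]

theorem dil_add {J : Type*} (lam : J → ℝ) (a : ℕ → J) (n m : ℕ) :
    dil lam a (n + m) = dil lam a n * dil lam (fun r => a (n + r)) m :=
  Finset.prod_range_add _ _ _

theorem isInflation_superTile {d : ℕ} {J : Type*} {X : Set (Tiling d)}
    {S : J → Set (E d) → Set (Set (E d))} {lam : J → ℝ} (hS : ∀ j, IsInflation X (S j) (lam j))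
    (a : ℕ → J) (n : ℕ) : IsInflation X (superTile S a n) (dil lam a n) := by
  induction n generalizing a with
  | zero =>
    have : dil lam a 0 = 1 := by simp [dil]
    rw [this]
    exact isInflation_singletons X
  | succ n ih =>
    have : dil lam a (n + 1) = lam (a 0) * dil lam (fun r => a (r + 1)) n := by
      rw [dil, Finset.prod_range_succ', mul_comm]
      rfl
    rw [this]
    exact (hS (a 0)).comp (ih _)

theorem pow_le_dil {J : Type*} {lam : J → ℝ} {m : ℝ} (hm : 0 ≤ m) (h : ∀ j, m ≤ lam j)
    (a : ℕ → J) (n : ℕ) : m ^ n ≤ dil lam a n := by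
  rw [dil, ← Finset.card_range n, ← Finset.prod_const]
  simp only [Finset.card_range]
  exact Finset.prod_le_prod (fun _ _ => hm) fun r _ => h (a r)

/-! ### Counting positions of patches -/

/-- The set of positions of `q` in `y`. -/
def positions {d : ℕ} (q y : Set (Set (E d))) : Set (E d) := {t | translate t q ⊆ y}

/-- The number of positions of `q` in `y`. -/
noncomputable def cnt {d : ℕ} (q y : Set (Set (E d))) : ℕ := (positions q y).ncard

theorem positions_mono {d : ℕ} {q y z : Set (Set (E d))} (h : y ⊆ z) :
    positions q y ⊆ positions q z := fun _ ht => Subset.trans ht h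

theorem positions_translate_left {d : ℕ} (s : E d) (q y : Set (Set (E d))) :
    positions (translate s q) y = (fun t => -s + t) '' positions q y := by
  ext t
  simp only [positions, mem_ofPred_eq, translate_translate, mem_image]
  constructor
  · intro h
    exact ⟨t + s, h, by abel⟩
  · rintro ⟨u, hu, rfl⟩
    convert hu using 2
    abel

theorem cnt_translate_left {d : ℕ} (s : E d) (q y : Set (Set (E d))) :
    cnt (translate s q) y = cnt q y := by
  rw [cnt, positions_translate_left, ncard_image_of_injective _ (add_right_injective _), cnt]

section

variable {d : ℕ} {q : Set (Set (E d))} {P : Set (E d)}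

theorem IsTile.vadd_injective (hP : IsTile P) : Function.Injective fun t : E d => t +ᵥ P :=
  fun _ _ h => eq_of_vadd_eq_vadd hP.nonempty hP.isBounded h

theorem vadd_mem_of_mem_positions {y : Set (Set (E d))} (hPq : P ∈ q) {t : E d}
    (ht : t ∈ positions q y) : t +ᵥ P ∈ y := ht (vadd_mem_translate.2 hPq)

theorem finite_positions (hP : IsTile P) (hPq : P ∈ q) {y : Set (Set (E d))} (hy : y.Finite) :
    (positions q y).Finite :=
  Set.Finite.of_finite_image (f := fun t => t +ᵥ P) (hy.subset (by
    rintro _ ⟨t, ht, rfl⟩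
    exact vadd_mem_of_mem_positions hPq ht)) hP.vadd_injective.injOn

theorem cnt_le_ncard (hP : IsTile P) (hPq : P ∈ q) {y : Set (Set (E d))} (hy : y.Finite) :
    cnt q y ≤ y.ncard :=
  ncard_le_ncard_of_injOn (fun t => t +ᵥ P) (fun _ ht => vadd_mem_of_mem_positions hPq ht)
    hP.vadd_injective.injOn hy

end

theorem copies_eq_cnt {d : ℕ} {q : Set (Set (E d))}
    (hq : Function.Injective fun t : E d => translate t q) (y : Set (Set (E d))) :
    copies q y = cnt q y := by
  rw [copies, cnt, ← ncard_image_of_injective _ (f := fun t => translate t q) hq]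
  congr 1
  ext p
  constructor
  · rintro ⟨hp, t, rfl⟩
    exact ⟨t, hp, rfl⟩
  · rintro ⟨t, ht, rfl⟩
    exact ⟨ht, t, rfl⟩

theorem copies_singleton {d : ℕ} {P : Set (E d)} (hP : IsTile P) (y : Set (Set (E d))) :
    copies {P} y = cnt {P} y :=
  copies_eq_cnt (fun _ _ h => hP.vadd_injective (by
    simpa [translate] using h)) y

theorem volumeReal_smul {d : ℕ} {Λ : ℝ} (hΛ : 0 ≤ Λ) (K : Set (E d)) :
    volume.real (Λ • K) = Λ ^ d * volume.real K := by
  rw [measureReal_def, Measure.addHaar_smul, ENNReal.toReal_mul, ENNReal.toReal_ofReal (abs_nonneg _)]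
  simp [abs_of_nonneg hΛ, measureReal_def]

theorem volumeReal_vadd {d : ℕ} (t : E d) (P : Set (E d)) :
    volume.real (t +ᵥ P) = volume.real P := by
  rw [measureReal_def, measureReal_def, measure_vadd]

theorem volumeReal_closedBall {d : ℕ} (x : E d) {r : ℝ} (hr : 0 ≤ r) :
    volume.real (Metric.closedBall x r) = r ^ d * volume.real (Metric.closedBall (0 : E d) 1) := by
  rw [measureReal_def, Measure.addHaar_closedBall' _ _ hr, ENNReal.toReal_mul,
    ENNReal.toReal_ofReal (by positivity)]
  simp [measureReal_def]

theorem HasPrototiles.exists_volume_le {d l : ℕ} {X : Set (Tiling d)} {D : Fin l → Set (E d)}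
    (h : HasPrototiles X D) :
    ∃ V : ℝ, 0 < V ∧ ∀ P ∈ tilesOf X, volume.real P ≤ V := by
  obtain ⟨M, hM⟩ := (Set.finite_range fun i => volume.real (D i)).bddAbove
  refine ⟨max M 1, by positivity, fun P hP => ?_⟩
  obtain ⟨i, t, rfl⟩ := h.complete P hP
  rw [volumeReal_vadd]
  exact (hM (mem_range_self i)).trans (le_max_left _ _)

/-! ### Neighborhoods of tile boundaries -/

/-- The iterates of a single inflation. -/
noncomputable def iter {d : ℕ} (T : Set (E d) → Set (Set (E d))) (n : ℕ) :
    Set (E d) → Set (Set (E d)) := superTile (fun _ : Unit => T) (fun _ => ()) n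

theorem IsInflation.isInflation_iter {d : ℕ} {X : Set (Tiling d)} {T : Set (E d) → Set (Set (E d))} {Λ : ℝ}
    (h : IsInflation X T Λ) (n : ℕ) : IsInflation X (iter T n) (Λ ^ n) := by
  have := isInflation_superTile (J := Unit) (lam := fun _ => Λ) (fun _ => h) (fun _ => ()) n
  simp only [dil, Finset.prod_const, Finset.card_range] at this
  exact this

/-- After enough iterations, the inflation of each tile has a tile in its interior. -/
theorem HasPrototiles.exists_iter_interior {d l : ℕ} {X : Set (Tiling d)} {D : Fin l → Set (E d)}
    (hX : HasPrototiles X D) {T : Set (E d) → Set (Set (E d))} {Λ : ℝ} (h : IsInflation X T Λ)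
    (hΛ : 1 < Λ) :
    ∃ n : ℕ, 0 < n ∧ ∀ P ∈ tilesOf X, ∃ Q ∈ iter T n P, Q ⊆ interior (Λ ^ n • P) := by
  obtain ⟨δ, hδ, hdiam⟩ := hX.exists_diam_le
  have h1 : ∀ i, ∃ r : ℝ, 0 < r ∧ ∃ v, Metric.closedBall v r ⊆ D i := fun i => by
    obtain ⟨v, hv⟩ := (hX.isTile i).interior_nonempty
    obtain ⟨r, hr, hvr⟩ := Metric.nhds_basis_closedBall.mem_iff.1 (mem_interior_iff_mem_nhds.1 hv)
    exact ⟨r, hr, v, hvr⟩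
  choose r hr v hv using h1
  obtain ⟨m, hm, hmr⟩ : ∃ m : ℝ, 0 < m ∧ ∀ i, m ≤ r i := by
    rcases isEmpty_or_nonempty (Fin l) with hl | hl
    · exact ⟨1, one_pos, fun i => hl.elim i⟩
    · obtain ⟨i, hi⟩ := Finite.exists_min r
      exact ⟨_, hr i, hi⟩
  -- Every tile contains a ball of radius `m`. Once the inflated radius exceeds the diameter bound
  -- `δ`, a tile covering the center of the inflated ball stays inside this ball.
  obtain ⟨n, hn⟩ := pow_unbounded_of_one_lt (δ / m) hΛ
  refine ⟨n + 1, Nat.succ_pos n, fun P hP => ?_⟩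
  have hn' : δ < Λ ^ (n + 1) * m := by
    rw [div_lt_iff₀ hm] at hn
    refine hn.trans_le (mul_le_mul_of_nonneg_right ?_ hm.le)
    exact pow_le_pow_right₀ hΛ.le (Nat.le_succ n)
  have hinf := h.isInflation_iter (n + 1)
  obtain ⟨i, t, rfl⟩ := hX.complete P hP
  have hball : Metric.closedBall (Λ ^ (n + 1) • (t + v i)) (Λ ^ (n + 1) * m) ⊆
      Λ ^ (n + 1) • (t +ᵥ D i) := by
    have : Metric.closedBall (Λ ^ (n + 1) • (t + v i)) (Λ ^ (n + 1) * m) =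
        Λ ^ (n + 1) • Metric.closedBall (t + v i) m := by
      rw [smul_closedBall _ _ hm.le, Real.norm_of_nonneg hinf.pos.le]
    rw [this]
    apply smul_set_mono
    intro u hu
    rw [mem_vadd_set_iff_neg_vadd_mem]
    apply hv i
    apply Metric.closedBall_subset_closedBall (hmr i)
    rw [Metric.mem_closedBall, dist_eq_norm] at hu ⊢
    convert hu using 2
    simp only [vadd_eq_add]
    abel
  have hmem : Λ ^ (n + 1) • (t + v i) ∈ supp (iter T (n + 1) (t +ᵥ D i)) := by
    rw [hinf.supp_eq _ hP]
    exact hball (Metric.mem_closedBall_self (mul_nonneg hinf.pos.le hm.le))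
  obtain ⟨Q, hQ, hvQ⟩ := hmem
  refine ⟨Q, hQ, fun u hu => interior_maximal (Metric.ball_subset_closedBall.trans hball)
    Metric.isOpen_ball ?_⟩
  exact (hdiam Q (hinf.mem_tilesOf hP hQ) u hu _ hvQ).trans_lt hn'

/-- The tiles of `y` which are not contained in the interior of `K`. -/
def outer {d : ℕ} (y : Set (Set (E d))) (K : Set (E d)) : Set (Set (E d)) :=
  {Q | Q ∈ y ∧ ¬ Q ⊆ interior K}

/-- Children of an interior tile are interior, so outer tiles have outer parents. Each parent `Q`
also has a child `c Q` inside, of volume at least `v`, which is not outer; the factor `ρ` records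
this loss. -/
theorem IsInflation.sum_outer_le {d : ℕ} {X : Set (Tiling d)} {T : Set (E d) → Set (Set (E d))}
    {Λ : ℝ} (h : IsInflation X T Λ) {v ρ : ℝ}
    (hv : ∀ P ∈ tilesOf X, v ≤ volume.real (interior P))
    (hρ : ∀ P ∈ tilesOf X, Λ ^ d * volume.real (interior P) - v ≤
      ρ * (Λ ^ d * volume.real (interior P)))
    (hT : ∀ P ∈ tilesOf X, ∃ Q ∈ T P, Q ⊆ interior (Λ • P)) {P : Set (E d)} (hP : P ∈ tilesOf X)
    (n : ℕ) :
    ∑ᶠ Q ∈ outer (iter T (n + 1) P) (Λ ^ (n + 1) • P), volume.real (interior Q) ≤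
      ρ * Λ ^ d * ∑ᶠ Q ∈ outer (iter T n P) (Λ ^ n • P), volume.real (interior Q) := by
  classical
  choose! c hcT hc using hT
  have hn := h.isInflation_iter n
  have hfn : (outer (iter T n P) (Λ ^ n • P)).Finite :=
    (hn.finite P hP).subset fun _ hQ => hQ.1
  have hfn' : (outer (iter T (n + 1) P) (Λ ^ (n + 1) • P)).Finite :=
    ((h.isInflation_iter (n + 1)).finite P hP).subset fun _ hQ => hQ.1
  have htile : ∀ Q ∈ outer (iter T n P) (Λ ^ n • P), Q ∈ tilesOf X :=
    fun Q hQ => hn.mem_tilesOf hP hQ.1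
  rw [finsum_mem_eq_finite_toFinset_sum _ hfn, finsum_mem_eq_finite_toFinset_sum _ hfn',
    Finset.mul_sum]
  have hsub : hfn'.toFinset ⊆ hfn.toFinset.attach.biUnion fun Q =>
      (h.finite Q (htile Q ((hfn.mem_toFinset).1 Q.2))).toFinset.erase (c Q) := by
    intro R hR
    rw [Set.Finite.mem_toFinset] at hR
    obtain ⟨hR1, hR2⟩ := hR
    obtain ⟨Q, hQ, hRQ⟩ := mem_extend.1 hR1
    have hQX := hn.mem_tilesOf hP hQ
    have hscale : interior (Λ ^ (n + 1) • P) = Λ • interior (Λ ^ n • P) := by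
      rw [pow_succ', mul_smul, interior_smul₀ h.pos.ne']
    have hQo : ¬ Q ⊆ interior (Λ ^ n • P) := fun hsub => hR2 (by
      rw [hscale]
      exact (h.subset_smul hQX hRQ).trans (smul_set_mono hsub))
    have hRc : R ≠ c Q := by
      rintro rfl
      apply hR2
      refine (hc Q hQX).trans ?_
      rw [hscale, ← interior_smul₀ h.pos.ne']
      exact interior_mono (smul_set_mono (hn.subset_smul hP hQ))
    simp only [Finset.mem_biUnion, Finset.mem_attach, true_and, Finset.mem_erase,
      Set.Finite.mem_toFinset, Subtype.exists]
    exact ⟨Q, ⟨hQ, hQo⟩, hRc, hRQ⟩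
  refine (Finset.sum_le_sum_of_subset_of_nonneg hsub fun _ _ _ => measureReal_nonneg).trans ?_
  rw [Finset.sum_biUnion]
  swap
  · rintro Q - Q' - hne
    refine Finset.disjoint_left.2 fun R hR hR' => hne ?_
    simp only [Finset.mem_erase, Set.Finite.mem_toFinset] at hR hR'
    exact Subtype.ext (h.eq_of_mem (hn.isSubpatch hP) ((hfn.mem_toFinset).1 Q.2).1
      ((hfn.mem_toFinset).1 Q'.2).1 hR.2 hR'.2)
  rw [← Finset.sum_attach hfn.toFinset fun Q => ρ * Λ ^ d * volume.real (interior Q)]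
  refine Finset.sum_le_sum fun Q _ => ?_
  have hQX := htile Q ((hfn.mem_toFinset).1 Q.2)
  have h1 : ∑ R ∈ (h.finite Q hQX).toFinset, volume.real (interior R) ≤
      volume.real (Λ • interior (Q : Set (E d))) := by
    refine IsPatch.sum_volume_interior_le ?_ ?_ fun R hR => h.interior_subset_smul hQX (by simpa using hR)
    · simpa using (h.isSubpatch hQX).isPatch
    · exact (((isTile_of_mem_tilesOf hQX).isBounded).subset interior_subset).smul₀ Λ
  rw [volumeReal_smul h.pos.le, ← Finset.add_sum_erase _ _
    (by simpa using hcT Q hQX : c Q ∈ (h.finite Q hQX).toFinset)] at h1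
  have h2 := hv (c Q) (h.mem_tilesOf hQX (hcT Q hQX))
  have h3 := hρ Q hQX
  linarith

theorem frontier_subset_supp_outer {d : ℕ} {X : Set (Tiling d)} {T : Set (E d) → Set (Set (E d))}
    {Λ : ℝ} (h : IsInflation X T Λ) {P : Set (E d)} (hP : P ∈ tilesOf X) :
    Λ • frontier P ⊆ supp (outer (T P) (Λ • P)) := by
  rintro _ ⟨u, hu, rfl⟩
  rw [(isTile_of_mem_tilesOf hP).1.isClosed.frontier_eq] at hu
  have : Λ • u ∈ supp (T P) := by
    rw [h.supp_eq P hP]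
    exact smul_mem_smul_set hu.1
  obtain ⟨Q, hQ, huQ⟩ := this
  refine ⟨Q, ⟨hQ, fun hsub => hu.2 ?_⟩, huQ⟩
  have := hsub huQ
  rwa [interior_smul₀ h.pos.ne', smul_mem_smul_set_iff₀ h.pos.ne'] at this

theorem IsTile.isCompact_frontier {d : ℕ} {P : Set (E d)} (hP : IsTile P) :
    IsCompact (frontier P) :=
  hP.1.of_isClosed_subset isClosed_frontier hP.1.isClosed.frontier_subset

/-- Box counting: scaled down by `Λ`, the outer tiles cover the boundary by sets of diameter at most
`Λ⁻¹ * δ`. -/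
theorem IsInflation.volume_cthickening_frontier_le {d : ℕ} {X : Set (Tiling d)}
    {T : Set (E d) → Set (Set (E d))} {Λ : ℝ} (h : IsInflation X T Λ) {δ : ℝ} (hδ : 0 ≤ δ)
    (hdiam : ∀ P ∈ tilesOf X, ∀ u ∈ P, ∀ v ∈ P, dist u v ≤ δ) {P : Set (E d)} (hP : P ∈ tilesOf X)
    {r : ℝ} (hr : 0 ≤ r) :
    volume.real (Metric.cthickening r (frontier P)) ≤ (outer (T P) (Λ • P)).ncard *
      ((r + Λ⁻¹ * δ) ^ d * volume.real (Metric.closedBall (0 : E d) 1)) := by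
  have hfin : (outer (T P) (Λ • P)).Finite := (h.finite P hP).subset fun _ hQ => hQ.1
  have hinv : 0 < Λ⁻¹ := inv_pos.2 h.pos
  have h1 : ∀ Q ∈ outer (T P) (Λ • P), ∃ c, c ∈ Q := fun Q hQ =>
    (isTile_of_mem_tilesOf (h.mem_tilesOf hP hQ.1)).nonempty
  choose! c hc using h1
  have hsub : Metric.cthickening r (frontier P) ⊆
      ⋃ Q ∈ hfin.toFinset, Metric.closedBall (Λ⁻¹ • c Q) (r + Λ⁻¹ * δ) := by
    rw [(isTile_of_mem_tilesOf hP).isCompact_frontier.cthickening_eq_biUnion_closedBall hr]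
    refine iUnion₂_subset fun u hu w hw => ?_
    obtain ⟨Q, hQ, huQ⟩ := frontier_subset_supp_outer h hP (smul_mem_smul_set hu)
    simp only [mem_iUnion, Set.Finite.mem_toFinset]
    refine ⟨Q, hQ, ?_⟩
    have h2 := hdiam Q (h.mem_tilesOf hP hQ.1) _ huQ _ (hc Q hQ)
    have h3 : dist u (Λ⁻¹ • c Q) ≤ Λ⁻¹ * δ := by
      have : u = Λ⁻¹ • Λ • u := by rw [inv_smul_smul₀ h.pos.ne']
      rw [this, dist_smul₀, Real.norm_of_nonneg hinv.le]
      exact mul_le_mul_of_nonneg_left h2 hinv.le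
    rw [Metric.mem_closedBall] at hw ⊢
    linarith [dist_triangle w u (Λ⁻¹ • c Q)]
  refine (measureReal_mono hsub ?_).trans ((measureReal_biUnion_finset_le _ _).trans ?_)
  · refine ((Bornology.isBounded_biUnion_finset _).2 fun Q _ =>
      Metric.isBounded_closedBall).measure_lt_top.ne
  · rw [Set.ncard_eq_toFinset_card _ hfin, ← nsmul_eq_mul]
    refine Finset.sum_le_card_nsmul _ _ _ fun Q _ => ?_
    rw [volumeReal_closedBall _ (by positivity)]

/-- The neighborhoods of the boundaries of the tiles have volume `O(r^κ)` for some `κ > 0`. -/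
theorem HasPrototiles.exists_volume_cthickening_frontier_le {d l : ℕ} {X : Set (Tiling d)}
    {D : Fin l → Set (E d)} (hX : HasPrototiles X D) {T : Set (E d) → Set (Set (E d))} {Λ : ℝ}
    (h : IsInflation X T Λ) (hΛ : 1 < Λ) :
    ∃ κ C : ℝ, 0 < κ ∧ 0 < C ∧ ∀ P ∈ tilesOf X, ∀ r : ℝ, 0 < r → r ≤ 1 →
      volume.real (Metric.cthickening r (frontier P)) ≤ C * r ^ κ := by
  obtain ⟨n₀, hn₀, hint⟩ := hX.exists_iter_interior h hΛ
  replace h := h.isInflation_iter n₀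
  replace hΛ : 1 < Λ ^ n₀ := one_lt_pow₀ hΛ hn₀.ne'
  generalize iter T n₀ = T at h hint
  generalize Λ ^ n₀ = Λ at h hint hΛ
  obtain ⟨δ, hδ, hdiam⟩ := hX.exists_diam_le
  obtain ⟨v, hv, hvol⟩ := hX.exists_le_volume
  obtain ⟨V, hV, hVol⟩ := hX.exists_volume_le
  have hΛd : 0 < Λ ^ d := pow_pos h.pos _
  -- A tile of volume at least `v` is lost from an inflated tile of volume at most `Λ ^ d * V`. The
  -- maximum with `1 / 2` only keeps `ρ` positive, so that its logarithm can be used.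
  set ρ : ℝ := max (1 / 2) (1 - v / (Λ ^ d * V)) with hρ
  have hρ0 : 0 < ρ := lt_of_lt_of_le (by norm_num) (le_max_left _ _)
  have hρ1 : ρ < 1 := max_lt (by norm_num) (by
    have : 0 < v / (Λ ^ d * V) := by positivity
    linarith)
  have hVint : ∀ P ∈ tilesOf X, volume.real (interior P) ≤ V := fun P hP =>
    (measureReal_mono interior_subset
      (isTile_of_mem_tilesOf hP).isBounded.measure_lt_top.ne).trans (hVol P hP)
  have hρv : ∀ P ∈ tilesOf X, Λ ^ d * volume.real (interior P) - v ≤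
      ρ * (Λ ^ d * volume.real (interior P)) := by
    intro P hP
    have h1 : (1 - v / (Λ ^ d * V)) * (Λ ^ d * volume.real (interior P)) ≤
        ρ * (Λ ^ d * volume.real (interior P)) :=
      mul_le_mul_of_nonneg_right (le_max_right _ _) (by positivity)
    have h2 : v / (Λ ^ d * V) * (Λ ^ d * volume.real (interior P)) ≤ v := by
      rw [div_mul_eq_mul_div, div_le_iff₀ (by positivity)]
      exact mul_le_mul_of_nonneg_left (mul_le_mul_of_nonneg_left (hVint P hP) hΛd.le) hv.le
    linarith
  have hcount : ∀ P ∈ tilesOf X, ∀ n : ℕ,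
      v * (outer (iter T n P) (Λ ^ n • P)).ncard ≤ (ρ * Λ ^ d) ^ n * V := by
    intro P hP n
    have hn := h.isInflation_iter n
    have hfin : (outer (iter T n P) (Λ ^ n • P)).Finite :=
      (hn.finite P hP).subset fun _ hQ => hQ.1
    have h1 : v * (outer (iter T n P) (Λ ^ n • P)).ncard ≤
        ∑ᶠ Q ∈ outer (iter T n P) (Λ ^ n • P), volume.real (interior Q) := by
      rw [finsum_mem_eq_finite_toFinset_sum _ hfin, Set.ncard_eq_toFinset_card _ hfin, mul_comm,
        ← nsmul_eq_mul]
      refine Finset.card_nsmul_le_sum _ _ _ fun Q hQ => hvol Q ?_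
      exact hn.mem_tilesOf hP ((hfin.mem_toFinset).1 hQ).1
    refine h1.trans ?_
    clear h1 hfin hn
    induction n with
    | zero =>
      have hn := h.isInflation_iter 0
      have hfin : (outer (iter T 0 P) (Λ ^ 0 • P)).Finite :=
        (hn.finite P hP).subset fun _ hQ => hQ.1
      rw [finsum_mem_eq_finite_toFinset_sum _ hfin]
      refine le_of_le_of_eq (b := V) ?_ (by simp)
      refine (IsPatch.sum_volume_interior_le (K := P) ?_ (isTile_of_mem_tilesOf hP).isBounded
        ?_).trans (hVol P hP)
      · rw [hfin.coe_toFinset]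
        exact (hn.isSubpatch hP).isPatch.mono fun _ hQ => hQ.1
      · intro Q hQ
        have := hn.subset_smul hP ((hfin.mem_toFinset).1 hQ).1
        rw [pow_zero, one_smul] at this
        exact interior_subset.trans this
    | succ n ih =>
      refine (h.sum_outer_le hvol hρv hint hP n).trans ?_
      rw [pow_succ', mul_assoc (ρ * Λ ^ d)]
      exact mul_le_mul_of_nonneg_left ih (by positivity)
  set ω := volume.real (Metric.closedBall (0 : E d) 1) with hω
  -- Then `ρ = Λ ^ (-κ)`: about `(ρ * Λ ^ d) ^ n` boxes of size `Λ ^ (-n)` have total volume of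
  -- order `(Λ ^ (-n)) ^ κ`. Below, `n` is chosen so that this scale is within a factor `Λ` of `r`.
  set κ : ℝ := -Real.logb Λ ρ with hκ
  have hκ0 : 0 < κ := neg_pos.2 (Real.logb_neg hΛ hρ0 hρ1)
  have hρκ : ρ = Λ ^ (-κ) := by rw [hκ, neg_neg, Real.rpow_logb h.pos hΛ.ne' hρ0]
  refine ⟨κ, V / v * (1 + δ) ^ d * ω * Λ ^ κ + 1, hκ0, by positivity, fun P hP r hr hr1 => ?_⟩
  obtain ⟨n, hn1, hn2⟩ := exists_nat_pow_near_of_lt_one hr hr1 (inv_pos.2 h.pos) (inv_lt_one_of_one_lt₀ hΛ)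
  have hn := h.isInflation_iter n
  have h1 := hn.volume_cthickening_frontier_le hδ.le hdiam hP hr.le
  have h2 : (r + (Λ ^ n)⁻¹ * δ) ^ d ≤ ((Λ ^ n)⁻¹) ^ d * (1 + δ) ^ d := by
    rw [← mul_pow]
    refine pow_le_pow_left₀ (by have := inv_pos.2 hn.pos; positivity) ?_ _
    rw [inv_pow] at hn2
    linarith
  have h3 : ((outer (iter T n P) (Λ ^ n • P)).ncard : ℝ) ≤ (ρ * Λ ^ d) ^ n * (V / v) := by
    rw [← mul_div_assoc, le_div_iff₀ hv, mul_comm]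
    exact hcount P hP n
  have h4 : volume.real (Metric.cthickening r (frontier P)) ≤ ρ ^ n * (V / v * (1 + δ) ^ d * ω) := by
    refine h1.trans ?_
    calc _ ≤ (ρ * Λ ^ d) ^ n * (V / v) * ((((Λ ^ n)⁻¹) ^ d * (1 + δ) ^ d) * ω) := by
            refine mul_le_mul h3 (mul_le_mul_of_nonneg_right h2 measureReal_nonneg) ?_ (by positivity)
            have := inv_pos.2 hn.pos
            positivity
      _ = ρ ^ n * ((Λ ^ n) ^ d * ((Λ ^ n)⁻¹) ^ d) * (V / v * (1 + δ) ^ d * ω) := by ring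
      _ = _ := by
            rw [← mul_pow, mul_inv_cancel₀ hn.pos.ne', one_pow, mul_one]
  have h5 : ρ ^ n ≤ Λ ^ κ * r ^ κ := by
    have h6 : ((Λ⁻¹) ^ (n + 1)) ^ κ ≤ r ^ κ :=
      Real.rpow_le_rpow (by have := h.pos; positivity) hn1.le hκ0.le
    have h7 : ρ ^ n = Λ ^ κ * ((Λ⁻¹) ^ (n + 1)) ^ κ := by
      rw [hρκ, ← Real.rpow_natCast, ← Real.rpow_mul h.pos.le, inv_pow, ← Real.rpow_natCast,
        ← Real.rpow_neg h.pos.le, ← Real.rpow_mul h.pos.le, ← Real.rpow_add h.pos]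
      congr 1
      push_cast
      ring
    rw [h7]
    exact mul_le_mul_of_nonneg_left h6 (Real.rpow_nonneg h.pos.le _)
  calc _ ≤ ρ ^ n * (V / v * (1 + δ) ^ d * ω) := h4
    _ ≤ (Λ ^ κ * r ^ κ) * (V / v * (1 + δ) ^ d * ω) :=
        mul_le_mul_of_nonneg_right h5 (by positivity)
    _ ≤ _ := by
        have : 0 ≤ r ^ κ := Real.rpow_nonneg hr.le _
        nlinarith

/-- The sum of the volumes of the `r`-neighborhoods of the boundaries of the prototiles. -/
noncomputable def boundaryVolume {d l : ℕ} (D : Fin l → Set (E d)) (r : ℝ) : ℝ :=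
  ∑ i, volume.real (Metric.cthickening r (frontier (D i)))

theorem cthickening_vadd {d : ℕ} (t : E d) (r : ℝ) (K : Set (E d)) :
    Metric.cthickening r (t +ᵥ K) = t +ᵥ Metric.cthickening r K := by
  ext u
  have := Metric.infEDist_vadd (-t) u (t +ᵥ K)
  rw [neg_vadd_vadd] at this
  rw [mem_vadd_set_iff_neg_vadd_mem, Metric.mem_cthickening_iff, Metric.mem_cthickening_iff, this]

theorem frontier_vadd {d : ℕ} (t : E d) (K : Set (E d)) : frontier (t +ᵥ K) = t +ᵥ frontier K := by
  rw [frontier, frontier, interior_vadd, closure_vadd, vadd_set_sdiff]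

theorem IsTile.isBounded_cthickening_frontier {d : ℕ} {P : Set (E d)} (hP : IsTile P) (r : ℝ) :
    Bornology.IsBounded (Metric.cthickening r (frontier P)) :=
  hP.isCompact_frontier.isBounded.cthickening

theorem HasPrototiles.volume_cthickening_frontier_le {d l : ℕ} {X : Set (Tiling d)}
    {D : Fin l → Set (E d)} (hX : HasPrototiles X D) {P : Set (E d)} (hP : P ∈ tilesOf X) (r : ℝ) :
    volume.real (Metric.cthickening r (frontier P)) ≤ boundaryVolume D r := by
  obtain ⟨i, t, rfl⟩ := hX.complete P hP
  rw [frontier_vadd, cthickening_vadd, volumeReal_vadd]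
  exact Finset.single_le_sum (f := fun i => volume.real (Metric.cthickening r (frontier (D i))))
    (fun _ _ => measureReal_nonneg) (Finset.mem_univ i)

theorem boundaryVolume_nonneg {d l : ℕ} (D : Fin l → Set (E d)) (r : ℝ) :
    0 ≤ boundaryVolume D r := Finset.sum_nonneg fun _ _ => measureReal_nonneg

theorem HasPrototiles.boundaryVolume_mono {d l : ℕ} {X : Set (Tiling d)}
    {D : Fin l → Set (E d)} (hX : HasPrototiles X D) {r s : ℝ} (h : r ≤ s) :
    boundaryVolume D r ≤ boundaryVolume D s :=
  Finset.sum_le_sum fun i _ => measureReal_mono (Metric.cthickening_mono h _)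
    ((hX.isTile i).isBounded_cthickening_frontier s).measure_lt_top.ne

theorem HasPrototiles.exists_boundaryVolume_le {d l : ℕ} {X : Set (Tiling d)}
    {D : Fin l → Set (E d)} (hX : HasPrototiles X D) (hD : ∀ i, D i ∈ tilesOf X)
    {T : Set (E d) → Set (Set (E d))} {Λ : ℝ} (h : IsInflation X T Λ) (hΛ : 1 < Λ) :
    ∃ κ C : ℝ, 0 < κ ∧ 0 < C ∧ ∀ r : ℝ, 0 < r → r ≤ 1 → boundaryVolume D r ≤ C * r ^ κ := by
  obtain ⟨κ, C, hκ, hC, hb⟩ := hX.exists_volume_cthickening_frontier_le h hΛ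
  refine ⟨κ, (l + 1) * C, hκ, by positivity, fun r hr hr1 => ?_⟩
  have h1 : boundaryVolume D r ≤ l * (C * r ^ κ) := by
    have := Finset.sum_le_card_nsmul Finset.univ
      (fun i => volume.real (Metric.cthickening r (frontier (D i)))) (C * r ^ κ)
      fun i _ => hb _ (hD i) r hr hr1
    simpa [boundaryVolume] using this
  have h2 : 0 ≤ C * r ^ κ := mul_nonneg hC.le (Real.rpow_nonneg hr.le _)
  linarith

/-- The boundary lies in all its neighborhoods, whose volumes tend to zero. -/
theorem HasPrototiles.volume_interior_eq {d l : ℕ} {X : Set (Tiling d)}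
    {D : Fin l → Set (E d)} (hX : HasPrototiles X D)
    {T : Set (E d) → Set (Set (E d))} {Λ : ℝ} (h : IsInflation X T Λ) (hΛ : 1 < Λ)
    {P : Set (E d)} (hP : P ∈ tilesOf X) : volume.real (interior P) = volume.real P := by
  obtain ⟨κ, C, hκ, hC, hb⟩ := hX.exists_volume_cthickening_frontier_le h hΛ
  have hPt := isTile_of_mem_tilesOf hP
  have h0 : volume.real (frontier P) ≤ 0 := by
    have hlim : Tendsto (fun r : ℝ => C * r ^ κ) (𝓝[>] 0) (𝓝 0) := by
      have : Tendsto (fun r : ℝ => C * r ^ κ) (𝓝 0) (𝓝 (C * 0 ^ κ)) :=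
        ((Real.continuousAt_rpow_const 0 κ (Or.inr hκ.le)).tendsto).const_mul C
      rw [Real.zero_rpow hκ.ne', mul_zero] at this
      exact this.mono_left nhdsWithin_le_nhds
    refine ge_of_tendsto hlim ?_
    filter_upwards [Ioc_mem_nhdsGT (zero_lt_one' ℝ)] with r hr
    refine (measureReal_mono (Metric.self_subset_cthickening _) ?_).trans (hb P hP r hr.1 hr.2)
    exact (hPt.isBounded_cthickening_frontier r).measure_lt_top.ne
  apply le_antisymm (measureReal_mono interior_subset hPt.isBounded.measure_lt_top.ne)
  have h1 : P ⊆ interior P ∪ frontier P := by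
    rw [hPt.1.isClosed.frontier_eq]
    intro u hu
    by_cases h : u ∈ interior P
    · exact Or.inl h
    · exact Or.inr ⟨hu, h⟩
  have h2 := measureReal_mono (μ := volume) h1 (((hPt.isBounded.subset interior_subset).union
    hPt.isCompact_frontier.isBounded).measure_lt_top.ne)
  have h3 := measureReal_union_le (μ := volume) (interior P) (frontier P)
  linarith

/-- The power bound puts `d - κ` into each set of exponents whose infimum is the dimension. -/
theorem boundaryDim_lt {d l : ℕ} (hd : 0 < d) {X : Set (Tiling d)} {D : Fin l → Set (E d)}
    (hX : HasPrototiles X D) (hD : ∀ i, D i ∈ tilesOf X)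
    {T : Set (E d) → Set (Set (E d))} {Λ : ℝ} (h : IsInflation X T Λ) (hΛ : 1 < Λ) :
    boundaryDim D < d := by
  obtain ⟨κ, C, hκ, hC, hb⟩ := hX.exists_volume_cthickening_frontier_le h hΛ
  have hdim : ∀ i, upperMinkowskiDim (frontier (D i)) < d := by
    intro i
    rw [upperMinkowskiDim]
    set B := {β : ℝ | (fun r : ℝ => volume.real (Metric.cthickening r (frontier (D i))))
      =O[𝓝[>] 0] (fun r : ℝ => r ^ ((d : ℝ) - β))} with hB
    by_cases hbdd : BddBelow B
    · refine lt_of_le_of_lt (csInf_le hbdd (?_ : (d : ℝ) - κ ∈ B)) (by linarith)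
      rw [hB, mem_ofPred_eq, sub_sub_cancel]
      refine Asymptotics.IsBigO.of_bound C ?_
      filter_upwards [Ioc_mem_nhdsGT (zero_lt_one' ℝ)] with r hr
      rw [Real.norm_of_nonneg measureReal_nonneg, Real.norm_of_nonneg (Real.rpow_nonneg hr.1.le _)]
      exact hb _ (hD i) r hr.1 hr.2
    -- The infimum is `0` by convention here, so `0 < d` suffices; the empty supremum below is
    -- treated alike.
    · rw [Real.sInf_of_not_bddBelow hbdd]
      exact_mod_cast hd
  rw [boundaryDim]
  rcases isEmpty_or_nonempty (Fin l) with hl | hl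
  · rw [Real.iSup_of_isEmpty]
    exact_mod_cast hd
  · obtain ⟨i, hi⟩ := exists_eq_ciSup_of_finite (f := fun i => upperMinkowskiDim (frontier (D i)))
    rw [← hi]
    exact hdim i

/-- The condition defining the dimension persists for larger exponents, since `r ≤ 1`; hence every
exponent above the infimum satisfies it, for all prototiles at once. -/
theorem exists_boundaryVolume_le_of_boundaryDim_lt {d l : ℕ} {X : Set (Tiling d)}
    {D : Fin l → Set (E d)} (hX : HasPrototiles X D) (hD : ∀ i, D i ∈ tilesOf X)
    {T : Set (E d) → Set (Set (E d))} {Λ : ℝ} (h : IsInflation X T Λ) (hΛ : 1 < Λ)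
    {β : ℝ} (hβ : boundaryDim D < β) :
    ∃ K : ℝ, 0 < K ∧ ∀ᶠ r in 𝓝[>] (0 : ℝ), boundaryVolume D r ≤ K * r ^ ((d : ℝ) - β) := by
  obtain ⟨κ, C, hκ, hC, hb⟩ := hX.exists_volume_cthickening_frontier_le h hΛ
  have key : ∀ i, (fun r : ℝ => volume.real (Metric.cthickening r (frontier (D i))))
      =O[𝓝[>] 0] (fun r : ℝ => r ^ ((d : ℝ) - β)) := by
    intro i
    have h1 : upperMinkowskiDim (frontier (D i)) < β :=
      (le_ciSup (f := fun i => upperMinkowskiDim (frontier (D i)))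
        (Set.finite_range _).bddAbove i).trans_lt hβ
    have hne : {β : ℝ | (fun r : ℝ => volume.real (Metric.cthickening r (frontier (D i))))
        =O[𝓝[>] 0] (fun r : ℝ => r ^ ((d : ℝ) - β))}.Nonempty := by
      refine ⟨d - κ, ?_⟩
      rw [mem_ofPred_eq, sub_sub_cancel]
      refine Asymptotics.IsBigO.of_bound C ?_
      filter_upwards [Ioc_mem_nhdsGT (zero_lt_one' ℝ)] with r hr
      rw [Real.norm_of_nonneg measureReal_nonneg, Real.norm_of_nonneg (Real.rpow_nonneg hr.1.le _)]
      exact hb _ (hD i) r hr.1 hr.2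
    obtain ⟨β', hβ', hlt⟩ := exists_lt_of_csInf_lt hne h1
    refine Asymptotics.IsBigO.trans hβ' (Asymptotics.IsBigO.of_bound 1 ?_)
    filter_upwards [Ioc_mem_nhdsGT (zero_lt_one' ℝ)] with r hr
    rw [Real.norm_of_nonneg (Real.rpow_nonneg hr.1.le _),
      Real.norm_of_nonneg (Real.rpow_nonneg hr.1.le _), one_mul]
    exact Real.rpow_le_rpow_of_exponent_ge hr.1 hr.2 (by linarith)
  have hsum : (fun r : ℝ => boundaryVolume D r) =O[𝓝[>] 0] (fun r : ℝ => r ^ ((d : ℝ) - β)) :=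
    Asymptotics.IsBigO.fun_sum fun i _ => key i
  obtain ⟨K, hK, hKb⟩ := hsum.exists_pos
  refine ⟨K, hK, ?_⟩
  filter_upwards [hKb.bound, self_mem_nhdsWithin] with r hr hr0
  rwa [Real.norm_of_nonneg (boundaryVolume_nonneg D r),
    Real.norm_of_nonneg (Real.rpow_nonneg (le_of_lt hr0) _)] at hr

/-! ### Sorting positions by their parent patches -/

section

variable {d : ℕ} {X : Set (Tiling d)} {T : Set (E d) → Set (Set (E d))} {Λ : ℝ}

/-- The tiles of `y` whose inflation contains a tile of `p`. -/
def parents (T : Set (E d) → Set (Set (E d))) (y p : Set (Set (E d))) : Set (Set (E d)) :=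
  {P | P ∈ y ∧ ∃ Q ∈ p, Q ∈ T P}

theorem subset_extend_parents {y p : Set (Set (E d))} (hp : p ⊆ extend T y) :
    p ⊆ extend T (parents T y p) := by
  intro Q hQ
  obtain ⟨P, hP, hQP⟩ := mem_extend.1 (hp hQ)
  exact mem_extend.2 ⟨P, ⟨hP, Q, hQ, hQP⟩, hQP⟩

/-- Each parent has a child in `p` and parents are unique, so `p` has at least as many tiles. The
scaled-down support of `p` is connected, is covered by the parents and meets each of them, so their
union is connected. -/
theorem IsInflation.parents_mem_patchesOf (h : IsInflation X T Λ) {y p : Set (Set (E d))}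
    (hy : IsSubpatch X y) {k : ℕ} (hp : p ∈ patchesOf X k) (hpy : p ⊆ extend T y) :
    ∃ k' ≤ k, parents T y p ∈ patchesOf X k' := by
  have hfin : (parents T y p).Finite := hy.1.subset fun P hP => hP.1
  refine ⟨(parents T y p).ncard, ?_, hfin, rfl, ?_, (hy.mono fun P hP => hP.1).2⟩
  · rw [← hp.2.1]
    have h1 : ∀ P ∈ parents T y p, ∃ Q, Q ∈ p ∧ Q ∈ T P := fun P hP => hP.2
    choose! f hfp hfT using h1
    refine Set.ncard_le_ncard_of_injOn f hfp (fun P hP P' hP' hPP' => ?_) hp.1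
    exact h.eq_of_mem hy hP.1 hP'.1 (hfT P hP) (hPP' ▸ hfT P' hP')
  · have hK : IsConnected (Λ⁻¹ • supp p) :=
      hp.2.2.1.image _ (continuous_const_smul Λ⁻¹).continuousOn
    have hKsub : Λ⁻¹ • supp p ⊆ supp (parents T y p) := by
      rintro _ ⟨u, hu, rfl⟩
      have : u ∈ Λ • supp (parents T y p) := by
        rw [← h.supp_extend fun P hP => hy.mem_tilesOf hP.1]
        exact supp_mono (subset_extend_parents hpy) hu
      exact (mem_smul_set_iff_inv_smul_mem₀ h.pos.ne' _ _).1 this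
    obtain ⟨u₀, hu₀⟩ := hK.nonempty
    have heq : supp (parents T y p) = ⋃ P : Option (parents T y p),
        (P.elim (Λ⁻¹ • supp p) fun P => (P : Set (E d)) ∪ Λ⁻¹ • supp p) := by
      apply Subset.antisymm
      · rintro u ⟨P, hP, hu⟩
        exact mem_iUnion.2 ⟨some ⟨P, hP⟩, Or.inl hu⟩
      · refine iUnion_subset fun P => ?_
        rcases P with _ | P
        · exact hKsub
        · exact union_subset (subset_supp P.2) hKsub
    rw [heq]
    refine ⟨⟨u₀, mem_iUnion.2 ⟨none, hu₀⟩⟩, isPreconnected_iUnion ⟨u₀, ?_⟩ ?_⟩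
    · rw [mem_iInter]
      rintro (_ | P)
      · exact hu₀
      · exact Or.inr hu₀
    · rintro (_ | ⟨P, hPy, Q, hQp, hQP⟩)
      · exact hK.isPreconnected
      · have hPX := hy.mem_tilesOf hPy
        refine (IsConnected.union ?_ (isTile_of_mem_tilesOf hPX).2.1 hK).isPreconnected
        obtain ⟨u, hu⟩ := (isTile_of_mem_tilesOf (h.mem_tilesOf hPX hQP)).nonempty
        refine ⟨Λ⁻¹ • u, ?_, smul_mem_smul_set ⟨Q, hQp, hu⟩⟩
        exact (mem_smul_set_iff_inv_smul_mem₀ h.pos.ne' _ _).1 (h.subset_smul hPX hQP hu)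

/-- The positions of `q` in the inflation of `q'` which meet the inflation of each tile of `q'`. -/
def fullPositions (T : Set (E d) → Set (Set (E d))) (q q' : Set (Set (E d))) : Set (E d) :=
  {t | t ∈ positions q (extend T q') ∧ ∀ P ∈ q', ∃ Q ∈ translate t q, Q ∈ T P}

theorem fullPositions_singleton {q : Set (Set (E d))} (hq : q.Nonempty) (P : Set (E d)) :
    fullPositions T q {P} = positions q (T P) := by
  ext t
  simp only [fullPositions, mem_ofPred_eq, mem_singleton_iff, forall_eq, extend_singleton,
    and_iff_left_iff_imp]
  intro ht
  obtain ⟨Q, hQ⟩ := hq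
  exact ⟨t +ᵥ Q, vadd_mem_translate.2 hQ, ht (vadd_mem_translate.2 hQ)⟩

theorem IsInflation.add_mem_fullPositions (h : IsInflation X T Λ) {q q' : Set (Set (E d))}
    (hq' : ∀ P ∈ q', P ∈ tilesOf X) {t : E d} (ht : t ∈ fullPositions T q q') (s : E d) :
    Λ • s + t ∈ fullPositions T q (translate s q') := by
  obtain ⟨ht1, ht2⟩ := ht
  refine ⟨?_, ?_⟩
  · rw [positions, mem_ofPred_eq, h.extend_translate hq', ← translate_translate]
    exact translate_mono _ ht1
  · rintro _ ⟨P, hP, rfl⟩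
    obtain ⟨Q, hQ, hQP⟩ := ht2 P hP
    refine ⟨Λ • s +ᵥ Q, ?_, ?_⟩
    · rw [← translate_translate]
      exact vadd_mem_translate.2 hQ
    · rw [h.equivariant P (hq' P hP)]
      exact vadd_mem_translate.2 hQP

theorem IsInflation.parents_eq (h : IsInflation X T Λ) {q q' y : Set (Set (E d))}
    (hy : IsSubpatch X y) (hq' : q' ⊆ y) {t : E d} (ht : t ∈ fullPositions T q q') :
    parents T y (translate t q) = q' := by
  ext P
  constructor
  · rintro ⟨hP, Q, hQ, hQP⟩
    obtain ⟨P', hP', hQP'⟩ := mem_extend.1 (ht.1 hQ)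
    rwa [h.eq_of_mem hy hP (hq' hP') hQP hQP']
  · exact fun hP => ⟨hq' hP, ht.2 P hP⟩

/-- The number of positions of a patch in an inflated patch, sorted by the smallest patch whose
inflation contains it. -/
theorem IsInflation.cnt_extend (h : IsInflation X T Λ) {l : ℕ} {D : Fin l → Set (E d)}
    (hX : HasPrototiles X D) {k N : ℕ} (hkN : k ≤ N) {q : Set (Set (E d))}
    (hq : q ∈ patchesOf X k) {y : Set (Set (E d))} (hy : IsSubpatch X y) :
    cnt q (extend T y) = ∑ q' ∈ (hX.finite_patchReps N).toFinset,
      (fullPositions T q q').ncard * cnt q' y := by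
  classical
  have hfin : (positions q (extend T y)).Finite := by
    obtain ⟨P, hP⟩ := nonempty_of_mem_patchesOf hq
    exact finite_positions (isTile_of_mem_tilesOf ((isSubpatch_of_mem_patchesOf hq).mem_tilesOf hP))
      hP (h.isSubpatch_extend hy).1
  -- The fibers collect the positions whose parent patches have the same translation class.
  rw [cnt, Set.ncard_eq_toFinset_card _ hfin, Finset.card_eq_sum_card_fiberwise
    (f := fun t => rep (parents T y (translate t q))) (t := (hX.finite_patchReps N).toFinset)]
  swap
  · intro t ht
    rw [SetLike.mem_coe, Set.Finite.mem_toFinset] at ht ⊢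
    obtain ⟨k', hk', hpar⟩ := h.parents_mem_patchesOf hy (hX.space.translate_mem_patchesOf hq t) ht
    exact ⟨_, ⟨k', hk'.trans hkN, hpar⟩, rfl⟩
  refine Finset.sum_congr rfl fun q' hq' => ?_
  rw [Set.Finite.mem_toFinset] at hq'
  obtain ⟨k', -, hk'⟩ := hX.space.exists_mem_patchesOf_of_mem_patchReps hq'
  have hq'X : ∀ P ∈ q', P ∈ tilesOf X := fun P hP =>
    (isSubpatch_of_mem_patchesOf hk').mem_tilesOf hP
  rw [cnt, mul_comm, ← Set.ncard_prod]
  rw [← Set.ncard_coe_finset]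
  -- In one class, a position is uniquely `Λ • s + t` with `s` placing the representative `q'` in
  -- `y` and `t` a full position over `q'`. The parents of the position recover `s`.
  have himage : (({t ∈ hfin.toFinset | rep (parents T y (translate t q)) = q'} : Finset (E d)) :
      Set (E d)) = (fun p : E d × E d => Λ • p.1 + p.2) ''
        (positions q' y ×ˢ fullPositions T q q') := by
    ext t
    simp only [Finset.coe_filter, Set.Finite.mem_toFinset, mem_ofPred_eq, mem_image, mem_prod,
      Prod.exists]
    constructor
    · rintro ⟨ht, hrep⟩
      obtain ⟨s, hs⟩ := exists_eq_translate_rep (parents T y (translate t q))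
      rw [hrep] at hs
      refine ⟨s, t - Λ • s, ⟨?_, ?_⟩, by abel⟩
      · rw [positions, mem_ofPred_eq, ← hs]
        exact fun P hP => hP.1
      · have hfull : t ∈ fullPositions T q (translate s q') := by
          rw [← hs]
          exact ⟨subset_extend_parents ht, fun P hP => hP.2⟩
        have := h.add_mem_fullPositions (fun P hP => by
          obtain ⟨P', hP', rfl⟩ := hP
          exact hX.space.vadd_mem_tilesOf (hq'X P' hP') s) hfull (-s)
        rw [translate_translate, neg_add_cancel, translate_zero] at this
        convert this using 1
        module
    · rintro ⟨s, t, ⟨hs, ht⟩, rfl⟩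
      have hfull := h.add_mem_fullPositions hq'X ht s
      refine ⟨Subset.trans hfull.1 (extend_mono hs), ?_⟩
      rw [h.parents_eq hy hs hfull, rep_translate, rep_eq_of_mem_patchReps hq']
  rw [himage, Set.InjOn.ncard_image]
  rintro ⟨s, t⟩ ⟨hs, ht⟩ ⟨s', t'⟩ ⟨hs', ht'⟩ heq
  simp only at heq hs ht hs' ht'
  have h1 := h.parents_eq hy hs (h.add_mem_fullPositions hq'X ht s)
  have h2 := h.parents_eq hy hs' (h.add_mem_fullPositions hq'X ht' s')
  rw [heq, h2] at h1
  obtain rfl := eq_of_translate_eq_of_mem_patchesOf hk' h1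
  rw [add_right_inj] at heq
  rw [heq]

/-- The positions of `q` in the inflation of `y` for which the tile `P₀` of `q` lies in the
inflation of `P`, but `q` does not. -/
def crossings (T : Set (E d) → Set (Set (E d))) (q y : Set (Set (E d))) (P₀ P : Set (E d)) :
    Set (E d) :=
  {t | t ∈ positions q (extend T y) ∧ t +ᵥ P₀ ∈ T P ∧ ¬ translate t q ⊆ T P}

/-- The translate of `q` is connected and has points inside and outside `Λ • P`, so it meets the
boundary of `Λ • P`. Its diameter is at most `R`, so all of it lies within `R` of that boundary. -/
theorem IsInflation.crossings_subset (h : IsInflation X T Λ) {q y : Set (Set (E d))}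
    (hy : IsSubpatch X y) {k : ℕ} (hq : q ∈ patchesOf X k) {R : ℝ}
    (hR : ∀ u ∈ supp q, ∀ v ∈ supp q, dist u v ≤ R) {P₀ P : Set (E d)} (hP₀ : P₀ ∈ q)
    (hP : P ∈ y) {t : E d} (ht : t ∈ crossings T q y P₀ P) :
    t +ᵥ P₀ ⊆ Λ • Metric.cthickening (R / Λ) (frontier P) := by
  obtain ⟨ht1, ht2, ht3⟩ := ht
  have hPX := hy.mem_tilesOf hP
  have hPt := isTile_of_mem_tilesOf hPX
  have hRt : ∀ u ∈ supp (translate t q), ∀ v ∈ supp (translate t q), dist u v ≤ R := by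
    rw [supp_translate]
    rintro _ ⟨u, hu, rfl⟩ _ ⟨v, hv, rfl⟩
    simpa using hR u hu v hv
  have hP₀t : t +ᵥ P₀ ∈ translate t q := vadd_mem_translate.2 hP₀
  have hconn : IsConnected (supp (translate t q)) := by
    rw [supp_translate]
    exact hq.2.2.1.image _ (continuous_const_vadd t).continuousOn
  obtain ⟨Q, hQ, hQP⟩ := not_subset.1 ht3
  obtain ⟨P', hP', hQP'⟩ := mem_extend.1 (ht1 hQ)
  have hne : P ≠ P' := by
    rintro rfl
    exact hQP hQP'
  have hP'X := hy.mem_tilesOf hP'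
  have hmeet : (supp (translate t q) ∩ (Λ • P \ interior (Λ • P))).Nonempty := by
    by_contra hemp
    rw [not_nonempty_iff_eq_empty] at hemp
    have hcov : supp (translate t q) ⊆ interior (Λ • P) ∪ (Λ • P)ᶜ := by
      intro u hu
      by_contra hu'
      simp only [mem_union, mem_compl_iff, not_or, not_not] at hu'
      exact (eq_empty_iff_forall_notMem.1 hemp) u ⟨hu, hu'.2, hu'.1⟩
    have hclosed : IsClosed (Λ • P) := hPt.1.isClosed.smul₀ Λ
    have hQt := isTile_of_mem_tilesOf (h.mem_tilesOf hP'X hQP')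
    obtain ⟨u, hu⟩ := (isTile_of_mem_tilesOf (h.mem_tilesOf hPX ht2)).interior_nonempty
    obtain ⟨w, hw⟩ := hQt.interior_nonempty
    -- The open set `interior Q` misses `Λ • interior P`, hence also its closure, which is `Λ • P`
    -- because a tile is the closure of its interior.
    have hdisj : Disjoint (interior Q) (Λ • P) := by
      have h1 : Disjoint (interior Q) (Λ • interior P) := by
        rw [disjoint_left]
        intro w hw hwP
        obtain ⟨w', hw', rfl⟩ := hwP
        have := h.interior_subset_smul hP'X hQP' hw
        rw [smul_mem_smul_set_iff₀ h.pos.ne'] at this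
        exact (hy.isPatch.2 P hP P' hP' hne).subset ⟨hw', this⟩
      have h2 := h1.closure_right isOpen_interior
      rwa [closure_smul₀, hPt.2.2] at h2
    obtain ⟨z, -, hz1, hz2⟩ := hconn.isPreconnected _ _ isOpen_interior hclosed.isOpen_compl hcov
      ⟨u, subset_supp hP₀t (interior_subset hu),
        interior_mono (h.subset_smul hPX ht2) hu⟩
      ⟨w, subset_supp hQ (interior_subset hw), fun hwP => disjoint_left.1 hdisj hw hwP⟩
    exact hz2 (interior_subset hz1)
  obtain ⟨w, hw, hwP, hwi⟩ := hmeet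
  intro u hu
  rw [mem_smul_set_iff_inv_smul_mem₀ h.pos.ne']
  apply Metric.mem_cthickening_of_dist_le _ (Λ⁻¹ • w)
  · rw [hPt.1.isClosed.frontier_eq]
    refine ⟨(mem_smul_set_iff_inv_smul_mem₀ h.pos.ne' _ _).1 hwP, fun hwi' => hwi ?_⟩
    rw [interior_smul₀ h.pos.ne']
    exact (mem_smul_set_iff_inv_smul_mem₀ h.pos.ne' _ _).2 hwi'
  · rw [dist_smul₀, Real.norm_of_nonneg (inv_nonneg.2 h.pos.le), div_eq_inv_mul]
    exact mul_le_mul_of_nonneg_left (hRt u (subset_supp hP₀t hu) w hw) (inv_nonneg.2 h.pos.le)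

/-- The tiles `t +ᵥ P₀` have disjoint interiors and lie in the inflated neighborhood of the
boundary, so comparing volumes bounds their number. -/
theorem IsInflation.ncard_crossings_le (h : IsInflation X T Λ) {l : ℕ} {D : Fin l → Set (E d)}
    (hX : HasPrototiles X D) {v : ℝ} (hv : 0 < v)
    (hvol : ∀ P ∈ tilesOf X, v ≤ volume.real (interior P)) {q y : Set (Set (E d))}
    (hy : IsSubpatch X y) {k : ℕ} (hq : q ∈ patchesOf X k) {R : ℝ}
    (hR : ∀ u ∈ supp q, ∀ v ∈ supp q, dist u v ≤ R) {P₀ P : Set (E d)} (hP₀ : P₀ ∈ q)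
    (hP : P ∈ y) :
    (crossings T q y P₀ P).ncard * v ≤ Λ ^ d * boundaryVolume D (R / Λ) := by
  have hPX := hy.mem_tilesOf hP
  have hPt := isTile_of_mem_tilesOf hPX
  have hP₀t := isTile_of_mem_tilesOf ((isSubpatch_of_mem_patchesOf hq).mem_tilesOf hP₀)
  have himg : (fun t : E d => t +ᵥ P₀) '' crossings T q y P₀ P ⊆ T P := by
    rintro _ ⟨t, ht, rfl⟩
    exact ht.2.1
  have hb : Bornology.IsBounded (Λ • Metric.cthickening (R / Λ) (frontier P)) :=
    (hPt.isBounded_cthickening_frontier _).smul₀ Λ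
  obtain ⟨-, h1⟩ := ((h.isSubpatch hPX).isPatch.mono himg).finite_and_ncard_le hb (by
    rintro _ ⟨t, ht, rfl⟩
    exact interior_subset.trans (h.crossings_subset hy hq hR hP₀ hP ht)) hv
    fun Q hQ => hvol Q (h.mem_tilesOf hPX (himg hQ))
  rw [Set.ncard_image_of_injective _ hP₀t.vadd_injective, volumeReal_smul h.pos.le] at h1
  exact h1.trans (mul_le_mul_of_nonneg_left (hX.volume_cthickening_frontier_le hPX _)
    (pow_nonneg h.pos.le _))

/-- A full position over several tiles puts `P₀` over one of them but also needs a child of another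
one, so it is a crossing. -/
theorem IsInflation.ncard_fullPositions_le (h : IsInflation X T Λ) {l : ℕ} {D : Fin l → Set (E d)}
    (hX : HasPrototiles X D) {v : ℝ} (hv : 0 < v)
    (hvol : ∀ P ∈ tilesOf X, v ≤ volume.real (interior P)) {q q' : Set (Set (E d))}
    (hq' : IsSubpatch X q') (hcard : 1 < q'.ncard) {k : ℕ} (hq : q ∈ patchesOf X k) {R : ℝ}
    (hR : ∀ u ∈ supp q, ∀ v ∈ supp q, dist u v ≤ R) :
    (fullPositions T q q').ncard * v ≤ q'.ncard * (Λ ^ d * boundaryVolume D (R / Λ)) := by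
  obtain ⟨P₀, hP₀⟩ := nonempty_of_mem_patchesOf hq
  have hP₀t := isTile_of_mem_tilesOf ((isSubpatch_of_mem_patchesOf hq).mem_tilesOf hP₀)
  have hfin : (positions q (extend T q')).Finite :=
    finite_positions hP₀t hP₀ (h.isSubpatch_extend hq').1
  have hsub : fullPositions T q q' ⊆ ⋃ P ∈ hq'.1.toFinset, crossings T q q' P₀ P := by
    intro t ht
    have hmem : t +ᵥ P₀ ∈ translate t q := vadd_mem_translate.2 hP₀
    obtain ⟨P, hP, hPP₀⟩ := mem_extend.1 (ht.1 hmem)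
    simp only [mem_iUnion, Set.Finite.mem_toFinset]
    refine ⟨P, hP, ht.1, hPP₀, fun hsub => ?_⟩
    obtain ⟨P', hP', hne⟩ := Set.exists_ne_of_one_lt_ncard hcard P
    obtain ⟨Q, hQ, hQP'⟩ := ht.2 P' hP'
    exact hne (h.eq_of_mem hq' hP' hP hQP' (hsub hQ))
  have h1 : (fullPositions T q q').ncard ≤ ∑ P ∈ hq'.1.toFinset, (crossings T q q' P₀ P).ncard := by
    refine (Set.ncard_le_ncard hsub ?_).trans (Finset.set_ncard_biUnion_le _ _)
    exact hfin.subset (iUnion₂_subset fun P _ t ht => ht.1)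
  calc ((fullPositions T q q').ncard : ℝ) * v
      ≤ (∑ P ∈ hq'.1.toFinset, ((crossings T q q' P₀ P).ncard : ℝ)) * v :=
        mul_le_mul_of_nonneg_right (by exact_mod_cast h1) hv.le
    _ = ∑ P ∈ hq'.1.toFinset, ((crossings T q q' P₀ P).ncard : ℝ) * v := Finset.sum_mul _ _ _
    _ ≤ ∑ P ∈ hq'.1.toFinset, Λ ^ d * boundaryVolume D (R / Λ) :=
        Finset.sum_le_sum fun P hP => h.ncard_crossings_le hX hv hvol hq' hq hR hP₀
          ((hq'.1.mem_toFinset).1 hP)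
    _ = _ := by
        rw [Finset.sum_const, nsmul_eq_mul, Set.ncard_eq_toFinset_card _ hq'.1]

end

section

variable {d l : ℕ} {X : Set (Tiling d)} {D : Fin l → Set (E d)}

theorem patchReps_mono {M N : ℕ} (h : M ≤ N) : patchReps X M ⊆ patchReps X N :=
  image_mono fun _ ⟨k, hk, hq⟩ => ⟨k, hk.trans h, hq⟩

/-- Inequivalence of the prototiles makes the indices correspond bijectively to the classes of
one-tile patches. -/
theorem sum_patchReps_one (hX : HasPrototiles X D) (hD : IsPrototileFamily X D)
    {M : Type*} [AddCommMonoid M] (f : Set (Set (E d)) → M)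
    (hf : ∀ q, f (rep q) = f q) :
    ∑ q ∈ (hX.finite_patchReps 1).toFinset, f q = ∑ j, f {D j} := by
  classical
  have h1 : (hX.finite_patchReps 1).toFinset = Finset.univ.image fun j => rep {D j} := by
    ext q
    simp only [Set.Finite.mem_toFinset, Finset.mem_image, Finset.mem_univ, true_and]
    constructor
    · intro hq
      obtain ⟨k, hk, hqk⟩ := hX.space.exists_mem_patchesOf_of_mem_patchReps hq
      have hpos : 0 < q.ncard := (Set.ncard_pos hqk.1).2 (nonempty_of_mem_patchesOf hqk)
      obtain ⟨P, rfl⟩ := Set.ncard_eq_one.1 (show q.ncard = 1 by rw [hqk.2.1] at hpos ⊢; omega)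
      obtain ⟨j, t, hjt⟩ := hX.complete P
        ((isSubpatch_of_mem_patchesOf hqk).mem_tilesOf (mem_singleton P))
      refine ⟨j, ?_⟩
      have h2 : ({P} : Set (Set (E d))) = translate t {D j} := by simp [translate, hjt]
      rw [← rep_eq_of_mem_patchReps hq, h2, rep_translate]
    · rintro ⟨j, rfl⟩
      exact ⟨_, ⟨1, le_rfl, singleton_mem_patchesOf (hD.mem j)⟩, rfl⟩
  rw [h1, Finset.sum_image]
  · simp only [hf]
  · intro i _ j _ hij
    by_contra hne
    obtain ⟨s, hs⟩ := exists_eq_translate_rep {D i}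
    obtain ⟨t, ht⟩ := exists_rep_eq_translate {D j}
    have h2 : ({D i} : Set (Set (E d))) = translate (s + t) {D j} := by
      simp only at hij
      rw [hs, hij, ht, translate_translate]
    simp only [translate, image_singleton, singleton_eq_singleton_iff] at h2
    exact hD.inequivalent i j hne _ h2

theorem IsInflation.ncard_fullPositions_rep {T : Set (E d) → Set (Set (E d))} {Λ : ℝ}
    (hX : IsTilingSpace X)
    (h : IsInflation X T Λ) (q : Set (Set (E d))) {q' : Set (Set (E d))}
    (hq' : ∀ P ∈ q', P ∈ tilesOf X) (s : E d) :
    (fullPositions T q (translate s q')).ncard = (fullPositions T q q').ncard := by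
  have : fullPositions T q (translate s q') = (fun t => Λ • s + t) '' fullPositions T q q' := by
    ext t
    constructor
    · intro ht
      have := h.add_mem_fullPositions (fun P hP => by
        obtain ⟨P', hP', rfl⟩ := hP
        exact hX.vadd_mem_tilesOf (hq' P' hP') s) ht (-s)
      rw [translate_translate, neg_add_cancel, translate_zero] at this
      exact ⟨_, this, by simp⟩
    · rintro ⟨t, ht, rfl⟩
      exact h.add_mem_fullPositions hq' ht s
  rw [this, Set.ncard_image_of_injective _ (add_right_injective _)]

open Classical in
/-- Representatives of the connected patches with at least two and at most `N` tiles. -/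
noncomputable def largeReps (hX : HasPrototiles X D) (N : ℕ) : Finset (Set (Set (E d))) :=
  {q ∈ (hX.finite_patchReps N).toFinset | 1 < q.ncard}

theorem exists_mem_patchesOf_of_mem_largeReps {hX : HasPrototiles X D} {N : ℕ}
    {q : Set (Set (E d))} (hq : q ∈ largeReps hX N) : 1 < q.ncard ∧ ∃ k ≤ N, q ∈ patchesOf X k := by
  rw [largeReps, Finset.mem_filter, Set.Finite.mem_toFinset] at hq
  exact ⟨hq.2, hX.space.exists_mem_patchesOf_of_mem_patchReps hq.1⟩

/-- One-tile parent patches give the main term; larger ones come from crossings and form the error.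
They again have at most `N` tiles, so iterating never leaves one finite family of patches. -/
theorem IsInflation.cnt_extend_eq_add {T : Set (E d) → Set (Set (E d))} {Λ : ℝ}
    (h : IsInflation X T Λ) (hX : HasPrototiles X D) (hD : IsPrototileFamily X D)
    {k N : ℕ} (hkN : k ≤ N) {q : Set (Set (E d))}
    (hq : q ∈ patchesOf X k) {y : Set (Set (E d))} (hy : IsSubpatch X y) :
    cnt q (extend T y) = ∑ j, cnt q (T (D j)) * cnt {D j} y +
      ∑ q' ∈ largeReps hX N, (fullPositions T q q').ncard * cnt q' y := by
  classical
  have hqne := nonempty_of_mem_patchesOf hq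
  have hN : 1 ≤ N := le_trans (by
    rw [← hq.2.1]
    exact (Set.ncard_pos hq.1).2 hqne) hkN
  have hsmall : {q' ∈ (hX.finite_patchReps N).toFinset | ¬ 1 < q'.ncard} =
      (hX.finite_patchReps 1).toFinset := by
    ext q'
    simp only [Finset.mem_filter, Set.Finite.mem_toFinset]
    constructor
    · rintro ⟨hq', hc⟩
      obtain ⟨k', hk', hqk⟩ := hX.space.exists_mem_patchesOf_of_mem_patchReps hq'
      exact ⟨q', ⟨k', by rw [hqk.2.1] at hc; omega, hqk⟩, rep_eq_of_mem_patchReps hq'⟩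
    · intro hq'
      obtain ⟨k', hk', hqk⟩ := hX.space.exists_mem_patchesOf_of_mem_patchReps hq'
      exact ⟨patchReps_mono hN hq', by rw [hqk.2.1]; omega⟩
  rw [h.cnt_extend hX hkN hq hy, ← Finset.sum_filter_add_sum_filter_not _ (fun q' => 1 < q'.ncard),
    add_comm, hsmall]
  congr 1
  have hsum : ∑ q' ∈ (hX.finite_patchReps 1).toFinset, (fullPositions T q q').ncard * cnt q' y =
      ∑ q' ∈ (hX.finite_patchReps 1).toFinset,
        (fullPositions T q (rep q')).ncard * cnt (rep q') y := by
    refine Finset.sum_congr rfl fun q' hq' => ?_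
    rw [rep_eq_of_mem_patchReps ((hX.finite_patchReps 1).mem_toFinset.1 hq')]
  rw [hsum, sum_patchReps_one hX hD (fun q' => (fullPositions T q (rep q')).ncard * cnt (rep q') y)
    fun q' => by rw [rep_rep]]
  refine Finset.sum_congr rfl fun j _ => ?_
  obtain ⟨t, ht⟩ := exists_rep_eq_translate {D j}
  have hj : ∀ P ∈ ({D j} : Set (Set (E d))), P ∈ tilesOf X := by
    rintro P rfl
    exact hD.mem j
  rw [ht, h.ncard_fullPositions_rep hX.space q hj, cnt_translate_left,
    fullPositions_singleton hqne]
  rfl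

/-- A single tile has a single parent, so there is no crossing term. -/
theorem IsInflation.cnt_tile_extend {T : Set (E d) → Set (Set (E d))} {Λ : ℝ}
    (h : IsInflation X T Λ) (hX : HasPrototiles X D) (hD : IsPrototileFamily X D)
    {P : Set (E d)} (hP : P ∈ tilesOf X) {y : Set (Set (E d))} (hy : IsSubpatch X y) :
    cnt {P} (extend T y) = ∑ j, cnt {P} (T (D j)) * cnt {D j} y := by
  rw [h.cnt_extend_eq_add hX hD le_rfl (singleton_mem_patchesOf hP) hy, add_eq_left]
  refine Finset.sum_eq_zero fun q' hq' => ?_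
  obtain ⟨h1, k, hk, hqk⟩ := exists_mem_patchesOf_of_mem_largeReps hq'
  rw [hqk.2.1] at h1
  omega

theorem sum_tiles_eq (hX : HasPrototiles X D) (hD : IsPrototileFamily X D) {y : Set (Set (E d))}
    (hy : y.Finite) (hyX : ∀ P ∈ y, P ∈ tilesOf X) (f : Set (E d) → ℝ)
    (hf : ∀ (t : E d) P, f (t +ᵥ P) = f P) :
    ∑ P ∈ hy.toFinset, f P = ∑ j, cnt {D j} y * f (D j) := by
  classical
  rcases isEmpty_or_nonempty (Fin l) with hl | hl
  · rw [Finset.univ_eq_empty, Finset.sum_empty]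
    refine Finset.sum_eq_zero fun P hP => ?_
    obtain ⟨i, -⟩ := hX.complete P (hyX P ((hy.mem_toFinset).1 hP))
    exact hl.elim i
  choose! τ s hτ using hX.complete
  rw [← Finset.sum_fiberwise _ τ]
  refine Finset.sum_congr rfl fun j _ => ?_
  have h1 : ∀ P ∈ {P ∈ hy.toFinset | τ P = j}, f P = f (D j) := by
    intro P hP
    rw [Finset.mem_filter, Set.Finite.mem_toFinset] at hP
    rw [hτ P (hyX P hP.1), hf, hP.2]
  rw [Finset.sum_congr rfl h1, Finset.sum_const, nsmul_eq_mul]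
  congr 2
  rw [cnt, ← Set.ncard_coe_finset, ← Set.ncard_image_of_injective (positions {D j} y)
    (hX.isTile j).vadd_injective]
  congr 1
  ext P
  simp only [Finset.coe_filter, Set.Finite.mem_toFinset, mem_ofPred_eq, mem_image, positions,
    translate, image_singleton, singleton_subset_iff]
  constructor
  · rintro ⟨hP, rfl⟩
    exact ⟨s P, by rwa [← hτ P (hyX P hP)], (hτ P (hyX P hP)).symm⟩
  · rintro ⟨t, ht, rfl⟩
    refine ⟨ht, ?_⟩
    by_contra hne
    have h2 := hτ _ (hyX _ ht)
    apply hD.inequivalent _ _ (Ne.symm hne) (-t + s (t +ᵥ D j))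
    rw [add_vadd, ← h2, neg_vadd_vadd]

theorem IsSubpatch.volume_supp {y : Set (Set (E d))} (hy : IsSubpatch X y)
    (hnull : ∀ P ∈ tilesOf X, volume.real (interior P) = volume.real P) :
    volume.real (supp y) = ∑ P ∈ hy.1.toFinset, volume.real P := by
  apply le_antisymm
  · have : supp y = ⋃ P ∈ hy.1.toFinset, P := by simp [supp, sUnion_eq_biUnion]
    rw [this]
    exact measureReal_biUnion_finset_le _ _
  · rw [← Finset.sum_congr rfl fun P hP =>
      hnull P (hy.mem_tilesOf ((hy.1.mem_toFinset).1 hP))]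
    refine IsPatch.sum_volume_interior_le (by simpa using hy.isPatch) hy.isBounded_supp fun P hP => ?_
    exact interior_subset.trans (subset_supp ((hy.1.mem_toFinset).1 hP))

end

/-! ### Densities in inflated tiles and tile frequencies -/

/-- A family of inflations with dilatation factors larger than one on a tiling space. -/
structure IsSystem {d l : ℕ} {J : Type*} (X : Set (Tiling d)) (D : Fin l → Set (E d))
    (S : J → Set (E d) → Set (Set (E d))) (lam : J → ℝ) : Prop where
  proto : HasPrototiles X D
  family : IsPrototileFamily X D
  inflation : ∀ j, IsInflation X (S j) (lam j)
  one_lt : ∀ j, 1 < lam j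

/-- The number of positions of `q` in `S_a^n(P)` per unit of volume. -/
noncomputable def density {d : ℕ} {J : Type*} (S : J → Set (E d) → Set (Set (E d))) (a : ℕ → J)
    (n : ℕ) (q : Set (Set (E d))) (P : Set (E d)) : ℝ :=
  cnt q (superTile S a n P) / volume.real (supp (superTile S a n P))

theorem density_nonneg {d : ℕ} {J : Type*} (S : J → Set (E d) → Set (Set (E d))) (a : ℕ → J)
    (n : ℕ) (q : Set (Set (E d))) (P : Set (E d)) : 0 ≤ density S a n q P := by
  unfold density; positivity

/-- A Doeblin-type contraction estimate. -/
theorem sum_mul_sub_sum_mul_le {ι : Type*} [Fintype ι] [Nonempty ι] {f w w' : ι → ℝ} {ε o : ℝ}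
    (hw : ∀ i, ε ≤ w i) (hw1 : ∑ i, w i = 1) (hw' : ∀ i, 0 ≤ w' i) (hw1' : ∑ i, w' i = 1)
    (hε : 0 ≤ ε) (ho : ∀ i j, f i - f j ≤ o) :
    ∑ i, f i * w i - ∑ i, f i * w' i ≤ (1 - ε) * o := by
  classical
  -- Both averages are compared with the minimum of `f`: the second is at least this value, and the
  -- first gives the minimizer a weight of at least `ε`.
  obtain ⟨i₀, hi₀⟩ := Finite.exists_min f
  have ho0 : 0 ≤ o := by simpa using ho i₀ i₀
  have h1 : f i₀ ≤ ∑ i, f i * w' i := by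
    calc f i₀ = ∑ i, f i₀ * w' i := by rw [← Finset.mul_sum, hw1', mul_one]
      _ ≤ _ := Finset.sum_le_sum fun i _ => mul_le_mul_of_nonneg_right (hi₀ i) (hw' i)
  have h2 : ∑ i, f i * w i - f i₀ = ∑ i, (f i - f i₀) * w i := by
    simp only [sub_mul, Finset.sum_sub_distrib, ← Finset.mul_sum, hw1, mul_one]
  have h3 : ∑ i, (f i - f i₀) * w i ≤ ∑ i, (o * w i - if i = i₀ then o * w i else 0) := by
    refine Finset.sum_le_sum fun i _ => ?_
    split_ifs with h
    · simp [h]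
    · rw [sub_zero]
      exact mul_le_mul_of_nonneg_right (ho i i₀) (hε.trans (hw i))
  rw [Finset.sum_sub_distrib, ← Finset.mul_sum, hw1, Finset.sum_ite_eq' Finset.univ i₀] at h3
  simp only [Finset.mem_univ, if_true] at h3
  nlinarith [hw i₀]

/-- Approximate limits common to all indices make one sequence Cauchy and force the others to share
its limit. -/
theorem exists_tendsto_of_forall_eps {ι : Type*} [Nonempty ι] {u : ι → ℕ → ℝ}
    (h : ∀ ε > 0, ∃ L, ∀ k, ∀ᶠ n in atTop, |u k n - L| ≤ ε) :
    ∃ c, ∀ k, Tendsto (u k) atTop (𝓝 c) := by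
  obtain ⟨k₀⟩ := ‹Nonempty ι›
  have hc : CauchySeq (u k₀) := by
    rw [Metric.cauchySeq_iff']
    intro ε hε
    obtain ⟨L, hL⟩ := h (ε / 4) (by positivity)
    obtain ⟨N, hN⟩ := eventually_atTop.1 (hL k₀)
    refine ⟨N, fun n hn => ?_⟩
    rw [Real.dist_eq]
    have h1 := abs_le.1 (hN n hn)
    have h2 := abs_le.1 (hN N le_rfl)
    rw [abs_lt]
    constructor <;> linarith
  obtain ⟨c, hc⟩ := cauchySeq_tendsto_of_complete hc
  refine ⟨c, fun k => ?_⟩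
  rw [Metric.tendsto_atTop'] at hc ⊢
  intro ε hε
  obtain ⟨L, hL⟩ := h (ε / 4) (by positivity)
  obtain ⟨N, hN⟩ := hc (ε / 4) (by positivity)
  obtain ⟨N', hN'⟩ := eventually_atTop.1 ((hL k).and (hL k₀))
  refine ⟨max N N', fun n hn => ?_⟩
  have h1 := hN n ((le_max_left _ _).trans_lt hn)
  obtain ⟨h2, h3⟩ := hN' n ((le_max_right _ _).trans hn.le)
  rw [Real.dist_eq] at h1 ⊢
  have h1 := abs_lt.1 h1
  have h2 := abs_le.1 h2
  have h3 := abs_le.1 h3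
  rw [abs_lt]
  constructor <;> linarith

section

variable {d l : ℕ} {J : Type*} {X : Set (Tiling d)} {D : Fin l → Set (E d)}
  {S : J → Set (E d) → Set (Set (E d))} {lam : J → ℝ}

namespace IsSystem

theorem superTile (h : IsSystem X D S lam) (a : ℕ → J) (n : ℕ) :
    IsInflation X (superTile S a n) (dil lam a n) := isInflation_superTile h.inflation a n

theorem volume_pos (h : IsSystem X D S lam) (k : Fin l) : 0 < volume.real (D k) :=
  (h.proto.isTile k).volume_interior_pos.trans_le
    (measureReal_mono interior_subset (h.proto.isTile k).isBounded.measure_lt_top.ne)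

theorem volume_superTile (h : IsSystem X D S lam) (a : ℕ → J) (n : ℕ) {P : Set (E d)}
    (hP : P ∈ tilesOf X) :
    volume.real (supp (MultiSubst.superTile S a n P)) = dil lam a n ^ d * volume.real P := by
  rw [(h.superTile a n).supp_eq P hP, volumeReal_smul (h.superTile a n).pos.le]

theorem nonempty_fin (h : IsSystem X D S lam) {P : Set (E d)} (hP : P ∈ tilesOf X) :
    Nonempty (Fin l) := by
  obtain ⟨i, -⟩ := h.proto.complete P hP
  exact ⟨i⟩

theorem volume_interior [Nonempty J] (h : IsSystem X D S lam) :
    ∀ P ∈ tilesOf X, volume.real (interior P) = volume.real P := fun _ hP =>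
  h.proto.volume_interior_eq (h.inflation (Classical.arbitrary J)) (h.one_lt _) hP

/-- The volume fractions of the tile types in `S_a^n(D_k)` add up to one. -/
theorem sum_density_mul_volume [Nonempty J] (h : IsSystem X D S lam) (a : ℕ → J) (n : ℕ)
    (k : Fin l) : ∑ j, density S a n {D j} (D k) * volume.real (D j) = 1 := by
  have hsub := (h.superTile a n).isSubpatch (h.family.mem k)
  have h1 := hsub.volume_supp h.volume_interior
  rw [sum_tiles_eq h.proto h.family hsub.1 (fun P hP => hsub.mem_tilesOf hP)
    (fun P => volume.real P) volumeReal_vadd] at h1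
  have hpos : 0 < volume.real (supp (MultiSubst.superTile S a n (D k))) := by
    rw [h.volume_superTile a n (h.family.mem k)]
    exact mul_pos (pow_pos (h.superTile a n).pos _) (h.volume_pos k)
  simp only [density, div_mul_eq_mul_div]
  rw [← Finset.sum_div, ← h1, div_self hpos.ne']

/-- The density of a patch in `S_a^{n+m}(D_k)`, by the decomposition into the inflations
`S_a^n(D_j)`. -/
theorem density_add (h : IsSystem X D S lam) (a : ℕ → J) (n m : ℕ) {k N : ℕ} (hkN : k ≤ N)
    {q : Set (Set (E d))} (hq : q ∈ patchesOf X k) (i : Fin l) :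
    density S a (n + m) q (D i) =
      ∑ j, density S a n q (D j) *
        (density S (fun r => a (n + r)) m {D j} (D i) * volume.real (D j)) +
      ∑ q' ∈ largeReps h.proto N,
        (fullPositions (MultiSubst.superTile S a n) q q').ncard / dil lam a n ^ d *
          density S (fun r => a (n + r)) m q' (D i) := by
  have hi := h.family.mem i
  have h1 := (h.superTile a n).cnt_extend_eq_add h.proto h.family hkN hq
    ((h.superTile (fun r => a (n + r)) m).isSubpatch hi)
  have hn : dil lam a n ^ d ≠ 0 := (pow_pos (h.superTile a n).pos _).ne'
  have hm : dil lam (fun r => a (n + r)) m ^ d ≠ 0 := (pow_pos (h.superTile _ m).pos _).ne'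
  have hv := fun j => (h.volume_pos j).ne'
  simp only [density, h.volume_superTile _ _ (h.family.mem _)]
  rw [superTile_add, h1, dil_add, mul_pow]
  push_cast
  rw [add_div, Finset.sum_div, Finset.sum_div]
  congr 1
  · refine Finset.sum_congr rfl fun j _ => ?_
    field_simp [hv i, hv j]
  · refine Finset.sum_congr rfl fun q' _ => ?_
    field_simp [hv i]

theorem density_tile_add (h : IsSystem X D S lam) (a : ℕ → J) (n m : ℕ) {P : Set (E d)}
    (hP : P ∈ tilesOf X) (i : Fin l) :
    density S a (n + m) {P} (D i) =
      ∑ j, density S a n {P} (D j) *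
        (density S (fun r => a (n + r)) m {D j} (D i) * volume.real (D j)) := by
  rw [h.density_add a n m le_rfl (singleton_mem_patchesOf hP), add_eq_left]
  refine Finset.sum_eq_zero fun q' hq' => ?_
  obtain ⟨h1, k, hk, hqk⟩ := exists_mem_patchesOf_of_mem_largeReps hq'
  rw [hqk.2.1] at h1
  omega

/-- Patch densities are bounded by the inverse of the smallest volume of a tile. -/
theorem density_le (h : IsSystem X D S lam) {v : ℝ} (hv : 0 < v)
    (hvol : ∀ P ∈ tilesOf X, v ≤ volume.real (interior P)) (a : ℕ → J) (n : ℕ)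
    {q : Set (Set (E d))} {k : ℕ} (hq : q ∈ patchesOf X k) {P : Set (E d)} (hP : P ∈ tilesOf X) :
    density S a n q P ≤ 1 / v := by
  have hsub := (h.superTile a n).isSubpatch hP
  obtain ⟨Q, hQ⟩ := nonempty_of_mem_patchesOf hq
  have h1 := cnt_le_ncard (isTile_of_mem_tilesOf ((isSubpatch_of_mem_patchesOf hq).mem_tilesOf hQ))
    hQ hsub.1
  obtain ⟨-, h2⟩ := hsub.isPatch.finite_and_ncard_le hsub.isBounded_supp
    (fun P hP => interior_subset.trans (subset_supp hP)) hv
    fun P hP => hvol P (hsub.mem_tilesOf hP)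
  refine div_le_of_le_mul₀ measureReal_nonneg (by positivity) ?_
  rw [div_mul_eq_mul_div, one_mul, le_div_iff₀ hv]
  refine le_trans ?_ h2
  exact mul_le_mul_of_nonneg_right (by exact_mod_cast h1) hv.le

end IsSystem

end

section

variable {d l : ℕ} {J : Type*} {X : Set (Tiling d)} {D : Fin l → Set (E d)}
  {S : J → Set (E d) → Set (Set (E d))} {lam : J → ℝ}

namespace IsSystem

theorem cnt_superTile_succ (h : IsSystem X D S lam) (a : ℕ → J) (n : ℕ) (i k : Fin l) :
    cnt {D i} (MultiSubst.superTile S a (n + 1) (D k)) =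
      ∑ j, cnt {D i} (MultiSubst.superTile S a n (D j)) * cnt {D j} (S (a n) (D k)) := by
  have h1 : MultiSubst.superTile S (fun r => a (n + r)) 1 (D k) = S (a n) (D k) := by
    rw [superTile_succ]
    exact extend_singleton _ _
  rw [superTile_add, h1]
  exact (h.superTile a n).cnt_tile_extend h.proto h.family (h.family.mem i)
    ((h.inflation (a n)).isSubpatch (h.family.mem k))

theorem cnt_tile_self (h : IsSystem X D S lam) (i k : Fin l) :
    cnt {D i} {D k} = if i = k then 1 else 0 := by
  have hpos : positions {D i} {D k} = {t : E d | t +ᵥ D i = D k} := by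
    ext t
    simp [positions, translate]
  rw [cnt, hpos]
  split_ifs with hik
  · subst hik
    rw [Set.ncard_eq_one]
    refine ⟨0, ?_⟩
    ext t
    simp only [mem_ofPred_eq, mem_singleton_iff]
    constructor
    · intro ht
      exact (h.proto.isTile i).vadd_injective (by simpa using ht)
    · rintro rfl
      exact zero_vadd _ _
  · rw [Set.ncard_eq_zero (Set.Subsingleton.finite fun s hs t ht =>
      (h.proto.isTile i).vadd_injective (hs.trans ht.symm))]
    refine eq_empty_of_forall_notMem fun t ht => h.family.inequivalent k i (Ne.symm hik) t ?_
    exact Eq.symm ht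

/-- This translates the matrix hypothesis into counts in supertiles. The last letter is split off
since it acts first on the prototile. -/
theorem structureMatrix_prod (h : IsSystem X D S lam) (a : ℕ → J) (n : ℕ) (i k : Fin l) :
    ((List.range n).map fun r => structureMatrix D (S (a r))).prod i k =
      cnt {D i} (MultiSubst.superTile S a n (D k)) := by
  induction n generalizing k with
  | zero =>
    rw [MultiSubst.superTile, h.cnt_tile_self]
    simp [Matrix.one_apply]
  | succ n ih =>
    rw [h.cnt_superTile_succ, List.range_succ, List.map_append, List.prod_append, Matrix.mul_apply]
    refine Finset.sum_congr rfl fun j _ => ?_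
    rw [ih]
    simp only [List.map_cons, List.map_nil, List.prod_cons, List.prod_nil, mul_one]
    rw [structureMatrix, Matrix.of_apply, copies_singleton (h.proto.isTile j)]

/-- A uniform version of primitivity. -/
theorem exists_forall_cnt_pos [Finite J] (h : IsSystem X D S lam) (hprim : IsPrimitive D S) :
    ∃ M : ℕ, 0 < M ∧ ∀ (a : ℕ → J) (i k : Fin l),
      0 < cnt {D i} (MultiSubst.superTile S a M (D k)) := by
  -- With the discrete topology on the finite set `J`, sequences form a compact space, and
  -- positivity at a given level depends on finitely many letters, so it is an open condition.
  let _ : TopologicalSpace J := ⊥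
  have : DiscreteTopology J := ⟨rfl⟩
  set U : ℕ → Set (ℕ → J) := fun m =>
    {a | ∀ i k : Fin l, 0 < cnt {D i} (MultiSubst.superTile S a (m + 1) (D k))} with hU
  -- Positivity persists at the next level because every inflated tile contains a tile of some type.
  have hmono : Monotone U := by
    refine monotone_nat_of_le_succ fun m a ha i k => ?_
    rw [h.cnt_superTile_succ]
    have hk := h.family.mem k
    obtain ⟨Q, hQ⟩ := (h.inflation (a (m + 1))).nonempty hk
    obtain ⟨j, t, rfl⟩ := h.proto.complete Q ((h.inflation _).mem_tilesOf hk hQ)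
    refine Finset.sum_pos' (fun _ _ => Nat.zero_le _) ⟨j, Finset.mem_univ _, ?_⟩
    refine Nat.mul_pos (ha i j) ?_
    have hfin := finite_positions (h.proto.isTile j) (mem_singleton (D j))
      ((h.inflation (a (m + 1))).finite _ hk)
    rw [cnt, Set.ncard_pos hfin]
    exact ⟨t, by simpa [positions, translate] using hQ⟩
  have hopen : ∀ m, IsOpen (U m) := by
    intro m
    rw [isOpen_iff_forall_mem_open]
    intro a ha
    refine ⟨⋂ r ∈ Finset.range (m + 1), {b | b r = a r}, fun b hb => ?_, ?_, ?_⟩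
    · simp only [mem_iInter, Finset.mem_range, mem_ofPred_eq] at hb
      intro i k
      rw [superTile_congr S hb]
      exact ha i k
    · exact isOpen_biInter_finset fun r _ => (isOpen_discrete ({a r} : Set J)).preimage
        (continuous_apply r : Continuous fun b : ℕ → J => b r)
    · simp
  have hcov : (univ : Set (ℕ → J)) ⊆ ⋃ m, U m := by
    intro a _
    obtain ⟨m, hm⟩ := hprim a 0
    refine mem_iUnion.2 ⟨m, fun i k => ?_⟩
    have := hm i k
    simp only [zero_add] at this
    rwa [h.structureMatrix_prod] at this
  obtain ⟨m, hm⟩ := isCompact_univ.elim_directed_cover U hopen hcov hmono.directed_le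
  exact ⟨m + 1, Nat.succ_pos m, fun a i k => hm (mem_univ a) i k⟩

theorem dil_le_pow [Finite J] (lam : J → ℝ) (hlam : ∀ j, 0 ≤ lam j) :
    ∃ m : ℝ, 0 < m ∧ ∀ (a : ℕ → J) (n : ℕ), dil lam a n ≤ m ^ n := by
  obtain ⟨m, hm⟩ := (Set.finite_range lam).bddAbove
  refine ⟨max m 1, by positivity, fun a n => ?_⟩
  rw [dil, ← Finset.card_range n, ← Finset.prod_const]
  simp only [Finset.card_range]
  exact Finset.prod_le_prod (fun r _ => hlam _) fun r _ =>
    (hm (mem_range_self _)).trans (le_max_left _ _)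

/-- The densities of a tile in the patches `S_a^n(D_k)` with different `k` approach each other
exponentially fast. -/
theorem exists_density_tile_sub_le [Finite J] [Nonempty J] (h : IsSystem X D S lam)
    (hprim : IsPrimitive D S) :
    ∃ ρ C : ℝ, 0 < ρ ∧ ρ < 1 ∧ 0 < C ∧ ∀ (a : ℕ → J) (n : ℕ) (i k k' : Fin l),
      density S a n {D i} (D k) - density S a n {D i} (D k') ≤ C * ρ ^ n := by
  rcases isEmpty_or_nonempty (Fin l) with hl | hl
  · exact ⟨1 / 2, 1, by norm_num, by norm_num, one_pos, fun _ _ i => hl.elim i⟩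
  obtain ⟨M, hM, hpos⟩ := h.exists_forall_cnt_pos hprim
  obtain ⟨v, hv, hvol⟩ := h.proto.exists_le_volume
  obtain ⟨V, hV, hVol⟩ := h.proto.exists_volume_le
  obtain ⟨m, hm, hdil⟩ := dil_le_pow lam fun j => (one_pos.trans (h.one_lt j)).le
  -- Each type occurs at level `M` with volume at least `v`, inside a volume of at most `(m ^ M) ^ d
  -- * V`. The cap `1 / 2` below keeps `1 - ε` positive.
  set ε₀ : ℝ := v / ((m ^ M) ^ d * V) with hε₀
  set ε : ℝ := min ε₀ (1 / 2) with hε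
  have hε0 : 0 < ε := lt_min (by positivity) (by norm_num)
  have hε1 : ε ≤ 1 / 2 := min_le_right _ _
  have hlow : ∀ (a : ℕ → J) (j i : Fin l),
      ε ≤ density S a M {D j} (D i) * volume.real (D j) := by
    intro a j i
    refine (min_le_left _ _).trans ?_
    rw [density, h.volume_superTile a M (h.family.mem i), div_mul_eq_mul_div, hε₀]
    have h1 : (1 : ℝ) ≤ cnt {D j} (MultiSubst.superTile S a M (D i)) := by
      exact_mod_cast hpos a j i
    have h2 : v ≤ volume.real (D j) := (hvol _ (h.family.mem j)).trans
      (measureReal_mono interior_subset (h.proto.isTile j).isBounded.measure_lt_top.ne)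
    have h3 := h.volume_pos i
    have h4 : dil lam a M ^ d ≤ (m ^ M) ^ d :=
      pow_le_pow_left₀ (h.superTile a M).pos.le (hdil a M) _
    have h5 := pow_pos (h.superTile a M).pos d
    refine div_le_div₀ (by positivity) ?_ (by positivity) ?_
    · nlinarith
    · exact mul_le_mul h4 (hVol _ (h.family.mem i)) h3.le (by positivity)
  have hnn : ∀ (a : ℕ → J) (n : ℕ) (j i : Fin l),
      0 ≤ density S a n {D j} (D i) * volume.real (D j) := fun a n j i =>
    mul_nonneg (density_nonneg _ _ _ _ _) measureReal_nonneg
  -- In the induction step the last `M` letters supply weights bounded below by `ε`, while the first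
  -- `s * M` letters carry the oscillation already estimated.
  have hstep : ∀ (s : ℕ) (a : ℕ → J) (i k k' : Fin l),
      density S a (s * M) {D i} (D k) - density S a (s * M) {D i} (D k') ≤
        (1 - ε) ^ s * (1 / v) := by
    intro s
    induction s with
    | zero =>
      intro a i k k'
      have h1 := h.density_le hv hvol a (0 * M) (singleton_mem_patchesOf (h.family.mem i))
        (h.family.mem k)
      have h2 := density_nonneg S a (0 * M) {D i} (D k')
      rw [pow_zero, one_mul]
      linarith
    | succ s ih =>
      intro a i k k'
      rw [Nat.succ_mul, h.density_tile_add a _ _ (h.family.mem i),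
        h.density_tile_add a _ _ (h.family.mem i), pow_succ', mul_assoc]
      exact sum_mul_sub_sum_mul_le (fun j => hlow _ j k) (h.sum_density_mul_volume _ _ _)
        (fun j => hnn _ _ j k') (h.sum_density_mul_volume _ _ _) hε0.le fun j j' => ih a i j j'
  -- The remaining `n % M` letters merely average and cannot increase the oscillation.
  have hall : ∀ (n : ℕ) (a : ℕ → J) (i k k' : Fin l),
      density S a n {D i} (D k) - density S a n {D i} (D k') ≤ (1 - ε) ^ (n / M) * (1 / v) := by
    intro n a i k k'
    have hn : n = n / M * M + n % M := (Nat.div_add_mod' n M).symm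
    conv_lhs => rw [hn]
    rw [h.density_tile_add a _ _ (h.family.mem i), h.density_tile_add a _ _ (h.family.mem i)]
    have := sum_mul_sub_sum_mul_le (ε := 0) (fun j => hnn (fun r => a (n / M * M + r)) (n % M) j k)
      (h.sum_density_mul_volume _ _ _)
      (fun j => hnn (fun r => a (n / M * M + r)) (n % M) j k')
      (h.sum_density_mul_volume _ _ _) le_rfl fun j j' => hstep (n / M) a i j j'
    simpa using this
  have h1ε : 0 < 1 - ε := by linarith
  -- So `ρ ^ M = 1 - ε`; the factor `1 / (1 - ε)` in the constant pays for rounding `n / M` down.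
  set ρ : ℝ := (1 - ε) ^ (1 / (M : ℝ)) with hρ
  have hMR : (0 : ℝ) < M := by exact_mod_cast hM
  have hρ0 : 0 < ρ := Real.rpow_pos_of_pos h1ε _
  refine ⟨ρ, 1 / (1 - ε) * (1 / v), hρ0, Real.rpow_lt_one h1ε.le (by linarith) (by positivity),
    by positivity, fun a n i k k' => (hall n a i k k').trans ?_⟩
  have h2 : (1 - ε) ^ (n / M) ≤ 1 / (1 - ε) * ρ ^ n := by
    rw [hρ, ← Real.rpow_natCast ((1 - ε) ^ (1 / (M : ℝ))) n, ← Real.rpow_mul h1ε.le, one_div,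
      ← Real.rpow_neg_one, ← Real.rpow_add h1ε, ← Real.rpow_natCast]
    refine Real.rpow_le_rpow_of_exponent_ge h1ε (by linarith) ?_
    have h3 : (n : ℝ) < ((n / M : ℕ) + 1) * M := by
      have := Nat.lt_div_mul_add hM (a := n)
      exact_mod_cast (by rw [add_mul, one_mul]; exact this : n < (n / M + 1) * M)
    rw [← div_lt_iff₀ hMR] at h3
    have h4 : 1 / (M : ℝ) * n = n / M := by ring
    rw [h4]
    linarith
  calc _ ≤ 1 / (1 - ε) * ρ ^ n * (1 / v) := mul_le_mul_of_nonneg_right h2 (by positivity)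
    _ = _ := by ring

/-- The tile frequencies exist and depend on the sequence at an exponential rate. -/
theorem exists_tileFrequency [Finite J] [Nonempty J] (h : IsSystem X D S lam)
    (hprim : IsPrimitive D S) (hX : (tilesOf X).Nonempty) :
    ∃ ρ C : ℝ, 0 < ρ ∧ ρ < 1 ∧ 0 < C ∧ ∃ c : (ℕ → J) → Fin l → ℝ,
      (∀ a i k, Tendsto (fun n => density S a n {D i} (D k)) atTop (𝓝 (c a i))) ∧
      ∀ (n : ℕ) (a b : ℕ → J), (∀ r < n, a r = b r) → ∀ i, |c a i - c b i| ≤ C * ρ ^ n := by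
  obtain ⟨P, hP⟩ := hX
  have := h.nonempty_fin hP
  obtain ⟨ρ, C, hρ0, hρ1, hC, hosc⟩ := h.exists_density_tile_sub_le hprim
  -- A density at level `n + m` is a weighted average of those at level `n`, hence close to each of
  -- them.
  have hclose : ∀ (a : ℕ → J) (n m : ℕ) (i k k' : Fin l),
      |density S a (n + m) {D i} (D k) - density S a n {D i} (D k')| ≤ C * ρ ^ n := by
    intro a n m i k k'
    rw [h.density_tile_add a n m (h.family.mem i)]
    have hw := h.sum_density_mul_volume (fun r => a (n + r)) m k
    have h1 : density S a n {D i} (D k') = ∑ j, density S a n {D i} (D k') *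
        (density S (fun r => a (n + r)) m {D j} (D k) * volume.real (D j)) := by
      rw [← Finset.mul_sum, hw, mul_one]
    rw [h1, ← Finset.sum_sub_distrib]
    refine (Finset.abs_sum_le_sum_abs _ _).trans ?_
    have h2 : C * ρ ^ n = ∑ j, C * ρ ^ n *
        (density S (fun r => a (n + r)) m {D j} (D k) * volume.real (D j)) := by
      rw [← Finset.mul_sum, hw, mul_one]
    rw [h2]
    refine Finset.sum_le_sum fun j _ => ?_
    have hnn : 0 ≤ density S (fun r => a (n + r)) m {D j} (D k) * volume.real (D j) :=
      mul_nonneg (density_nonneg _ _ _ _ _) measureReal_nonneg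
    rw [← sub_mul, abs_mul, abs_of_nonneg hnn]
    refine mul_le_mul_of_nonneg_right (abs_sub_le_iff.2 ⟨hosc a n i j k', hosc a n i k' j⟩) hnn
  have hlim : ∀ (a : ℕ → J) (i : Fin l), ∃ c, ∀ k,
      Tendsto (fun n => density S a n {D i} (D k)) atTop (𝓝 c) := by
    intro a i
    refine exists_tendsto_of_forall_eps fun ε hε => ?_
    have h1 : Tendsto (fun n : ℕ => C * ρ ^ n) atTop (𝓝 0) := by
      simpa using (tendsto_pow_atTop_nhds_zero_of_lt_one hρ0.le hρ1).const_mul C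
    obtain ⟨n, hn⟩ := (h1.eventually (ge_mem_nhds hε)).exists
    refine ⟨density S a n {D i} (D (Classical.arbitrary _)), fun k => ?_⟩
    filter_upwards [eventually_ge_atTop n] with m hm
    obtain ⟨m, rfl⟩ := Nat.exists_eq_add_of_le hm
    exact (hclose a n m i k _).trans hn
  choose c hc using hlim
  refine ⟨ρ, 2 * C, hρ0, hρ1, by positivity, c, hc, fun n a b hab i => ?_⟩
  have hca : ∀ a : ℕ → J, |c a i - density S a n {D i} (D (Classical.arbitrary _))| ≤ C * ρ ^ n := by
    intro a
    have h1 := (hc a i (Classical.arbitrary _)).comp (tendsto_add_atTop_nat n)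
    refine le_of_tendsto ((h1.sub_const _).abs) (Eventually.of_forall fun m => ?_)
    have := hclose a n m i (Classical.arbitrary _) (Classical.arbitrary _)
    simpa only [Function.comp_apply, add_comm m n] using this
  have h1 := hca a
  have h2 := hca b
  have h3 : density S a n {D i} (D (Classical.arbitrary _)) =
      density S b n {D i} (D (Classical.arbitrary _)) := by
    rw [density, density, superTile_congr S hab]
  rw [h3] at h1
  have := abs_sub_le (c a i) (density S b n {D i} (D (Classical.arbitrary _))) (c b i)
  rw [abs_sub_comm (density S b n _ _) (c b i)] at this
  linarith

end IsSystem

end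

/-! ### Patch frequencies and their dependence on the sequence -/

section

variable {d l : ℕ} {J : Type*} {X : Set (Tiling d)} {D : Fin l → Set (E d)}
  {S : J → Set (E d) → Set (Set (E d))} {lam : J → ℝ}

theorem HasPrototiles.exists_patch_diam_le (hX : HasPrototiles X D) (N : ℕ) :
    ∃ R : ℝ, 0 < R ∧ ∀ k ≤ N, ∀ q ∈ patchesOf X k, ∀ u ∈ supp q, ∀ v ∈ supp q, dist u v ≤ R := by
  have h1 : ∀ q : Set (Set (E d)), ∃ C : ℝ, q ∈ patchReps X N →
      ∀ u ∈ supp q, ∀ v ∈ supp q, dist u v ≤ C := by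
    intro q
    by_cases hq : q ∈ patchReps X N
    · obtain ⟨k, -, hk⟩ := hX.space.exists_mem_patchesOf_of_mem_patchReps hq
      obtain ⟨C, hC⟩ := Metric.isBounded_iff.1 (isSubpatch_of_mem_patchesOf hk).isBounded_supp
      exact ⟨C, fun _ u hu v hv => hC hu hv⟩
    · exact ⟨0, fun h => absurd h hq⟩
  choose C hC using h1
  obtain ⟨M, hM⟩ := ((hX.finite_patchReps N).image C).bddAbove
  refine ⟨max M 1, by positivity, fun k hk q hq u hu v hv => ?_⟩
  have hrep : rep q ∈ patchReps X N := ⟨q, ⟨k, hk, hq⟩, rfl⟩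
  obtain ⟨t, ht⟩ := exists_eq_translate_rep q
  rw [ht, supp_translate] at hu hv
  obtain ⟨u, hu, rfl⟩ := hu
  obtain ⟨v, hv, rfl⟩ := hv
  simp only [dist_vadd_cancel_left]
  exact (hC _ hrep u hu v hv).trans ((hM (mem_image_of_mem C hrep)).trans (le_max_left _ _))

namespace IsSystem

theorem one_lt_iInf [Finite J] [Nonempty J] (h : IsSystem X D S lam) : 1 < ⨅ j, lam j := by
  obtain ⟨j, hj⟩ := exists_eq_ciInf_of_finite (f := lam)
  rw [← hj]
  exact h.one_lt j

theorem iInf_pow_le_dil [Finite J] [Nonempty J] (h : IsSystem X D S lam) (a : ℕ → J) (n : ℕ) :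
    (⨅ j, lam j) ^ n ≤ dil lam a n :=
  pow_le_dil (one_pos.trans h.one_lt_iInf).le (fun j => ciInf_le (Set.finite_range lam).bddBelow j)
    a n

/-- The proportion of the positions of a patch crossing the boundaries of the inflations of tiles is
controlled by the volume of the neighborhoods of these boundaries. -/
theorem exists_sum_fullPositions_le [Finite J] [Nonempty J] (h : IsSystem X D S lam) (N : ℕ) :
    ∃ K R : ℝ, 0 < K ∧ 0 < R ∧ ∀ (a : ℕ → J) (n : ℕ), ∀ k ≤ N, ∀ q ∈ patchesOf X k,
      ∑ q' ∈ largeReps h.proto N, ((fullPositions (MultiSubst.superTile S a n) q q').ncard : ℝ) /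
        dil lam a n ^ d ≤ K * boundaryVolume D (R / (⨅ j, lam j) ^ n) := by
  obtain ⟨R, hR, hdiam⟩ := h.proto.exists_patch_diam_le N
  obtain ⟨v, hv, hvol⟩ := h.proto.exists_le_volume
  refine ⟨((largeReps h.proto N).card + 1) * (N / v + 1), R, by positivity, hR,
    fun a n k hk q hq => ?_⟩
  have hΛ := h.superTile a n
  have hpow : (0 : ℝ) < (⨅ j, lam j) ^ n := pow_pos (one_pos.trans h.one_lt_iInf) n
  -- Using the smallest dilatation factor only enlarges the neighborhoods and makes the bound
  -- uniform in the sequence.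
  have hmono : boundaryVolume D (R / dil lam a n) ≤ boundaryVolume D (R / (⨅ j, lam j) ^ n) :=
    h.proto.boundaryVolume_mono (div_le_div_of_nonneg_left hR.le hpow (h.iInf_pow_le_dil a n))
  have hb := boundaryVolume_nonneg D (R / (⨅ j, lam j) ^ n)
  have h1 : ∀ q' ∈ largeReps h.proto N,
      ((fullPositions (MultiSubst.superTile S a n) q q').ncard : ℝ) / dil lam a n ^ d ≤
        (N / v + 1) * boundaryVolume D (R / (⨅ j, lam j) ^ n) := by
    intro q' hq'
    obtain ⟨hcard, k', hk', hqk'⟩ := exists_mem_patchesOf_of_mem_largeReps hq'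
    have h2 := hΛ.ncard_fullPositions_le h.proto hv hvol (isSubpatch_of_mem_patchesOf hqk') hcard hq
      (hdiam k hk q hq)
    rw [hqk'.2.1] at h2
    have hd := pow_pos hΛ.pos d
    rw [div_le_iff₀ hd]
    have h3 : ((fullPositions (MultiSubst.superTile S a n) q q').ncard : ℝ) ≤
        k' * (dil lam a n ^ d * boundaryVolume D (R / dil lam a n)) / v := by
      rwa [le_div_iff₀ hv]
    refine h3.trans ?_
    have h4 : (k' : ℝ) ≤ N := by exact_mod_cast hk'
    calc _ = k' / v * boundaryVolume D (R / dil lam a n) * dil lam a n ^ d := by ring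
      _ ≤ _ := by
        refine mul_le_mul_of_nonneg_right (mul_le_mul ?_ hmono (boundaryVolume_nonneg _ _)
          (by positivity)) hd.le
        have : (k' : ℝ) / v ≤ N / v := div_le_div_of_nonneg_right h4 hv.le
        linarith
  refine (Finset.sum_le_card_nsmul _ _ _ h1).trans ?_
  rw [nsmul_eq_mul]
  have : 0 ≤ (N / v + 1) * boundaryVolume D (R / (⨅ j, lam j) ^ n) := by positivity
  nlinarith

theorem tendsto_div_pow [Finite J] [Nonempty J] (h : IsSystem X D S lam) {R : ℝ} (hR : 0 < R) :
    Tendsto (fun n : ℕ => R / (⨅ j, lam j) ^ n) atTop (𝓝[>] 0) := by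
  refine tendsto_nhdsWithin_iff.2 ⟨?_, Eventually.of_forall fun n =>
    div_pos hR (pow_pos (one_pos.trans h.one_lt_iInf) n)⟩
  exact (tendsto_const_nhds).div_atTop (tendsto_pow_atTop_atTop_of_one_lt h.one_lt_iInf)

theorem tendsto_boundaryVolume [Nonempty J] (h : IsSystem X D S lam) :
    Tendsto (boundaryVolume D) (𝓝[>] 0) (𝓝 0) := by
  obtain ⟨κ, C, hκ, hC, hb⟩ := h.proto.exists_boundaryVolume_le h.family.mem
    (h.inflation (Classical.arbitrary J)) (h.one_lt _)
  have hlim : Tendsto (fun r : ℝ => C * r ^ κ) (𝓝[>] 0) (𝓝 0) := by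
    have : Tendsto (fun r : ℝ => C * r ^ κ) (𝓝 0) (𝓝 (C * 0 ^ κ)) :=
      ((Real.continuousAt_rpow_const 0 κ (Or.inr hκ.le)).tendsto).const_mul C
    rw [Real.zero_rpow hκ.ne', mul_zero] at this
    exact this.mono_left nhdsWithin_le_nhds
  refine squeeze_zero' (Eventually.of_forall fun r => boundaryVolume_nonneg D r) ?_ hlim
  filter_upwards [Ioc_mem_nhdsGT (zero_lt_one' ℝ)] with r hr using hb r hr.1 hr.2

/-- The existence of the patch frequencies. -/
theorem exists_patchFrequency [Finite J] [Nonempty J] (h : IsSystem X D S lam)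
    (hX : (tilesOf X).Nonempty) {c : (ℕ → J) → Fin l → ℝ}
    (hc : ∀ a i k, Tendsto (fun n => density S a n {D i} (D k)) atTop (𝓝 (c a i)))
    (a : ℕ → J) {N : ℕ} {q : Set (Set (E d))} (hq : q ∈ patchesOf X N) :
    ∃ f : ℝ, ∀ i, Tendsto (fun n => density S a n q (D i)) atTop (𝓝 f) := by
  obtain ⟨P, hP⟩ := hX
  have := h.nonempty_fin hP
  obtain ⟨K, R, hK, hR, hcross⟩ := h.exists_sum_fullPositions_le N
  obtain ⟨v, hv, hvol⟩ := h.proto.exists_le_volume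
  refine exists_tendsto_of_forall_eps fun ε hε => ?_
  have hlim : Tendsto (fun n : ℕ => K * boundaryVolume D (R / (⨅ j, lam j) ^ n) * (1 / v)) atTop
      (𝓝 0) := by
    have := ((h.tendsto_boundaryVolume.comp (h.tendsto_div_pow hR)).const_mul K).mul_const (1 / v)
    simpa using this
  -- At this fixed level the crossing term is at most `ε / 2` for all further levels `m`, and only
  -- tile densities of the shifted sequence remain to converge.
  obtain ⟨n, hn⟩ := (hlim.eventually (ge_mem_nhds (half_pos hε))).exists
  set b : ℕ → J := fun r => a (n + r) with hb
  refine ⟨∑ j, density S a n q (D j) * (c b j * volume.real (D j)), fun i => ?_⟩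
  have hmain : Tendsto (fun m => ∑ j, density S a n q (D j) *
      (density S b m {D j} (D i) * volume.real (D j))) atTop
      (𝓝 (∑ j, density S a n q (D j) * (c b j * volume.real (D j)))) :=
    tendsto_finsetSum _ fun j _ => ((hc b j i).mul_const _).const_mul _
  obtain ⟨m₀, hm₀⟩ := eventually_atTop.1 (Metric.tendsto_nhds.1 hmain (ε / 2) (half_pos hε))
  filter_upwards [eventually_ge_atTop (n + m₀)] with m hm
  obtain ⟨m, rfl⟩ := Nat.exists_eq_add_of_le ((Nat.le_add_right n m₀).trans hm)
  rw [h.density_add a n m le_rfl hq]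
  have h1 := hm₀ m (by omega)
  rw [Real.dist_eq] at h1
  have h2 : ∑ q' ∈ largeReps h.proto N,
      ((fullPositions (MultiSubst.superTile S a n) q q').ncard : ℝ) / dil lam a n ^ d *
        density S b m q' (D i) ≤ ε / 2 := by
    refine le_trans ?_ hn
    refine le_trans ?_ (mul_le_mul_of_nonneg_right (hcross a n N le_rfl q hq) (by positivity))
    rw [Finset.sum_mul]
    refine Finset.sum_le_sum fun q' hq' => mul_le_mul_of_nonneg_left ?_ ?_
    · obtain ⟨-, k, -, hk⟩ := exists_mem_patchesOf_of_mem_largeReps hq'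
      exact h.density_le hv hvol b m hk (h.family.mem i)
    · exact div_nonneg (Nat.cast_nonneg _) (pow_nonneg (h.superTile a n).pos.le _)
  have h3 : 0 ≤ ∑ q' ∈ largeReps h.proto N,
      ((fullPositions (MultiSubst.superTile S a n) q q').ncard : ℝ) / dil lam a n ^ d *
        density S b m q' (D i) :=
    Finset.sum_nonneg fun q' _ => mul_nonneg
      (div_nonneg (Nat.cast_nonneg _) (pow_nonneg (h.superTile a n).pos.le _))
      (density_nonneg _ _ _ _ _)
  have h4 := abs_lt.1 h1
  rw [abs_le]
  constructor <;> linarith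

/-- The renormalization equation of the patch frequencies. -/
theorem patchFrequency_eq (h : IsSystem X D S lam) [Nonempty (Fin l)]
    {f : (ℕ → J) → Set (Set (E d)) → ℝ}
    (hf : ∀ (a : ℕ → J) (N : ℕ), ∀ q ∈ patchesOf X N, ∀ i,
      Tendsto (fun n => density S a n q (D i)) atTop (𝓝 (f a q)))
    (a : ℕ → J) (n : ℕ) {k N : ℕ} (hkN : k ≤ N) {q : Set (Set (E d))} (hq : q ∈ patchesOf X k) :
    f a q = ∑ j, density S a n q (D j) * (f (fun r => a (n + r)) {D j} * volume.real (D j)) +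
      ∑ q' ∈ largeReps h.proto N,
        (fullPositions (MultiSubst.superTile S a n) q q').ncard / dil lam a n ^ d *
          f (fun r => a (n + r)) q' := by
  obtain ⟨i⟩ := ‹Nonempty (Fin l)›
  have h1 := (hf a k q hq i).comp (tendsto_add_atTop_nat n)
  refine tendsto_nhds_unique h1 ?_
  simp only [Function.comp_def, add_comm _ n, h.density_add a n _ hkN hq]
  refine Tendsto.add (tendsto_finsetSum _ fun j _ => ?_) (tendsto_finsetSum _ fun q' hq' => ?_)
  · exact ((hf _ 1 _ (singleton_mem_patchesOf (h.family.mem j)) i).mul_const _).const_mul _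
  · obtain ⟨-, k', -, hk'⟩ := exists_mem_patchesOf_of_mem_largeReps hq'
    exact (hf _ k' q' hk' i).const_mul _

/-- The exponential dependence of the patch frequencies on the sequence. -/
theorem exists_patchFrequency_sub_le [Finite J] [Nonempty J] [Nonempty (Fin l)]
    (h : IsSystem X D S lam) {f : (ℕ → J) → Set (Set (E d)) → ℝ}
    (hf : ∀ (a : ℕ → J) (N : ℕ), ∀ q ∈ patchesOf X N, ∀ i,
      Tendsto (fun n => density S a n q (D i)) atTop (𝓝 (f a q)))
    {θ θ' C : ℝ} (hθ : 0 ≤ θ) (hθ' : 0 < θ') (hθθ' : θ ≤ θ') (hC : 0 < C)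
    (hθ1 : θ' ≤ 1)
    (hrate : ∀ (n : ℕ) (a b : ℕ → J), (∀ r < n, a r = b r) →
      ∀ i, |f a {D i} - f b {D i}| ≤ C * θ ^ n)
    (hsmall : ∀ K R : ℝ, 0 < K → 0 < R →
      ∃ n : ℕ, 0 < n ∧ K * boundaryVolume D (R / (⨅ j, lam j) ^ n) ≤ θ' ^ n / 2) (N : ℕ) :
    ∃ C' : ℝ, 0 < C' ∧ ∀ (n : ℕ) (a b : ℕ → J), (∀ r < n, a r = b r) →
      ∀ k ≤ N, ∀ q ∈ patchesOf X k, |f a q - f b q| ≤ C' * θ' ^ n := by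
  obtain ⟨K, R, hK, hR, hcross⟩ := h.exists_sum_fullPositions_le N
  obtain ⟨v, hv, hvol⟩ := h.proto.exists_le_volume
  obtain ⟨V, hV, hVol⟩ := h.proto.exists_volume_le
  obtain ⟨n₀, hn₀, hsm⟩ := hsmall K R hK hR
  have hpow : 0 < θ' ^ n₀ := pow_pos hθ' _
  set B : ℝ := l * (1 / v * (C * V)) with hB
  have hB0 : 0 ≤ B := by positivity
  have hbd : ∀ (a : ℕ → J) (k : ℕ), ∀ q ∈ patchesOf X k, 0 ≤ f a q ∧ f a q ≤ 1 / v := by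
    intro a k q hq
    have h1 := hf a k q hq (Classical.arbitrary _)
    exact ⟨ge_of_tendsto' h1 fun n => density_nonneg _ _ _ _ _,
      le_of_tendsto' h1 fun n => h.density_le hv hvol a n hq (h.family.mem _)⟩
  refine ⟨(1 / v + 2 * B) / θ' ^ n₀, by positivity, ?_⟩
  -- The summand `1 / v` covers the trivial bound when fewer than `n₀` letters agree; `2 * B` lets
  -- the tile term fit into the half of the budget left by the crossing term.
  set C' : ℝ := (1 / v + 2 * B) / θ' ^ n₀ with hC'
  have hC'0 : 0 < C' := by positivity
  intro L
  induction L using Nat.strong_induction_on with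
  | _ L ih =>
    intro a b hab k hk q hq
    rcases lt_or_ge L n₀ with hL | hL
    · obtain ⟨h1, h2⟩ := hbd a k q hq
      obtain ⟨h3, h4⟩ := hbd b k q hq
      have h5 : |f a q - f b q| ≤ 1 / v := by
        rw [abs_le]
        constructor <;> linarith
      refine h5.trans ?_
      have h6 : θ' ^ n₀ ≤ θ' ^ L := pow_le_pow_of_le_one hθ'.le hθ1 hL.le
      rw [hC', div_mul_eq_mul_div, le_div_iff₀ hpow]
      have h7 : 0 < 1 / v := by positivity
      calc 1 / v * θ' ^ n₀ ≤ 1 / v * θ' ^ L := mul_le_mul_of_nonneg_left h6 h7.le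
        _ ≤ _ := mul_le_mul_of_nonneg_right (by linarith) (pow_nonneg hθ'.le _)
    · obtain ⟨m, rfl⟩ := Nat.exists_eq_add_of_le hL
      have hab₀ : ∀ r < n₀, a r = b r := fun r hr => hab r (by omega)
      have hshift : ∀ r < m, a (n₀ + r) = b (n₀ + r) := fun r hr => hab _ (by omega)
      rw [h.patchFrequency_eq hf a n₀ hk hq, h.patchFrequency_eq hf b n₀ hk hq]
      -- The coefficients involve only the first `n₀` letters, so they are the same for both
      -- sequences.
      have hT := superTile_congr S hab₀
      simp only [density, hT, dil_congr lam hab₀]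
      rw [add_sub_add_comm, ← Finset.sum_sub_distrib, ← Finset.sum_sub_distrib]
      have h1 : |∑ j, (density S b n₀ q (D j) * (f (fun r => a (n₀ + r)) {D j} * volume.real (D j)) -
          density S b n₀ q (D j) * (f (fun r => b (n₀ + r)) {D j} * volume.real (D j)))| ≤
          B * θ ^ m := by
        refine (Finset.abs_sum_le_sum_abs _ _).trans ?_
        have h2 : ∀ j ∈ Finset.univ,
            |density S b n₀ q (D j) * (f (fun r => a (n₀ + r)) {D j} * volume.real (D j)) -
              density S b n₀ q (D j) * (f (fun r => b (n₀ + r)) {D j} * volume.real (D j))| ≤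
            1 / v * (C * V) * θ ^ m := by
          intro j _
          have h3 := density_nonneg S b n₀ q (D j)
          have h4 := h.density_le hv hvol b n₀ hq (h.family.mem j)
          have h5 := hVol _ (h.family.mem j)
          have h6 := hrate m _ _ hshift j
          rw [← mul_sub, ← sub_mul, abs_mul, abs_mul, abs_of_nonneg h3,
            abs_of_nonneg (measureReal_nonneg (μ := volume) (s := D j))]
          calc _ ≤ 1 / v * ((C * θ ^ m) * V) :=
                mul_le_mul h4 (mul_le_mul h6 h5 measureReal_nonneg (by positivity))
                  (by positivity) (by positivity)
            _ = _ := by ring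
        refine (Finset.sum_le_card_nsmul _ _ _ h2).trans (le_of_eq ?_)
        rw [nsmul_eq_mul, Finset.card_univ, Fintype.card_fin, hB]
        ring
      have h2 : |∑ q' ∈ largeReps h.proto N,
          (((fullPositions (MultiSubst.superTile S b n₀) q q').ncard : ℝ) / dil lam b n₀ ^ d *
            f (fun r => a (n₀ + r)) q' -
          ((fullPositions (MultiSubst.superTile S b n₀) q q').ncard : ℝ) / dil lam b n₀ ^ d *
            f (fun r => b (n₀ + r)) q')| ≤ θ' ^ n₀ / 2 * (C' * θ' ^ m) := by
        refine (Finset.abs_sum_le_sum_abs _ _).trans ?_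
        refine le_trans ?_ (mul_le_mul_of_nonneg_right ((hcross b n₀ k hk q hq).trans hsm)
          (by positivity))
        rw [Finset.sum_mul]
        refine Finset.sum_le_sum fun q' hq' => ?_
        obtain ⟨-, k', hk', hqk'⟩ := exists_mem_patchesOf_of_mem_largeReps hq'
        have hnn : 0 ≤ ((fullPositions (MultiSubst.superTile S b n₀) q q').ncard : ℝ) /
            dil lam b n₀ ^ d :=
          div_nonneg (Nat.cast_nonneg _) (pow_nonneg (h.superTile b n₀).pos.le _)
        rw [← mul_sub, abs_mul, abs_of_nonneg hnn]
        exact mul_le_mul_of_nonneg_left (ih m (by omega) _ _ hshift k' hk' q' hqk') hnn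
      refine (abs_add_le _ _).trans ((add_le_add h1 h2).trans ?_)
      have h3 : B * θ ^ m ≤ θ' ^ n₀ / 2 * (C' * θ' ^ m) := by
        have h4 : θ ^ m ≤ θ' ^ m := pow_le_pow_left₀ hθ hθθ' m
        have h5 : θ' ^ n₀ * C' = 1 / v + 2 * B := by
          rw [hC']
          field_simp
        have h6 : θ' ^ n₀ / 2 * (C' * θ' ^ m) = (1 / v + 2 * B) / 2 * θ' ^ m := by
          rw [← h5]
          ring
        rw [h6]
        have h7 : 0 < 1 / v := by positivity
        exact mul_le_mul (by linarith) h4 (pow_nonneg hθ _) (by linarith)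
      calc _ ≤ θ' ^ n₀ / 2 * (C' * θ' ^ m) + θ' ^ n₀ / 2 * (C' * θ' ^ m) := by linarith
        _ = _ := by ring

/-- For a number larger than the rate of decay of the boundaries, the proportion of positions
crossing boundaries decays faster than its powers. -/
theorem exists_mul_boundaryVolume_le [Finite J] [Nonempty J] (h : IsSystem X D S lam) {γ θ' : ℝ}
    (hγ : γ < d - boundaryDim D) (hθ' : (⨅ j, lam j) ^ (-γ) < θ') {K R : ℝ} (hK : 0 < K)
    (hR : 0 < R) :
    ∃ n : ℕ, 0 < n ∧ K * boundaryVolume D (R / (⨅ j, lam j) ^ n) ≤ θ' ^ n / 2 := by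
  set m := ⨅ j, lam j with hm
  have hm1 : 1 < m := h.one_lt_iInf
  have hm0 : 0 < m := one_pos.trans hm1
  obtain ⟨K', hK', hb⟩ := exists_boundaryVolume_le_of_boundaryDim_lt h.proto h.family.mem
    (h.inflation (Classical.arbitrary J)) (h.one_lt _) (β := d - γ) (by linarith)
  rw [sub_sub_cancel] at hb
  have h1 := (h.tendsto_div_pow hR).eventually hb
  have hpos : 0 < m ^ (-γ) := Real.rpow_pos_of_pos hm0 _
  have hθ0 : 0 < θ' := hpos.trans hθ'
  -- The ratio `m ^ (-γ) / θ'` is below one, so for large `n` its powers absorb every constant and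
  -- the factor `1 / 2`.
  have hratio : Tendsto (fun n : ℕ => K * (K' * R ^ γ) * (m ^ (-γ) / θ') ^ n) atTop (𝓝 0) := by
    have := (tendsto_pow_atTop_nhds_zero_of_lt_one (div_pos hpos hθ0).le
      ((div_lt_one hθ0).2 hθ')).const_mul (K * (K' * R ^ γ))
    simpa using this
  obtain ⟨n, ⟨h2, h3⟩, h4⟩ := ((h1.and (hratio.eventually
    (ge_mem_nhds (show (0 : ℝ) < 1 / 2 by norm_num)))).and (eventually_gt_atTop 0)).exists
  refine ⟨n, h4, ?_⟩
  have h5 : (R / m ^ n) ^ γ = R ^ γ * (m ^ (-γ)) ^ n := by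
    rw [Real.div_rpow hR.le (pow_nonneg hm0.le _), div_eq_mul_inv, ← Real.rpow_natCast m n,
      ← Real.rpow_mul hm0.le, ← Real.rpow_natCast, ← Real.rpow_mul hm0.le, ← Real.rpow_neg hm0.le]
    congr 2
    ring
  rw [h5] at h2
  have h6 : 0 < θ' ^ n := pow_pos hθ0 _
  rw [div_pow] at h3
  calc _ ≤ K * (K' * (R ^ γ * (m ^ (-γ)) ^ n)) := mul_le_mul_of_nonneg_left h2 hK.le
    _ = K * (K' * R ^ γ) * ((m ^ (-γ)) ^ n / θ' ^ n) * θ' ^ n := by field_simp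
    _ ≤ 1 / 2 * θ' ^ n := mul_le_mul_of_nonneg_right h3 h6.le
    _ = _ := by ring

/-- The rate `θ₀` is at least `θ` and smaller than one, and it is larger than the rate of decay of
the boundaries. -/
theorem theta₀_spec [Finite J] [Nonempty J] (h : IsSystem X D S lam) (hd : 0 < d) {θ : ℝ}
    (hθ0 : 0 < θ) (hθ1 : θ < 1) :
    theta₀ D lam θ < 1 ∧ θ ≤ theta₀ D lam θ ∧
      ∃ γ < d - boundaryDim D, (⨅ j, lam j) ^ (-γ) < theta₀ D lam θ := by
  have hm1 : 1 < ⨅ j, lam j := h.one_lt_iInf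
  have hdim := boundaryDim_lt hd h.proto h.family.mem
    (h.inflation (Classical.arbitrary J)) (h.one_lt _)
  rw [theta₀]
  set m := ⨅ j, lam j with hm
  have hm0 : 0 < m := one_pos.trans hm1
  -- With `θ = m ^ (-y)` the rate becomes `m ^ (-x * y / (x + y))`. The witness `γ` is the midpoint
  -- of `x * y / (x + y)` and `x`, which makes both of its inequalities strict.
  set x : ℝ := d - boundaryDim D with hx
  set y : ℝ := -Real.logb m θ with hy
  have hx0 : 0 < x := by linarith
  have hy0 : 0 < y := neg_pos.2 (Real.logb_neg hm1 hθ0 hθ1)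
  have hs : (boundaryDim D - d) / (boundaryDim D - d + Real.logb m θ) = x / (x + y) := by
    rw [hx, hy, ← neg_div_neg_eq]
    congr 1 <;> ring
  rw [hs]
  have hs0 : 0 < x / (x + y) := by positivity
  have hs1 : x / (x + y) < 1 := (div_lt_one (by positivity)).2 (by linarith)
  refine ⟨Real.rpow_lt_one hθ0.le hθ1 hs0, ?_, (x * y / (x + y) + x) / 2, ?_, ?_⟩
  · conv_lhs => rw [← Real.rpow_one θ]
    exact Real.rpow_le_rpow_of_exponent_ge hθ0 hθ1.le hs1.le
  · have : x * y / (x + y) < x := by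
      rw [div_lt_iff₀ (by positivity)]
      nlinarith
    linarith
  · have hθm : θ = m ^ (-y) := by rw [hy, neg_neg, Real.rpow_logb hm0 hm1.ne' hθ0]
    rw [hθm, ← Real.rpow_mul hm0.le]
    refine Real.rpow_lt_rpow_of_exponent_lt hm1 ?_
    have h1 : x * y / (x + y) < x := by
      rw [div_lt_iff₀ (by positivity)]
      nlinarith
    have h2 : -y * (x / (x + y)) = -(x * y / (x + y)) := by ring
    rw [h2]
    linarith

end IsSystem

end

/-! ### Topology of the space of tilings -/

theorem isOpen_iff_distT {d : ℕ} {V : Set (Tiling d)} :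
    IsOpen V ↔ ∀ x ∈ V, ∃ ε > 0, ∀ y, distT x y < ε → y ∈ V := Iff.rfl

theorem exists_patches_of_distT_lt {d : ℕ} {x y : Tiling d} {ε : ℝ} (hε : ε ≤ √2 / 2)
    (h : distT x y < ε) : ∃ r, 0 < r ∧ r < ε ∧
      ∃ x' ∈ coveringPatches x.tiles (Metric.closedBall 0 (1 / r)),
      ∃ y' ∈ coveringPatches y.tiles (Metric.closedBall 0 (1 / r)),
      ∃ t : E d, ‖t‖ ≤ r ∧ translate t x' = y' := by
  obtain ⟨r, hr | ⟨hr0, -, hr⟩, hrε⟩ := exists_lt_of_csInf_lt ((singleton_nonempty (√2 / 2)).inl) h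
  · exact absurd hrε (not_lt.2 (hε.trans (le_of_eq hr.symm)))
  · exact ⟨r, hr0, hrε, hr⟩

theorem distT_le {d : ℕ} {x y : Tiling d} {r : ℝ} (hr : 0 < r) (hr2 : r < √2 / 2)
    {x' y' : Set (Set (E d))} (hx' : x' ∈ coveringPatches x.tiles (Metric.closedBall 0 (1 / r)))
    (hy' : y' ∈ coveringPatches y.tiles (Metric.closedBall 0 (1 / r))) {t : E d} (ht : ‖t‖ ≤ r)
    (hxy : translate t x' = y') : distT x y ≤ r := by
  refine csInf_le ⟨0, ?_⟩ (Or.inr ⟨hr, hr2, x', hx', y', hy', t, ht, hxy⟩)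
  rintro s (hs | hs)
  · rw [mem_singleton_iff] at hs
    rw [hs]
    positivity
  · exact hs.1.le

/-- The extra radius `1` ensures that the moved patch still covers the ball of radius `1 / r`. -/
theorem distT_le_of_translate_subset {d : ℕ} {x y : Tiling d} {r : ℝ} (hr : 0 < r)
    (hr2 : r < √2 / 2) {q : Set (Set (E d))} (hq : q ⊆ x.tiles)
    (hb : Bornology.IsBounded (supp q)) (hcov : Metric.closedBall 0 (1 / r + 1) ⊆ supp q)
    {t : E d} (ht : ‖t‖ ≤ r) (ht1 : ‖t‖ ≤ 1) (hty : translate t q ⊆ y.tiles) : distT x y ≤ r := by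
  refine distT_le hr hr2 ⟨hq, hb, ?_⟩ ⟨hty, ?_, ?_⟩ ht rfl
  · exact (Metric.closedBall_subset_closedBall (by linarith)).trans hcov
  · rw [supp_translate]
    exact hb.vadd t
  · intro v hv
    rw [supp_translate, mem_vadd_set_iff_neg_vadd_mem]
    apply hcov
    rw [mem_closedBall_zero_iff] at hv ⊢
    have := norm_add_le (-t) v
    rw [norm_neg] at this
    simp only [vadd_eq_add]
    linarith

/-- A tiling close to `x` contains a small translate of a given finite patch of `x`. -/
theorem exists_translate_subset_of_distT_lt {d : ℕ} (x : Tiling d) {q : Set (Set (E d))}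
    (hq : q ⊆ x.tiles) (hfin : q.Finite) {ε : ℝ} (hε : 0 < ε) :
    ∃ ε' > 0, ∀ y, distT x y < ε' → ∃ t : E d, ‖t‖ < ε ∧ translate t q ⊆ y.tiles := by
  obtain ⟨ρ, hρ, hb⟩ := (isBounded_supp hfin fun P hP =>
    x.isPatch.1 P (hq hP)).subset_closedBall_lt 0 0
  refine ⟨min (√2 / 2) (min ε (1 / ρ)), lt_min (by positivity) (lt_min hε (by positivity)),
    fun y hy => ?_⟩
  obtain ⟨r, hr0, hr, x', ⟨hx'1, -, hx'2⟩, y', ⟨hy'1, -, -⟩, t, ht, rfl⟩ :=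
    exists_patches_of_distT_lt (min_le_left _ _) hy
  have hrε : r < ε := hr.trans_le ((min_le_right _ _).trans (min_le_left _ _))
  have hrρ : r < 1 / ρ := hr.trans_le ((min_le_right _ _).trans (min_le_right _ _))
  refine ⟨t, ht.trans_lt hrε, (translate_mono t fun P hP => ?_).trans hy'1⟩
  have hPt := x.isPatch.1 P (hq hP)
  obtain ⟨v, hv⟩ := hPt.interior_nonempty
  refine x.isPatch.mem_of_interior_inter_supp hx'1 (hq hP) ⟨v, hv, hx'2 ?_⟩
  refine Metric.closedBall_subset_closedBall ?_ (hb (subset_supp hP (interior_subset hv)))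
  rw [lt_div_iff₀ hρ] at hrρ
  rw [le_div_iff₀ hr0]
  linarith

/-- The tilings containing a translate of `q` by a vector in `U`. -/
def cyl {d : ℕ} (q : Set (Set (E d))) (U : Set (E d)) : Set (Tiling d) :=
  {x | ∃ t ∈ U, translate t q ⊆ x.tiles}

theorem cylinder_eq {d : ℕ} (Y : Set (Tiling d)) (q : Set (Set (E d))) (U : Set (E d)) :
    cylinder Y q U = Y ∩ cyl q U := rfl

theorem isOpen_cyl {d : ℕ} {q : Set (Set (E d))} (hq : q.Finite) {U : Set (E d)} (hU : IsOpen U) :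
    IsOpen (cyl q U) := by
  rw [isOpen_iff_distT]
  rintro x ⟨t, ht, htx⟩
  obtain ⟨ε, hε, hball⟩ := Metric.isOpen_iff.1 hU t ht
  obtain ⟨ε', hε', h⟩ := exists_translate_subset_of_distT_lt x htx (hq.image _) hε
  refine ⟨ε', hε', fun y hy => ?_⟩
  obtain ⟨s, hs, hsy⟩ := h y hy
  rw [translate_translate] at hsy
  refine ⟨s + t, hball ?_, hsy⟩
  rw [Metric.mem_ball, dist_eq_norm]
  simpa using hs

theorem Tiling.ext_tiles {d : ℕ} {x y : Tiling d} (h : x.tiles = y.tiles) : x = y := by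
  cases x
  cases y
  simp only at h
  subst h
  rfl

/-- Some tile `Q` of `y` overlaps `P` without being equal to it. A tiling close to both would
contain slightly moved copies of `P` and `Q`; these still overlap, so they coincide, and `Q` is a
tiny translate of `P`, which the choice of `ε` excludes. -/
theorem Tiling.exists_disjoint_nhds {d : ℕ} {x y : Tiling d} {P : Set (E d)} (hP : P ∈ x.tiles)
    (hPy : P ∉ y.tiles) : ∃ U V : Set (Tiling d), IsOpen U ∧ IsOpen V ∧ x ∈ U ∧ y ∈ V ∧
      Disjoint U V := by
  have hPt := x.isPatch.1 P hP
  obtain ⟨p, hp⟩ := hPt.interior_nonempty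
  obtain ⟨Q, hQ, hpQ⟩ : p ∈ supp y.tiles := by rw [y.covers]; trivial
  have hQt := y.isPatch.1 Q hQ
  have hPQ : P ≠ Q := by
    rintro rfl
    exact hPy hQ
  obtain ⟨p', hp'⟩ := hQt.inter_interior_nonempty isOpen_interior ⟨p, hp, hpQ⟩
  obtain ⟨r, hr, hball⟩ := Metric.isOpen_iff.1 (isOpen_interior.inter isOpen_interior) p' hp'
  obtain ⟨ε, hε, hεr, hεu⟩ : ∃ ε : ℝ, 0 < ε ∧ 2 * ε ≤ r ∧
      ∀ u : E d, Q = u +ᵥ P → 2 * ε ≤ ‖u‖ := by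
    by_cases hu : ∃ u : E d, Q = u +ᵥ P
    · obtain ⟨u, hu⟩ := hu
      have hu0 : 0 < ‖u‖ := norm_pos_iff.2 fun h0 => hPQ (by rw [hu, h0, zero_vadd])
      refine ⟨min r ‖u‖ / 2, half_pos (lt_min hr hu0), ?_, fun w hw => ?_⟩
      · linarith [min_le_left r ‖u‖]
      · obtain rfl := hPt.vadd_injective (hu.symm.trans hw : u +ᵥ P = w +ᵥ P)
        linarith [min_le_right r ‖u‖]
    · exact ⟨r / 2, half_pos hr, by linarith, fun u h => absurd ⟨u, h⟩ hu⟩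
  refine ⟨cyl {P} (Metric.ball 0 ε), cyl {Q} (Metric.ball 0 ε),
    isOpen_cyl (finite_singleton _) Metric.isOpen_ball,
    isOpen_cyl (finite_singleton _) Metric.isOpen_ball,
    ⟨0, Metric.mem_ball_self hε, by simpa [translate_zero] using hP⟩,
    ⟨0, Metric.mem_ball_self hε, by simpa [translate_zero] using hQ⟩, ?_⟩
  rw [disjoint_left]
  rintro z ⟨s, hs, hsz⟩ ⟨t, ht, htz⟩
  rw [mem_ball_zero_iff] at hs ht
  simp only [translate, image_singleton, singleton_subset_iff] at hsz htz
  have heq : s +ᵥ P = t +ᵥ Q := by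
    refine z.isPatch.eq_of_interior hsz htz ⟨t + p', ?_, ?_⟩
    · rw [interior_vadd, mem_vadd_set_iff_neg_vadd_mem]
      refine (hball ?_).1
      rw [Metric.mem_ball, dist_eq_norm]
      have : (-s +ᵥ (t + p')) - p' = t - s := by
        simp only [vadd_eq_add]
        abel
      rw [this]
      linarith [norm_sub_le t s]
    · rw [interior_vadd]
      exact ⟨p', hp'.2, rfl⟩
  have hQeq : Q = (s - t) +ᵥ P := by
    rw [sub_eq_neg_add, add_vadd, heq, neg_vadd_vadd]
  have := hεu _ hQeq
  linarith [norm_sub_le s t]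

instance {d : ℕ} : T2Space (Tiling d) := by
  refine ⟨fun x y hxy => ?_⟩
  by_cases h : x.tiles ⊆ y.tiles
  · obtain ⟨P, hP, hPx⟩ := not_subset.1 fun h' : y.tiles ⊆ x.tiles =>
      hxy (Tiling.ext_tiles (h.antisymm h'))
    obtain ⟨U, V, hU, hV, hyU, hxV, hUV⟩ := Tiling.exists_disjoint_nhds hP hPx
    exact ⟨V, U, hV, hU, hxV, hyU, hUV.symm⟩
  · obtain ⟨P, hP, hPy⟩ := not_subset.1 h
    exact Tiling.exists_disjoint_nhds hP hPy

theorem closedBall_subset_vadd {d : ℕ} {K : Set (E d)} {R : ℝ} (h : Metric.closedBall 0 R ⊆ K)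
    (t : E d) : Metric.closedBall 0 (R - ‖t‖) ⊆ t +ᵥ K := by
  intro v hv
  rw [mem_vadd_set_iff_neg_vadd_mem]
  apply h
  rw [mem_closedBall_zero_iff] at hv ⊢
  have := norm_add_le (-t) v
  rw [norm_neg] at this
  simp only [vadd_eq_add]
  linarith

/-- Agreement on a ball of radius `1 / r₁ + ‖t‖` becomes, after the shift, agreement on a ball of
radius `1 / r₁`. -/
theorem continuous_shift {d : ℕ} (t : E d) : Continuous (Tiling.shift t) := by
  rw [continuous_def]
  intro V hV
  rw [isOpen_iff_distT] at hV ⊢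
  intro x hx
  obtain ⟨ε, hε, hball⟩ := hV _ hx
  set r₁ : ℝ := min (ε / 2) (1 / 2) with hr₁
  have hr₁0 : 0 < r₁ := lt_min (by positivity) (by norm_num)
  have hr₁2 : r₁ < √2 / 2 := by
    have h1 : r₁ ≤ 1 / 2 := min_le_right _ _
    have h2 : 1 < √2 := by
      rw [Real.lt_sqrt (by norm_num)]
      norm_num
    linarith
  have hpos : 0 < 1 / (1 / r₁ + ‖t‖) := by positivity
  refine ⟨min (√2 / 2) (1 / (1 / r₁ + ‖t‖)), lt_min (by positivity) hpos, fun y hy => hball _ ?_⟩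
  obtain ⟨r, hr0, hr, x', ⟨hx'1, hx'b, hx'2⟩, y', ⟨hy'1, hy'b, hy'2⟩, s, hs, hxy⟩ :=
    exists_patches_of_distT_lt (min_le_left _ _) hy
  have hr3 : 1 / r₁ + ‖t‖ < 1 / r := by
    have h1 := hr.trans_le (min_le_right _ _)
    rw [lt_div_iff₀ (by positivity)] at h1
    rw [lt_div_iff₀ hr0]
    linarith
  have hrr₁ : r ≤ r₁ := by
    have : 1 / r₁ < 1 / r := by linarith [norm_nonneg t]
    exact ((one_div_lt_one_div hr₁0 hr0).1 this).le
  have hlt : r₁ < ε := lt_of_le_of_lt (min_le_left _ _) (by linarith)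
  refine lt_of_le_of_lt (distT_le hr₁0 hr₁2 (x' := translate t x') (y' := translate t y')
    ⟨translate_mono t hx'1, ?_, ?_⟩ ⟨translate_mono t hy'1, ?_, ?_⟩ (hs.trans hrr₁) ?_) hlt
  · rw [supp_translate]
    exact hx'b.vadd t
  · rw [supp_translate]
    exact (Metric.closedBall_subset_closedBall (by linarith)).trans (closedBall_subset_vadd hx'2 t)
  · rw [supp_translate]
    exact hy'b.vadd t
  · rw [supp_translate]
    exact (Metric.closedBall_subset_closedBall (by linarith)).trans (closedBall_subset_vadd hy'2 t)
  · rw [translate_translate, add_comm, ← translate_translate, hxy]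

section

variable {d l : ℕ} {X : Set (Tiling d)} {D : Fin l → Set (E d)}

/-- Every neighborhood of a tiling in `X` contains a neighborhood given by a finite patch. -/
theorem HasPrototiles.exists_cyl_subset (hX : HasPrototiles X D) {x : Tiling d} (hx : x ∈ X)
    {V : Set (Tiling d)} (hV : IsOpen V) (hxV : x ∈ V) :
    ∃ N, ∃ q ∈ patchesOf X N, q ⊆ x.tiles ∧ ∃ ε > 0, cyl q (Metric.ball 0 ε) ⊆ V := by
  obtain ⟨ε, hε, hball⟩ := isOpen_iff_distT.1 hV x hxV
  set r : ℝ := min (ε / 2) (1 / 2) with hr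
  have hr0 : 0 < r := lt_min (by positivity) (by norm_num)
  have hr2 : r < √2 / 2 := by
    have h1 : r ≤ 1 / 2 := min_le_right _ _
    have h2 : 1 < √2 := by
      rw [Real.lt_sqrt (by norm_num)]
      norm_num
    linarith
  obtain ⟨N, hN⟩ := hX.exists_ballPatch_mem (show 0 ≤ 1 / r + 1 by positivity)
  obtain ⟨k, -, hk⟩ := hN x hx
  refine ⟨k, _, hk, ballPatch_subset _ _, min r 1, lt_min hr0 one_pos, ?_⟩
  rintro y ⟨t, ht, hty⟩
  rw [mem_ball_zero_iff, lt_min_iff] at ht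
  apply hball
  refine lt_of_le_of_lt (distT_le_of_translate_subset hr0 hr2 (ballPatch_subset _ _)
    (isSubpatch_of_mem_patchesOf hk).isBounded_supp (closedBall_subset_supp_ballPatch x _) ht.1.le
    ht.2.le hty) ?_
  exact lt_of_le_of_lt (min_le_left _ _) (by linarith)

theorem HasPrototiles.isTopologicalBasis (hX : HasPrototiles X D) :
    TopologicalSpace.IsTopologicalBasis {V : Set X | ∃ q ∈ ⋃ N, patchReps X N,
      ∃ B ∈ TopologicalSpace.countableBasis (E d), V = Subtype.val ⁻¹' cyl q B} := by
  refine TopologicalSpace.isTopologicalBasis_of_isOpen_of_nhds ?_ ?_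
  · rintro V ⟨q, hq, B, hB, rfl⟩
    obtain ⟨N, hN⟩ := mem_iUnion.1 hq
    obtain ⟨k, -, hk⟩ := hX.space.exists_mem_patchesOf_of_mem_patchReps hN
    exact (isOpen_cyl hk.1 (TopologicalSpace.isOpen_of_mem_countableBasis hB)).preimage
      continuous_subtype_val
  · rintro ⟨x, hx⟩ V hxV hV
    obtain ⟨W, hW, rfl⟩ := isOpen_induced_iff.1 hV
    obtain ⟨N, q, hq, hqx, ε, hε, hsub⟩ := hX.exists_cyl_subset hx hW hxV
    obtain ⟨s, hs⟩ := exists_eq_translate_rep q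
    obtain ⟨B, hB, hsB, hBε⟩ := (TopologicalSpace.isBasis_countableBasis (E d)).exists_subset_of_mem_open
      (Metric.mem_ball_self hε : s ∈ Metric.ball s ε) Metric.isOpen_ball
    refine ⟨_, ⟨rep q, mem_iUnion.2 ⟨N, q, ⟨N, le_rfl, hq⟩, rfl⟩, B, hB, rfl⟩, ⟨s, hsB, hs ▸ hqx⟩, ?_⟩
    rintro ⟨y, hy⟩ ⟨t, ht, hty⟩
    refine hsub ⟨t - s, ?_, ?_⟩
    · rw [mem_ball_zero_iff, ← dist_eq_norm]
      exact hBε ht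
    · rw [hs, translate_translate, sub_add_cancel]
      exact hty

/-- There are countably many patch classes, so cylinders over a countable basis of `ℝ^d` form a
countable basis. -/
theorem HasPrototiles.secondCountableTopology (hX : HasPrototiles X D) :
    SecondCountableTopology X := by
  refine hX.isTopologicalBasis.secondCountableTopology ?_
  have : {V : Set X | ∃ q ∈ ⋃ N, patchReps X N,
      ∃ B ∈ TopologicalSpace.countableBasis (E d), V = Subtype.val ⁻¹' cyl q B} ⊆
      (fun p : Set (Set (E d)) × Set (E d) => (Subtype.val ⁻¹' cyl p.1 p.2 : Set X)) ''
        ((⋃ N, patchReps X N) ×ˢ TopologicalSpace.countableBasis (E d)) := by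
    rintro V ⟨q, hq, B, hB, rfl⟩
    exact ⟨(q, B), ⟨hq, hB⟩, rfl⟩
  refine Countable.mono this (Countable.image ?_ _)
  exact (countable_iUnion fun N => (hX.finite_patchReps N).countable).prod
    (TopologicalSpace.countable_countableBasis _)

/-- The translation action on `X`. -/
def shiftOn (hX : IsTilingSpace X) (t : E d) (x : X) : X :=
  ⟨Tiling.shift t x, hX.invariant x x.2 t⟩

theorem mem_cyl_shift {q : Set (Set (E d))} {U : Set (E d)} {x : Tiling d} {s : E d} :
    x.shift s ∈ cyl q U ↔ ∃ t, s + t ∈ U ∧ translate t q ⊆ x.tiles := by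
  constructor
  · rintro ⟨t, ht, htx⟩
    refine ⟨-s + t, by simpa using ht, ?_⟩
    rw [← translate_translate, translate_subset_iff, neg_neg]
    exact htx
  · rintro ⟨t, ht, htx⟩
    refine ⟨s + t, ht, ?_⟩
    rw [← translate_translate]
    exact translate_mono s htx

/-- By `mem_cyl_shift`, a shifted tiling lies in a cylinder when the sum of the shift and some
position lies in an open set, so continuity of addition is enough. -/
theorem HasPrototiles.continuous_shiftOn (hX : HasPrototiles X D) :
    Continuous fun p : E d × X => shiftOn hX.space p.1 p.2 := by
  rw [hX.isTopologicalBasis.continuous_iff]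
  rintro V ⟨q, hq, B, hB, rfl⟩
  obtain ⟨N, hN⟩ := mem_iUnion.1 hq
  obtain ⟨k, -, hk⟩ := hX.space.exists_mem_patchesOf_of_mem_patchReps hN
  have hBo := TopologicalSpace.isOpen_of_mem_countableBasis hB
  rw [isOpen_iff_forall_mem_open]
  rintro ⟨s, x⟩ hsx
  obtain ⟨t, ht, htx⟩ := mem_cyl_shift.1 hsx
  obtain ⟨U₁, U₂, hU₁, hU₂, hs, ht', hsub⟩ :=
    isOpen_prod_iff.1 (hBo.preimage (continuous_add : Continuous fun p : E d × E d => p.1 + p.2))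
      s t ht
  refine ⟨U₁ ×ˢ (Subtype.val ⁻¹' cyl q U₂), ?_,
    hU₁.prod ((isOpen_cyl hk.1 hU₂).preimage continuous_subtype_val), hs, t, ht', htx⟩
  rintro ⟨s', y⟩ ⟨hs', t', ht', hty⟩
  exact mem_cyl_shift.2 ⟨t', hsub (mk_mem_prod hs' ht'), hty⟩

end

/-! ### Compactness -/

section

variable {d l : ℕ} {X : Set (Tiling d)} {D : Fin l → Set (E d)}

/-- Along an ultrafilter on `X`, the patches covering a ball converge to a patch. -/
theorem HasPrototiles.exists_limit_patch (hX : HasPrototiles X D) (f : Ultrafilter (Tiling d))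
    (hf : X ∈ f) {R : ℝ} (hR : 0 ≤ R) :
    ∃ (z : Set (Set (E d))) (e : Tiling d → E d), Tendsto e f (𝓝 0) ∧
      ∀ᶠ x in (f : Filter (Tiling d)), x ∈ X ∧ ballPatch x R = translate (e x) z := by
  obtain ⟨N, hN⟩ := hX.exists_ballPatch_mem hR
  have h1 : (⋃ q ∈ patchReps X N, {x | x ∈ X ∧ rep (ballPatch x R) = q}) ∈ f := by
    refine mem_of_superset hf fun x hx => ?_
    obtain ⟨k, hk, hkq⟩ := hN x hx
    simp only [mem_iUnion]
    exact ⟨_, ⟨_, ⟨k, hk, hkq⟩, rfl⟩, hx, rfl⟩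
  -- The ultrafilter selects one of finitely many patch classes. The translations `τ` stay bounded
  -- because the patch covers the origin, so they converge along it.
  obtain ⟨q, hq, hqf⟩ := (Ultrafilter.finite_biUnion_mem_iff (hX.finite_patchReps N)).1 h1
  have h2 : ∀ x : Tiling d, ∃ t, ballPatch x R = translate t (rep (ballPatch x R)) :=
    fun x => exists_eq_translate_rep _
  choose τ hτ using h2
  obtain ⟨k, -, hk⟩ := hX.space.exists_mem_patchesOf_of_mem_patchReps hq
  obtain ⟨ρ, hρ⟩ := (isSubpatch_of_mem_patchesOf hk).isBounded_supp.subset_closedBall 0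
  have h3 : ∀ x ∈ {x | x ∈ X ∧ rep (ballPatch x R) = q}, τ x ∈ Metric.closedBall 0 (R + ρ) := by
    rintro x ⟨hx, hxq⟩
    have h0 : (0 : E d) ∈ supp (ballPatch x R) :=
      closedBall_subset_supp_ballPatch x R (Metric.mem_closedBall_self hR)
    rw [hτ x, hxq, supp_translate, mem_vadd_set_iff_neg_vadd_mem] at h0
    have h4 := hρ h0
    rw [mem_closedBall_zero_iff] at h4 ⊢
    simp only [vadd_eq_add, add_zero, norm_neg] at h4
    linarith
  obtain ⟨σ, -, hσ⟩ := (isCompact_closedBall (0 : E d) (R + ρ)).ultrafilter_le_nhds (f.map τ)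
    (by
      rw [le_principal_iff]
      exact Filter.mem_of_superset (f := (f : Filter (Tiling d))) hqf h3)
  refine ⟨translate σ q, fun x => τ x - σ, ?_, ?_⟩
  · have h4 : Tendsto τ f (𝓝 σ) := hσ
    simpa using h4.sub_const σ
  · filter_upwards [hqf] with x hx
    refine ⟨hx.1, ?_⟩
    rw [translate_translate, sub_add_cancel]
    conv_lhs => rw [hτ x, hx.2]

/-- Along an ultrafilter the patches covering balls of integer radii converge up to vanishing
translations. Their limits are nested, and the union of these is the limit tiling. -/
theorem HasPrototiles.isCompact (hX : HasPrototiles X D) : IsCompact X := by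
  rw [isCompact_iff_ultrafilter_le_nhds]
  intro f hf
  rw [le_principal_iff] at hf
  have h1 := fun n : ℕ => hX.exists_limit_patch f hf (Nat.cast_nonneg n : (0 : ℝ) ≤ n)
  choose z e he hz using h1
  have hne : ∀ n, ∃ P ∈ z n, IsTile P := by
    intro n
    obtain ⟨x, hx, hxz⟩ := (hz n).exists
    have h0 : (0 : E d) ∈ supp (ballPatch x n) :=
      closedBall_subset_supp_ballPatch x n (Metric.mem_closedBall_self (Nat.cast_nonneg n))
    obtain ⟨P, hP, -⟩ := h0
    have hPt := (x.isPatch.1 P hP.1).vadd (-e n x)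
    rw [hxz, mem_translate] at hP
    exact ⟨_, hP, hPt⟩
  have hfin : ∀ n, (z n).Finite := by
    intro n
    obtain ⟨x, hx, hxz⟩ := (hz n).exists
    have h2 := (hX.finite_ballPatch hx n).image fun P => -e n x +ᵥ P
    have h3 : translate (-e n x) (ballPatch x n) = z n := by
      rw [hxz, translate_translate, neg_add_cancel, translate_zero]
    rw [← h3]
    exact h2
  have hpatch : ∀ n, IsPatch (z n) := by
    intro n
    obtain ⟨x, hx, hxz⟩ := (hz n).exists
    have h2 := (x.isPatch.mono (ballPatch_subset x n)).translate (-e n x)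
    rwa [hxz, translate_translate, neg_add_cancel, translate_zero] at h2
  -- The inclusion holds after translations tending to zero. As a finite set, `positions (z m) (z
  -- n)` is closed, so it contains `0`.
  have hmono : ∀ m n, m ≤ n → z m ⊆ z n := by
    intro m n hmn
    obtain ⟨P, hP, hPt⟩ := hne m
    have hclosed : IsClosed (positions (z m) (z n)) := (finite_positions hPt hP (hfin n)).isClosed
    have h2 : Tendsto (fun x => e m x - e n x) f (𝓝 0) := by simpa using (he m).sub (he n)
    have h3 : (0 : E d) ∈ positions (z m) (z n) := by
      refine hclosed.mem_of_tendsto h2 ?_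
      filter_upwards [hz m, hz n] with x hxm hxn
      have h4 := ballPatch_mono x (Nat.cast_le.2 hmn : (m : ℝ) ≤ n)
      rw [hxm.2, hxn.2] at h4
      rw [positions, mem_ofPred_eq, sub_eq_neg_add, ← translate_translate, translate_subset_iff,
        neg_neg]
      exact h4
    rwa [positions, mem_ofPred_eq, translate_zero] at h3
  -- One unit of radius is given up for the translation `e n x`.
  have hcov : ∀ n : ℕ, Metric.closedBall 0 ((n : ℝ) - 1) ⊆ supp (z n) := by
    intro n
    obtain ⟨x, ⟨hx, hxz⟩, hxe⟩ := ((hz n).and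
      ((he n).eventually (Metric.closedBall_mem_nhds 0 one_pos))).exists
    have h2 := closedBall_subset_vadd (closedBall_subset_supp_ballPatch x n) (-e n x)
    rw [← supp_translate, hxz, translate_translate, neg_add_cancel, translate_zero, norm_neg] at h2
    refine (Metric.closedBall_subset_closedBall ?_).trans h2
    rw [dist_zero_right] at hxe
    linarith
  let y : Tiling d :=
    { tiles := ⋃ n, z n
      isPatch := by
        refine ⟨fun P hP => ?_, fun P hP Q hQ => ?_⟩
        · obtain ⟨n, hn⟩ := mem_iUnion.1 hP
          exact (hpatch n).1 P hn
        · obtain ⟨m, hm⟩ := mem_iUnion.1 hP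
          obtain ⟨n, hn⟩ := mem_iUnion.1 hQ
          exact (hpatch (max m n)).2 P (hmono _ _ (le_max_left m n) hm) Q
            (hmono _ _ (le_max_right m n) hn)
      covers := by
        refine eq_univ_of_forall fun v => ?_
        obtain ⟨n, hn⟩ := exists_nat_ge (‖v‖ + 1)
        have h2 : v ∈ supp (z n) := by
          apply hcov
          rw [mem_closedBall_zero_iff]
          linarith
        exact supp_mono (subset_iUnion z n) h2 }
  have hlim : (f : Filter (Tiling d)) ≤ 𝓝 y := by
    rw [le_nhds_iff]
    intro V hyV hV
    obtain ⟨ε, hε, hball⟩ := isOpen_iff_distT.1 hV y hyV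
    set r : ℝ := min (ε / 2) (1 / 2) with hr
    have hr0 : 0 < r := lt_min (by positivity) (by norm_num)
    have hr2 : r < √2 / 2 := by
      have h1 : r ≤ 1 / 2 := min_le_right _ _
      have h2 : 1 < √2 := by
        rw [Real.lt_sqrt (by norm_num)]
        norm_num
      linarith
    obtain ⟨n, hn⟩ := exists_nat_ge (1 / r + 1 + 1)
    filter_upwards [hz n, (he n).eventually
      (Metric.closedBall_mem_nhds 0 (lt_min hr0 one_pos))] with x hx hxe
    rw [dist_zero_right, le_min_iff] at hxe
    apply hball
    refine lt_of_le_of_lt (distT_le_of_translate_subset hr0 hr2 (subset_iUnion z n)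
      (isBounded_supp (hfin n) (hpatch n).1)
      ((Metric.closedBall_subset_closedBall (by linarith)).trans (hcov n)) hxe.1 hxe.2
      (hx.2 ▸ ballPatch_subset x n)) ?_
    exact lt_of_le_of_lt (min_le_left _ _) (by linarith)
  exact ⟨y, hX.space.closed.mem_of_tendsto (hlim : Tendsto id _ _) hf, hlim⟩

end

/-! ### The spaces `X_a` -/

section

variable {d l : ℕ} {J : Type*} {X : Set (Tiling d)} {D : Fin l → Set (E d)}
  {S : J → Set (E d) → Set (Set (E d))} {lam : J → ℝ}

theorem tilingSpace_subset (X : Set (Tiling d)) (S : J → Set (E d) → Set (Set (E d)))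
    (D₀ : Set (E d)) (a : ℕ → J) : tilingSpace X S D₀ a ⊆ X := fun _ hx => hx.1

/-- The defining condition is invariant under translation, and a finite patch violating it
reappears, slightly moved, in all nearby tilings; this gives closedness. -/
theorem IsTilingSpace.tilingSpace (hX : IsTilingSpace X) (S : J → Set (E d) → Set (Set (E d)))
    (D₀ : Set (E d)) (a : ℕ → J) : IsTilingSpace (tilingSpace X S D₀ a) where
  invariant x hx t := by
    refine ⟨hX.invariant x hx.1 t, fun x' hx' hfin => ?_⟩
    obtain ⟨n, s, hs⟩ := hx.2 (translate (-t) x') (by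
      rw [translate_subset_iff, neg_neg]
      exact hx') (hfin.image _)
    exact ⟨n, s + -t, by rwa [← translate_translate]⟩
  closed := by
    rw [← isOpen_compl_iff, isOpen_iff_distT]
    intro x hx
    by_cases hxX : x ∈ X
    · have h1 : ∃ x' ⊆ x.tiles, x'.Finite ∧ ∀ (n : ℕ) (t : E d),
          ¬ translate t x' ⊆ superTile S a n D₀ := by
        by_contra! h
        exact hx ⟨hxX, h⟩
      obtain ⟨x', hx', hfin, hno⟩ := h1
      obtain ⟨ε, hε, h2⟩ := exists_translate_subset_of_distT_lt x hx' hfin one_pos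
      refine ⟨ε, hε, fun y hy hyX => ?_⟩
      obtain ⟨t, -, ht⟩ := h2 y hy
      obtain ⟨n, s, hs⟩ := hyX.2 _ ht (hfin.image _)
      rw [translate_translate] at hs
      exact hno n _ hs
    · obtain ⟨ε, hε, h1⟩ := isOpen_iff_distT.1 hX.closed.isOpen_compl x hxX
      exact ⟨ε, hε, fun y hy hyX => h1 y hy hyX.1⟩
  flc := by
    obtain ⟨F, hF, h⟩ := hX.flc
    refine ⟨F, hF, fun x' hx' => h x' ?_⟩
    obtain ⟨h1, h2, h3, x, hx, h4⟩ := hx'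
    exact ⟨h1, h2, h3, x, hx.1, h4⟩

theorem HasPrototiles.tilingSpace (hX : HasPrototiles X D) (S : J → Set (E d) → Set (Set (E d)))
    (D₀ : Set (E d)) (a : ℕ → J) : HasPrototiles (tilingSpace X S D₀ a) D where
  space := hX.space.tilingSpace S D₀ a
  isTile := hX.isTile
  complete P hP := by
    obtain ⟨x, hx, hPx⟩ := hP
    exact hX.complete P ⟨x, hx.1, hPx⟩

theorem IsSystem.tendsto_dil [Finite J] [Nonempty J] (h : IsSystem X D S lam) (a : ℕ → J) :
    Tendsto (dil lam a) atTop atTop :=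
  tendsto_atTop_mono (h.iInf_pow_le_dil a) (tendsto_pow_atTop_atTop_of_one_lt h.one_lt_iInf)

/-- Centered at an interior point, the supertiles `S_a^n(D₀)` cover growing balls in tilings of `X`.
A limit of these tilings exists by compactness, and its finite patches occur, up to translation,
inside such balls. -/
theorem IsSystem.tilingSpace_nonempty [Finite J] [Nonempty J] (h : IsSystem X D S lam)
    {D₀ : Set (E d)} (hD₀ : D₀ ∈ tilesOf X) (a : ℕ → J) : (tilingSpace X S D₀ a).Nonempty := by
  obtain ⟨p, hp⟩ := (isTile_of_mem_tilesOf hD₀).interior_nonempty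
  obtain ⟨r, hr, hball⟩ := Metric.nhds_basis_closedBall.mem_iff.1 (mem_interior_iff_mem_nhds.1 hp)
  have h1 : ∀ n, ∃ x ∈ X, ∃ t : E d, translate t (MultiSubst.superTile S a n D₀) ⊆ x.tiles ∧
      Metric.closedBall 0 (dil lam a n * r) ⊆ supp (translate t (MultiSubst.superTile S a n D₀)) := by
    intro n
    have hn := h.superTile a n
    obtain ⟨-, x, hx, hsub⟩ := hn.isSubpatch hD₀
    refine ⟨x.shift (-(dil lam a n • p)), h.proto.space.invariant x hx _, _, translate_mono _ hsub,
      ?_⟩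
    rw [supp_translate, hn.supp_eq D₀ hD₀]
    intro v hv
    rw [mem_vadd_set_iff_neg_vadd_mem, neg_neg, mem_smul_set_iff_inv_smul_mem₀ hn.pos.ne']
    apply hball
    rw [mem_closedBall_zero_iff] at hv
    rw [Metric.mem_closedBall, dist_eq_norm, vadd_eq_add, smul_add, inv_smul_smul₀ hn.pos.ne',
      add_sub_cancel_left, norm_smul, norm_inv, Real.norm_of_nonneg hn.pos.le,
      inv_mul_le_iff₀ hn.pos]
    exact hv
  choose x hx t hsub hcov using h1
  let g : Ultrafilter ℕ := Ultrafilter.of atTop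
  obtain ⟨y, hy, hlim⟩ := h.proto.isCompact.ultrafilter_le_nhds (g.map x) (by
      rw [le_principal_iff]
      exact Filter.mem_of_superset (f := (g : Filter ℕ)) Filter.univ_mem fun n _ => hx n)
  refine ⟨y, hy, fun x' hx' hfin => ?_⟩
  have hopen := isOpen_cyl hfin (Metric.isOpen_ball : IsOpen (Metric.ball (0 : E d) 1))
  have hmem : y ∈ cyl x' (Metric.ball 0 1) :=
    ⟨0, Metric.mem_ball_self one_pos, by rwa [translate_zero]⟩
  have h2 : ∀ᶠ n in (g : Filter ℕ), x n ∈ cyl x' (Metric.ball 0 1) :=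
    hlim (hopen.mem_nhds hmem)
  obtain ⟨ρ, hρ⟩ := (isBounded_supp hfin fun P hP =>
    y.isPatch.1 P (hx' hP)).subset_closedBall 0
  have h3 : ∀ᶠ n in (g : Filter ℕ), ρ + 1 ≤ dil lam a n * r :=
    (Ultrafilter.of_le atTop) (((h.tendsto_dil a).atTop_mul_const hr).eventually_ge_atTop _)
  obtain ⟨n, ⟨s, hs, hsx⟩, hn⟩ := (h2.and h3).exists
  refine ⟨n, -t n + s, ?_⟩
  rw [← translate_translate, translate_subset_iff, neg_neg]
  rintro _ ⟨P, hP, rfl⟩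
  have hPt := (y.isPatch.1 P (hx' hP)).vadd s
  obtain ⟨v, hv⟩ := hPt.interior_nonempty
  refine (x n).isPatch.mem_of_interior_inter_supp (hsub n) (hsx ⟨P, hP, rfl⟩) ⟨v, hv, hcov n ?_⟩
  obtain ⟨w, hw, rfl⟩ := interior_subset hv
  have h4 := hρ (subset_supp hP hw)
  rw [mem_closedBall_zero_iff] at h4 ⊢
  rw [mem_ball_zero_iff] at hs
  have := norm_add_le s w
  simp only [vadd_eq_add]
  linarith

end

/-! ### Existence of invariant measures -/

theorem abs_setIntegral_sub_le {d : ℕ} {h : E d → ℝ} {M : ℝ} (hc : Continuous h)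
    (hM : ∀ v, |h v| ≤ M) {A B : Set (E d)} (hA : MeasurableSet A) (hAB : A ⊆ B)
    (hB : volume B ≠ ⊤) :
    |(∫ v in B, h v) - ∫ v in A, h v| ≤ M * (volume.real B - volume.real A) := by
  have hint : IntegrableOn h B := Measure.integrableOn_of_bounded hB hc.aestronglyMeasurable
    (ae_of_all _ hM)
  rw [← setIntegral_sdiff hA hint hAB, ← measureReal_sdiff hAB hA, ← Real.norm_eq_abs]
  exact norm_setIntegral_le_of_norm_le_const
    ((measure_mono sdiff_subset).trans_lt (lt_top_iff_ne_top.2 hB)) fun v _ => hM v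

theorem volumeReal_closedBall_pos {d : ℕ} {r : ℝ} (hr : 0 < r) :
    0 < volume.real (Metric.closedBall (0 : E d) r) :=
  ENNReal.toReal_pos (Metric.measure_closedBall_pos volume _ hr).ne' measure_closedBall_lt_top.ne

/-- The volume of a ball grows like its radius to a power, hence subexponentially. -/
theorem tendsto_volumeReal_closedBall_add_div {d : ℕ} (c : ℝ) :
    Tendsto (fun R : ℝ => volume.real (Metric.closedBall (0 : E d) (R + c)) /
      volume.real (Metric.closedBall (0 : E d) R)) atTop (𝓝 1) := by
  have h1 : Tendsto (fun R : ℝ => (1 + c * R⁻¹) ^ d) atTop (𝓝 ((1 + c * 0) ^ d)) :=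
    ((tendsto_inv_atTop_zero.const_mul c).const_add 1).pow d
  rw [mul_zero, add_zero, one_pow] at h1
  refine h1.congr' ?_
  filter_upwards [eventually_gt_atTop 0, eventually_ge_atTop (-c)] with R hR hRc
  have h0 : 0 < volume.real (Metric.closedBall (0 : E d) 1) := volumeReal_closedBall_pos one_pos
  rw [volumeReal_closedBall _ (by linarith), volumeReal_closedBall _ hR.le,
    mul_div_mul_right _ _ h0.ne', ← div_pow]
  congr 1
  field_simp

/-- Krylov–Bogoliubov: averages along an orbit over growing balls have a limit along an ultrafilter.
It is invariant since a ball and its translate differ by a vanishing proportion of volume. -/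
theorem exists_invariant_probabilityMeasure {d : ℕ} {K : Type*} [TopologicalSpace K]
    [CompactSpace K] [T2Space K] [SecondCountableTopology K] [MeasurableSpace K] [BorelSpace K]
    [Nonempty K] {φ : E d → K → K} (hφ : Continuous fun p : E d × K => φ p.1 p.2)
    (hadd : ∀ s t x, φ s (φ t x) = φ (s + t) x) :
    ∃ μ : ProbabilityMeasure K, ∀ s, (μ : Measure K).map (φ s) = μ := by
  obtain ⟨x₀⟩ := ‹Nonempty K›
  have hφ₀ : Continuous fun t => φ t x₀ := 
    hφ.comp (by fun_prop : Continuous fun t : E d => (t, x₀))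
  have hφs : ∀ s, Continuous (φ s) := fun s =>
    hφ.comp (by fun_prop : Continuous fun x : K => (s, x))
  let B : ℕ → Set (E d) := fun n => Metric.closedBall 0 n
  have hBpos : ∀ n : ℕ, 0 < n → volume (B n) ≠ 0 := fun n hn =>
    (Metric.measure_closedBall_pos volume _ (Nat.cast_pos.2 hn)).ne'
  have hBtop : ∀ n, volume (B n) ≠ ⊤ := fun n => measure_closedBall_lt_top.ne
  have hprob : ∀ n, IsProbabilityMeasure (ProbabilityTheory.cond volume (B (n + 1))) := fun n =>
    ProbabilityTheory.cond_isProbabilityMeasure_of_finite (hBpos _ n.succ_pos) (hBtop _)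
  let P : ℕ → ProbabilityMeasure K := fun n =>
    ProbabilityMeasure.map ⟨ProbabilityTheory.cond volume (B (n + 1)), hprob n⟩
      (hφ₀.measurable.aemeasurable)
  let g : Ultrafilter ℕ := Ultrafilter.of atTop
  have hg : (g : Filter ℕ) ≤ atTop := Ultrafilter.of_le _
  obtain ⟨μ, -, hμ⟩ := (isCompact_univ (X := ProbabilityMeasure K)).ultrafilter_le_nhds (g.map P)
    (by simp)
  have hlim : Tendsto P g (𝓝 μ) := hμ
  rw [ProbabilityMeasure.tendsto_iff_forall_integral_tendsto] at hlim
  refine ⟨μ, fun s => ?_⟩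
  have : IsProbabilityMeasure ((μ : Measure K).map (φ s)) :=
    Measure.isProbabilityMeasure_map (hφs s).measurable.aemeasurable
  refine ext_of_forall_integral_eq_of_IsFiniteMeasure fun f => ?_
  rw [integral_map (hφs s).measurable.aemeasurable f.continuous.aestronglyMeasurable]
  have hint : ∀ (f : BoundedContinuousFunction K ℝ) (n : ℕ), ∫ x, f x ∂(P n : Measure K) =
      (volume.real (B (n + 1)))⁻¹ * ∫ v in B (n + 1), f (φ v x₀) := by
    intro f n
    show ∫ x, f x ∂((ProbabilityTheory.cond volume (B (n + 1))).map fun t => φ t x₀) = _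
    rw [integral_map hφ₀.measurable.aemeasurable f.continuous.aestronglyMeasurable]
    rw [ProbabilityTheory.cond, integral_smul_measure, ENNReal.toReal_inv]
    rfl
  let fs : BoundedContinuousFunction K ℝ := f.compContinuous ⟨φ s, hφs s⟩
  have h1 := hlim f
  have h2 := hlim fs
  have h3 : Tendsto (fun n => ∫ x, fs x ∂(P n : Measure K) - ∫ x, f x ∂(P n : Measure K)) g
      (𝓝 0) := by
    refine squeeze_zero_norm (a := fun n : ℕ => 2 * ‖f‖ *
      (volume.real (Metric.closedBall (0 : E d) ((n + 1 : ℕ) + ‖s‖)) /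
        volume.real (Metric.closedBall (0 : E d) (n + 1 : ℕ)) - 1)) (fun n => ?_) ?_
    · have hB0 : 0 < volume.real (B (n + 1)) :=
        volumeReal_closedBall_pos (Nat.cast_pos.2 n.succ_pos)
      have hM : ∀ v, |f (φ v x₀)| ≤ ‖f‖ := fun v => f.norm_coe_le_norm _
      have hc : Continuous fun v => f (φ v x₀) := f.continuous.comp hφ₀
      have hB' : volume (Metric.closedBall (0 : E d) ((n + 1 : ℕ) + ‖s‖)) ≠ ⊤ :=
        measure_closedBall_lt_top.ne
      -- The balls centered at `0` and at `s` both lie in the ball of radius `n + 1 + ‖s‖`;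
      -- comparing each integral with the one over this ball gives the factor `2`.
      have e1 := abs_setIntegral_sub_le hc hM (A := B (n + 1)) Metric.isClosed_closedBall.measurableSet
        (Metric.closedBall_subset_closedBall (by linarith [norm_nonneg s])) hB'
      have e2 := abs_setIntegral_sub_le hc hM (A := Metric.closedBall s (n + 1 : ℕ))
        Metric.isClosed_closedBall.measurableSet
        (Metric.closedBall_subset_closedBall' (by rw [dist_zero_right])) hB'
      have hvol : volume.real (Metric.closedBall s ((n + 1 : ℕ) : ℝ)) = volume.real (B (n + 1)) := by
        rw [Measure.real, Measure.addHaar_closedBall_center]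
        rfl
      have e3 : ∫ v in B (n + 1), fs (φ v x₀) =
          ∫ v in Metric.closedBall s (n + 1 : ℕ), f (φ v x₀) := by
        have hmp : MeasurePreserving (fun v : E d => s + v) volume volume :=
          measurePreserving_add_left volume s
        rw [← hmp.setIntegral_preimage_emb (measurableEmbedding_addLeft s)
            (fun v => f (φ v x₀)) (Metric.closedBall s (n + 1 : ℕ))]
        have : (fun v : E d => s + v) ⁻¹' Metric.closedBall s (n + 1 : ℕ) = B (n + 1) := by
          ext v
          simp [B, dist_eq_norm]
        rw [this]
        refine integral_congr_ae (ae_of_all _ fun v => ?_)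
        show f (φ s (φ v x₀)) = _
        rw [hadd]
      rw [hint, hint, e3, ← mul_sub, norm_mul, norm_inv, Real.norm_of_nonneg hB0.le,
        inv_mul_le_iff₀ hB0, Real.norm_eq_abs]
      rw [hvol] at e2
      have e4 : volume.real (B (n + 1)) * (2 * ‖f‖ *
          (volume.real (Metric.closedBall (0 : E d) ((n + 1 : ℕ) + ‖s‖)) /
            volume.real (Metric.closedBall (0 : E d) (n + 1 : ℕ)) - 1)) =
          2 * (‖f‖ * (volume.real (Metric.closedBall (0 : E d) ((n + 1 : ℕ) + ‖s‖)) -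
            volume.real (B (n + 1)))) := by
        change 0 < volume.real (Metric.closedBall (0 : E d) (n + 1 : ℕ)) at hB0
        show volume.real (Metric.closedBall (0 : E d) (n + 1 : ℕ)) * _ = 2 * (_ * (_ -
          volume.real (Metric.closedBall (0 : E d) (n + 1 : ℕ))))
        field_simp
      rw [e4]
      rw [abs_le] at e1 e2 ⊢
      constructor <;> linarith [e1.1, e1.2, e2.1, e2.2]
    · have h4 := (((tendsto_volumeReal_closedBall_add_div (d := d) ‖s‖).comp
        ((tendsto_natCast_atTop_atTop (R := ℝ)).comp (tendsto_add_atTop_nat 1))).mono_left hg)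
      simpa using (h4.sub_const 1).const_mul (2 * ‖f‖)
  have h5 := tendsto_nhds_unique h3 (h2.sub h1)
  exact (sub_eq_zero.1 h5.symm)

section

variable {d l : ℕ} {X : Set (Tiling d)} {D : Fin l → Set (E d)}

theorem HasPrototiles.exists_isInvariantProb (hX : HasPrototiles X D) (hne : X.Nonempty) :
    ∃ μ, IsInvariantProb X μ := by
  have : CompactSpace X := isCompact_iff_compactSpace.1 hX.isCompact
  have := hX.secondCountableTopology
  have : Nonempty X := hne.to_subtype
  obtain ⟨μ, hμ⟩ := exists_invariant_probabilityMeasure hX.continuous_shiftOn (fun s t x =>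
    Subtype.ext (Tiling.ext_tiles (translate_translate s t _)))
  have hval : Measurable (Subtype.val : X → Tiling d) := measurable_subtype_coe
  have hXm : MeasurableSet X := hX.space.closed.measurableSet
  refine ⟨(μ : Measure X).map Subtype.val,
    Measure.isProbabilityMeasure_map hval.aemeasurable, ?_, fun t V hV => ?_⟩
  · rw [Measure.map_apply hval hXm.compl]
    simp
  · rw [Measure.map_apply hval hV, Measure.map_apply hval ((continuous_shift t).measurable hV)]
    conv_rhs => rw [← hμ t]
    rw [Measure.map_apply _ (hval hV)]
    · rfl
    · exact (hX.continuous_shiftOn.comp (by fun_prop : Continuous fun x : X => (t, x))).measurable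

end

/-! ### Uniform patch frequencies in the tilings of `X_a` -/

section

variable {d l : ℕ} {J : Type*} {X : Set (Tiling d)} {D : Fin l → Set (E d)}
  {S : J → Set (E d) → Set (Set (E d))} {lam : J → ℝ}

/-- If the densities of `q` in `S_a^n(D_i)` converge to `f`, the density of `q` in `S_a^n(y)` is
close to `f` uniformly in the patch `y`. -/
theorem IsSystem.exists_forall_abs_cnt_extend_sub_le [Finite J] [Nonempty J]
    (h : IsSystem X D S lam) {a : ℕ → J} {N : ℕ} {q : Set (Set (E d))} (hq : q ∈ patchesOf X N)
    {f : ℝ} (hf : ∀ i, Tendsto (fun n => density S a n q (D i)) atTop (𝓝 f)) {ε : ℝ}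
    (hε : 0 < ε) :
    ∃ n, ∀ y, IsSubpatch X y → |cnt q (extend (MultiSubst.superTile S a n) y) -
      f * (dil lam a n ^ d * volume.real (supp y))| ≤
        ε * (dil lam a n ^ d * volume.real (supp y)) := by
  obtain ⟨K, R, hK, hR, hcross⟩ := h.exists_sum_fullPositions_le N
  obtain ⟨v, hv, hvol⟩ := h.proto.exists_le_volume
  have h1 : ∀ᶠ n in atTop, ∀ i, |density S a n q (D i) - f| ≤ ε / 2 := by
    rw [eventually_all]
    intro i
    filter_upwards [(Metric.tendsto_nhds.1 (hf i)) (ε / 2) (half_pos hε)] with n hn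
    exact hn.le
  -- The factor `v` is needed because a patch `q'` has up to `volume.real (supp y) / v` positions in
  -- `y`.
  have h2 : ∀ᶠ n : ℕ in atTop, K * boundaryVolume D (R / (⨅ j, lam j) ^ n) ≤ ε / 2 * v := by
    have := ((h.tendsto_boundaryVolume.comp (h.tendsto_div_pow hR)).const_mul K)
    rw [mul_zero] at this
    exact this.eventually (ge_mem_nhds (by positivity))
  obtain ⟨n, hn1, hn2⟩ := (h1.and h2).exists
  refine ⟨n, fun y hy => ?_⟩
  have hΛ : 0 < dil lam a n ^ d := pow_pos (h.superTile a n).pos _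
  have hW : volume.real (supp y) = ∑ j, cnt {D j} y * volume.real (D j) := by
    rw [hy.volume_supp h.volume_interior, sum_tiles_eq h.proto h.family hy.1
      (fun P hP => hy.mem_tilesOf hP) (fun P => volume.real P) volumeReal_vadd]
  obtain ⟨-, hcard⟩ := hy.isPatch.finite_and_ncard_le hy.isBounded_supp
    (fun P hP => interior_subset.trans (subset_supp hP)) hv fun P hP => hvol P (hy.mem_tilesOf hP)
  have hfull := (hcross a n N le_rfl q hq).trans hn2
  rw [(h.superTile a n).cnt_extend_eq_add h.proto h.family le_rfl hq hy]
  push_cast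
  have e1 : |∑ j, (cnt q (MultiSubst.superTile S a n (D j)) : ℝ) * cnt {D j} y -
      f * (dil lam a n ^ d * volume.real (supp y))| ≤
        ε / 2 * (dil lam a n ^ d * volume.real (supp y)) := by
    rw [hW]
    simp only [Finset.mul_sum]
    rw [← Finset.sum_sub_distrib]
    refine (Finset.abs_sum_le_sum_abs _ _).trans (Finset.sum_le_sum fun j _ => ?_)
    have hj : (cnt q (MultiSubst.superTile S a n (D j)) : ℝ) =
        density S a n q (D j) * (dil lam a n ^ d * volume.real (D j)) := by
      rw [density, h.volume_superTile a n (h.family.mem j), div_mul_cancel₀]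
      exact (mul_pos hΛ (h.volume_pos j)).ne'
    have e : (cnt q (MultiSubst.superTile S a n (D j)) : ℝ) * cnt {D j} y -
        f * (dil lam a n ^ d * (cnt {D j} y * volume.real (D j))) =
        (density S a n q (D j) - f) *
          (dil lam a n ^ d * (cnt {D j} y * volume.real (D j))) := by
      rw [hj]
      ring
    rw [e, abs_mul, abs_of_nonneg (show 0 ≤ dil lam a n ^ d * (cnt {D j} y * volume.real (D j)) by
      positivity)]
    exact mul_le_mul_of_nonneg_right (hn1 j) (by positivity)
  have e2 : ∑ q' ∈ largeReps h.proto N, ((fullPositions (MultiSubst.superTile S a n) q q').ncard : ℝ)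
      * cnt q' y ≤ ε / 2 * (dil lam a n ^ d * volume.real (supp y)) := by
    have hle : ∀ q' ∈ largeReps h.proto N,
        ((fullPositions (MultiSubst.superTile S a n) q q').ncard : ℝ) * cnt q' y ≤
          ((fullPositions (MultiSubst.superTile S a n) q q').ncard : ℝ) / dil lam a n ^ d *
            (dil lam a n ^ d * volume.real (supp y) / v) := by
      intro q' hq'
      obtain ⟨-, k, -, hk⟩ := exists_mem_patchesOf_of_mem_largeReps hq'
      obtain ⟨P, hP⟩ := nonempty_of_mem_patchesOf hk
      have h3 := cnt_le_ncard
        (isTile_of_mem_tilesOf ((isSubpatch_of_mem_patchesOf hk).mem_tilesOf hP)) hP hy.1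
      have h4 : (cnt q' y : ℝ) ≤ volume.real (supp y) / v := by
        rw [le_div_iff₀ hv]
        exact (mul_le_mul_of_nonneg_right (by exact_mod_cast h3) hv.le).trans hcard
      have h5 : ((fullPositions (MultiSubst.superTile S a n) q q').ncard : ℝ) / dil lam a n ^ d *
            (dil lam a n ^ d * volume.real (supp y) / v) =
          ((fullPositions (MultiSubst.superTile S a n) q q').ncard : ℝ) *
            (volume.real (supp y) / v) := by
        field_simp
      rw [h5]
      exact mul_le_mul_of_nonneg_left h4 (Nat.cast_nonneg _)
    refine (Finset.sum_le_sum hle).trans ?_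
    rw [← Finset.sum_mul]
    refine (mul_le_mul_of_nonneg_right hfull (by positivity)).trans_eq ?_
    field_simp
  have e3 : 0 ≤ ∑ q' ∈ largeReps h.proto N,
      ((fullPositions (MultiSubst.superTile S a n) q q').ncard : ℝ) * cnt q' y :=
    Finset.sum_nonneg fun _ _ => by positivity
  rw [abs_le] at e1 ⊢
  constructor <;> linarith [e1.1, e1.2]

theorem volumeReal_closedBall_center (c : E d) (r : ℝ) :
    volume.real (Metric.closedBall c r) = volume.real (Metric.closedBall (0 : E d) r) := by
  rw [Measure.real, Measure.addHaar_closedBall_center, Measure.real]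

/-- Counting the positions of a patch in a ball, from uniform densities in inflated patches. -/
theorem IsInflation.ncard_positions_inter_closedBall {T : Set (E d) → Set (Set (E d))} {Λ : ℝ}
    (hT : IsInflation X T Λ) {N : ℕ} {q : Set (Set (E d))} (hq : q ∈ patchesOf X N) {ρ δ f ε : ℝ}
    (hρ : supp q ⊆ Metric.closedBall 0 ρ) (hδ : ∀ P ∈ tilesOf X, ∀ u ∈ P, ∀ v ∈ P, dist u v ≤ δ)
    (hf : 0 ≤ f) (hε : 0 ≤ ε)
    (hcnt : ∀ y, IsSubpatch X y → |cnt q (extend T y) - f * (Λ ^ d * volume.real (supp y))| ≤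
      ε * (Λ ^ d * volume.real (supp y)))
    {y : Set (Set (E d))} (hy : IsSubpatch X y) {c : E d} {R : ℝ}
    (hcov : Metric.closedBall c R ⊆ supp (extend T y)) :
    f * volume.real (Metric.closedBall (0 : E d) (R - (ρ + Λ * δ))) -
        ε * volume.real (Metric.closedBall (0 : E d) R) ≤
      (positions q (extend T y) ∩ Metric.closedBall c R).ncard ∧
    (positions q (extend T y) ∩ Metric.closedBall c R).ncard ≤
      (f + ε) * volume.real (Metric.closedBall (0 : E d) (R + (ρ + Λ * δ))) := by
  obtain ⟨Q₀, hQ₀⟩ := nonempty_of_mem_patchesOf hq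
  have hqX : ∀ Q ∈ q, IsTile Q := fun Q hQ =>
    isTile_of_mem_tilesOf ((isSubpatch_of_mem_patchesOf hq).mem_tilesOf hQ)
  obtain ⟨u₀, hu₀⟩ := hq.2.2.1.nonempty
  have hρu : ∀ u ∈ supp q, ‖u‖ ≤ ρ := fun u hu => mem_closedBall_zero_iff.1 (hρ hu)
  have hρ0 : 0 ≤ ρ := (norm_nonneg _).trans (hρu _ hu₀)
  have hδ0 : 0 ≤ δ := by
    have hP := (isSubpatch_of_mem_patchesOf hq).mem_tilesOf hQ₀
    obtain ⟨u, hu⟩ := (isTile_of_mem_tilesOf hP).nonempty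
    exact dist_nonneg.trans (hδ _ hP u hu u hu)
  have hΛ := hT.pos
  have hfin : (positions q (extend T y)).Finite :=
    finite_positions (hqX Q₀ hQ₀) hQ₀ (hT.isSubpatch_extend hy).1
  -- The inflation of `near r` reaches at most `Λ * δ` beyond the ball of radius `r`. With `r = R -
  -- (ρ + Λ * δ)` all its positions of `q` lie in the ball of radius `R`; with `r = R + ρ` it
  -- contains every position in that ball.
  let near : ℝ → Set (Set (E d)) := fun r =>
    {P | P ∈ y ∧ ((Λ • P) ∩ Metric.closedBall c r).Nonempty}
  have hnear : ∀ r, IsSubpatch X (near r) := fun r => hy.mono fun P hP => hP.1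
  have hvol : ∀ r, Λ ^ d * volume.real (supp (near r)) = volume.real (Λ • supp (near r)) :=
    fun r => (volumeReal_smul hΛ.le _).symm
  have hsub : ∀ r, Λ • supp (near r) ⊆ Metric.closedBall c (r + Λ * δ) := by
    rintro r _ ⟨u, ⟨P, ⟨hP, w, ⟨w', hw', rfl⟩, hw⟩, hu⟩, rfl⟩
    have h1 := hδ P (hy.mem_tilesOf hP) u hu w' hw'
    have h2 : dist (Λ • u) (Λ • w') ≤ Λ * δ := by
      rw [dist_smul₀, Real.norm_of_nonneg hΛ.le]
      exact mul_le_mul_of_nonneg_left h1 hΛ.le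
    rw [Metric.mem_closedBall] at hw ⊢
    exact (dist_triangle _ (Λ • w') _).trans (by simp only at hw; linarith)
  constructor
  · set r := R - (ρ + Λ * δ) with hr
    have hrR : r ≤ R := by
      have : 0 ≤ Λ * δ := by positivity
      linarith
    have h1 := (abs_le.1 (hcnt _ (hnear r))).1
    rw [hvol] at h1
    have h2 : volume.real (Metric.closedBall (0 : E d) r) ≤ volume.real (Λ • supp (near r)) := by
      rw [← volumeReal_closedBall_center c]
      refine measureReal_mono (fun u hu => ?_)
        ((Metric.isBounded_closedBall.subset (hsub r)).measure_lt_top).ne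
      have hu' := hcov (Metric.closedBall_subset_closedBall hrR hu)
      rw [hT.supp_extend fun P hP => hy.mem_tilesOf hP] at hu'
      obtain ⟨w, ⟨P, hP, hw⟩, rfl⟩ := hu'
      exact ⟨w, ⟨P, ⟨hP, Λ • w, ⟨w, hw, rfl⟩, hu⟩, hw⟩, rfl⟩
    have h3 : volume.real (Λ • supp (near r)) ≤ volume.real (Metric.closedBall (0 : E d) R) := by
      rw [← volumeReal_closedBall_center c R]
      refine measureReal_mono ((hsub r).trans (Metric.closedBall_subset_closedBall (by linarith)))
        measure_closedBall_lt_top.ne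
    have h4 : cnt q (extend T (near r)) ≤
        (positions q (extend T y) ∩ Metric.closedBall c R).ncard := by
      refine Set.ncard_le_ncard (fun s hs => ⟨hs.trans (extend_mono fun P hP => hP.1), ?_⟩)
        (hfin.inter_of_left _)
      have h5 : s + u₀ ∈ supp (extend T (near r)) :=
        supp_mono hs (by rw [supp_translate]; exact ⟨u₀, hu₀, rfl⟩)
      rw [hT.supp_extend fun P hP => hy.mem_tilesOf hP.1] at h5
      have h6 := hsub r h5
      rw [Metric.mem_closedBall, dist_eq_norm] at h6 ⊢
      have h7 : s - c = (s + u₀ - c) - u₀ := by abel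
      rw [h7]
      have := norm_sub_le (s + u₀ - c) u₀
      linarith [hρu _ hu₀]
    have h5 : (cnt q (extend T (near r)) : ℝ) ≤
        (positions q (extend T y) ∩ Metric.closedBall c R).ncard := by exact_mod_cast h4
    have h6 := mul_le_mul_of_nonneg_left h2 hf
    have h7 := mul_le_mul_of_nonneg_left h3 hε
    linarith
  · have h1 := (abs_le.1 (hcnt _ (hnear (R + ρ)))).2
    rw [hvol] at h1
    have h3 : volume.real (Λ • supp (near (R + ρ))) ≤
        volume.real (Metric.closedBall (0 : E d) (R + (ρ + Λ * δ))) := by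
      rw [← volumeReal_closedBall_center c (R + (ρ + Λ * δ)), ← add_assoc]
      exact measureReal_mono (hsub _) measure_closedBall_lt_top.ne
    have h4 : (positions q (extend T y) ∩ Metric.closedBall c R).ncard ≤
        cnt q (extend T (near (R + ρ))) := by
      refine Set.ncard_le_ncard (fun s hs => ?_)
        (hfin.subset (positions_mono (extend_mono fun P hP => hP.1)))
      rintro _ ⟨Q, hQ, rfl⟩
      obtain ⟨P, hP, hQP⟩ := mem_extend.1 (hs.1 ⟨Q, hQ, rfl⟩)
      obtain ⟨u, hu⟩ := (hqX Q hQ).nonempty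
      refine mem_extend.2 ⟨P, ⟨hP, s + u, ?_, ?_⟩, hQP⟩
      · exact hT.subset_smul (hy.mem_tilesOf hP) hQP ⟨u, hu, rfl⟩
      · have h5 := hs.2
        rw [Metric.mem_closedBall] at h5 ⊢
        have := dist_triangle (s + u) s c
        rw [dist_self_add_left] at this
        linarith [hρu _ (subset_supp hQ hu)]
    have h5 : ((positions q (extend T y) ∩ Metric.closedBall c R).ncard : ℝ) ≤
        cnt q (extend T (near (R + ρ))) := by exact_mod_cast h4
    have h6 := mul_le_mul_of_nonneg_left h3 (add_nonneg hf hε)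
    linarith

/-- Every ball of a tiling in `X_a` appears in an inflation `S_a^n(y)`, with `n` given. -/
theorem IsSystem.exists_ballPatch_subset_extend [Finite J] [Nonempty J] (hd : 0 < d)
    (h : IsSystem X D S lam) {D₀ : Set (E d)} (hD₀ : D₀ ∈ tilesOf X) {a : ℕ → J} {x : Tiling d}
    (hx : x ∈ tilingSpace X S D₀ a) (n : ℕ) (R : ℝ) :
    ∃ y, IsSubpatch X y ∧ ∃ t,
      translate t (ballPatch x R) ⊆ extend (MultiSubst.superTile S a n) y := by
  obtain ⟨p, hp⟩ := (isTile_of_mem_tilesOf hD₀).nonempty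
  -- A ball of this radius has too much volume for a supertile of level below `n`, so a supertile
  -- containing it has level at least `n` and factors through `S_a^n`.
  obtain ⟨R', hRR', hR'⟩ : ∃ R', R ≤ R' ∧ dil lam a n ^ d * volume.real D₀ <
      volume.real (Metric.closedBall (0 : E d) R') := by
    have h1 : Tendsto (fun r : ℝ => volume.real (Metric.closedBall (0 : E d) r)) atTop atTop := by
      have h2 : Tendsto (fun r : ℝ => r ^ d * volume.real (Metric.closedBall (0 : E d) 1)) atTop
          atTop := (tendsto_pow_atTop hd.ne').atTop_mul_const (volumeReal_closedBall_pos one_pos)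
      refine h2.congr' ?_
      filter_upwards [eventually_ge_atTop 0] with r hr
      rw [volumeReal_closedBall _ hr]
    obtain ⟨R', h2, h3⟩ := ((eventually_ge_atTop R).and (h1.eventually_gt_atTop
      (dil lam a n ^ d * volume.real D₀))).exists
    exact ⟨R', h2, h3⟩
  obtain ⟨m, t, ht⟩ := hx.2 (ballPatch x R') (ballPatch_subset _ _)
    (h.proto.finite_ballPatch hx.1 R')
  have hnm : n ≤ m := by
    by_contra! hlt
    have h1 : volume.real (Metric.closedBall (0 : E d) R') ≤
        volume.real (supp (MultiSubst.superTile S a m D₀)) := by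
      rw [← volumeReal_vadd t]
      refine measureReal_mono ?_ ((h.superTile a m).isSubpatch hD₀).isBounded_supp.measure_lt_top.ne
      refine Subset.trans ?_ (supp_mono ht)
      rw [supp_translate]
      exact vadd_set_mono (closedBall_subset_supp_ballPatch x R')
    rw [h.volume_superTile a m hD₀] at h1
    have h2 : dil lam a m ≤ dil lam a n := by
      obtain ⟨k, rfl⟩ := Nat.exists_eq_add_of_le hlt.le
      rw [dil_add]
      exact le_mul_of_one_le_right (h.superTile a m).pos.le (h.superTile _ k).one_le
    have h3 := mul_le_mul_of_nonneg_right (pow_le_pow_left₀ (h.superTile a m).pos.le h2 d)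
      (measureReal_nonneg (μ := volume) (s := D₀))
    linarith
  obtain ⟨k, rfl⟩ := Nat.exists_eq_add_of_le hnm
  refine ⟨_, (h.superTile (fun r => a (n + r)) k).isSubpatch hD₀, t, ?_⟩
  rw [← superTile_add]
  exact (translate_mono t (ballPatch_mono x hRR')).trans ht

/-- The positions of a patch in a ball of a tiling are visible in any patch containing a slightly
larger ball of this tiling. -/
theorem ncard_positions_inter_closedBall_eq {q Z : Set (Set (E d))} {x : Tiling d} {t : E d}
    {R R' ρ : ℝ} (hqt : ∀ Q ∈ q, IsTile Q) (hρ : supp q ⊆ Metric.closedBall 0 ρ)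
    (hR : R + ρ ≤ R') (hZ : IsPatch Z) (hxZ : translate t (ballPatch x R') ⊆ Z) :
    (positions q x.tiles ∩ Metric.closedBall 0 R).ncard =
      (positions q Z ∩ Metric.closedBall t R).ncard := by
  have hmem : ∀ s ∈ Metric.closedBall (0 : E d) R, ∀ Q ∈ q, ∀ u ∈ Q,
      s + u ∈ Metric.closedBall (0 : E d) R' := by
    intro s hs Q hQ u hu
    have h1 := hρ (subset_supp hQ hu)
    rw [mem_closedBall_zero_iff] at hs h1 ⊢
    linarith [norm_add_le s u]
  have : positions q Z ∩ Metric.closedBall t R =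
      (fun s => t + s) '' (positions q x.tiles ∩ Metric.closedBall 0 R) := by
    ext s
    constructor
    · rintro ⟨hs, hsR⟩
      have hsR' : -t + s ∈ Metric.closedBall (0 : E d) R := by
        rw [Metric.mem_closedBall, dist_eq_norm] at hsR
        rw [mem_closedBall_zero_iff, neg_add_eq_sub]
        exact hsR
      refine ⟨-t + s, ⟨?_, hsR'⟩, by simp⟩
      rintro _ ⟨Q, hQ, rfl⟩
      have hsQ : s +ᵥ Q ∈ Z := hs ⟨Q, hQ, rfl⟩
      obtain ⟨w, hw⟩ := ((hqt Q hQ).vadd s).interior_nonempty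
      have h1 := hZ.mem_of_interior_inter_supp hxZ hsQ ⟨w, hw, ?_⟩
      · rw [mem_translate, vadd_vadd] at h1
        exact ballPatch_subset _ _ h1
      · obtain ⟨u, hu, rfl⟩ := interior_subset hw
        rw [supp_translate, mem_vadd_set_iff_neg_vadd_mem]
        apply closedBall_subset_supp_ballPatch
        have := hmem _ hsR' Q hQ u hu
        simpa [add_assoc] using this
    · rintro ⟨s, ⟨hs, hsR⟩, rfl⟩
      refine ⟨?_, ?_⟩
      · rw [positions, mem_ofPred_eq, ← translate_translate]
        refine (translate_mono t ?_).trans hxZ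
        rintro _ ⟨Q, hQ, rfl⟩
        obtain ⟨u, hu⟩ := (hqt Q hQ).nonempty
        exact ⟨hs ⟨Q, hQ, rfl⟩, s + u, ⟨u, hu, rfl⟩, hmem s hsR Q hQ u hu⟩
      · rw [Metric.mem_closedBall, dist_eq_norm]
        rw [mem_closedBall_zero_iff] at hsR
        simpa using hsR
  rw [this, Set.ncard_image_of_injective _ (add_right_injective t)]

/-- The tilings in `X_a` have uniform patch frequencies. -/
theorem IsSystem.exists_forall_ncard_positions [Finite J] [Nonempty J] (hd : 0 < d)
    (h : IsSystem X D S lam) {D₀ : Set (E d)} (hD₀ : D₀ ∈ tilesOf X) {a : ℕ → J} {N : ℕ}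
    {q : Set (Set (E d))} (hq : q ∈ patchesOf X N) {f : ℝ}
    (hf : ∀ i, Tendsto (fun n => density S a n q (D i)) atTop (𝓝 f)) {ε : ℝ} (hε : 0 < ε) :
    ∃ κ, ∀ x ∈ tilingSpace X S D₀ a, ∀ R,
      f * volume.real (Metric.closedBall (0 : E d) (R - κ)) -
          ε * volume.real (Metric.closedBall (0 : E d) R) ≤
        (positions q x.tiles ∩ Metric.closedBall 0 R).ncard ∧
      (positions q x.tiles ∩ Metric.closedBall 0 R).ncard ≤
        (f + ε) * volume.real (Metric.closedBall (0 : E d) (R + κ)) := by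
  obtain ⟨i⟩ := h.nonempty_fin hD₀
  have hf0 : 0 ≤ f := ge_of_tendsto' (hf i) fun n => density_nonneg S a n q _
  have hqs := isSubpatch_of_mem_patchesOf hq
  have hqt : ∀ Q ∈ q, IsTile Q := fun Q hQ => isTile_of_mem_tilesOf (hqs.mem_tilesOf hQ)
  obtain ⟨ρ, hρ0, hρ⟩ := hqs.isBounded_supp.subset_closedBall_lt 0 0
  obtain ⟨δ, -, hδ⟩ := h.proto.exists_diam_le
  obtain ⟨n, hn⟩ := h.exists_forall_abs_cnt_extend_sub_le hq hf hε
  refine ⟨ρ + dil lam a n * δ, fun x hx R => ?_⟩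
  obtain ⟨y, hy, t, ht⟩ := h.exists_ballPatch_subset_extend hd hD₀ hx n (R + ρ)
  have hT := h.superTile a n
  rw [ncard_positions_inter_closedBall_eq hqt hρ le_rfl (hT.isSubpatch_extend hy).isPatch ht]
  refine hT.ncard_positions_inter_closedBall hq hρ hδ hf0 hε.le hn hy ?_
  refine Subset.trans ?_ (supp_mono ht)
  intro u hu
  rw [supp_translate, mem_vadd_set_iff_neg_vadd_mem]
  apply closedBall_subset_supp_ballPatch
  rw [Metric.mem_closedBall, dist_eq_norm] at hu
  rw [mem_closedBall_zero_iff, vadd_eq_add, neg_add_eq_sub]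
  linarith

end

/-! ### Measures of cylinders -/

section

variable {d l : ℕ} {J : Type*} {X Y : Set (Tiling d)} {D : Fin l → Set (E d)}
  {S : J → Set (E d) → Set (Set (E d))} {lam : J → ℝ}

/-- Translates by `s` and `t` of a tile containing an `η`-ball overlap if `dist s t < η`, so they
are the same tile. Sets of diameter below `η` thus contain at most one position. -/
theorem eq_of_dist_lt_of_mem_positions {q : Set (Set (E d))} {η : ℝ}
    (hη : ∃ P ∈ q, ∃ v, Metric.closedBall v η ⊆ P) {x : Tiling d} {s t : E d}
    (hs : s ∈ positions q x.tiles) (ht : t ∈ positions q x.tiles) (hst : dist s t < η) : s = t := by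
  obtain ⟨P, hP, v, hv⟩ := hη
  have hsP : s +ᵥ P ∈ x.tiles := hs ⟨P, hP, rfl⟩
  have htP : t +ᵥ P ∈ x.tiles := ht ⟨P, hP, rfl⟩
  have hPt : IsTile P := by
    have := (x.isPatch.1 _ hsP).vadd (-s)
    rwa [neg_vadd_vadd] at this
  have hint : Metric.ball v η ⊆ interior P :=
    Metric.isOpen_ball.subset_interior_iff.2 (Metric.ball_subset_closedBall.trans hv)
  refine hPt.vadd_injective (x.isPatch.eq_of_interior hsP htP ⟨s + v, ?_, ?_⟩)
  · rw [interior_vadd]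
    exact ⟨v, hint (Metric.mem_ball_self (dist_nonneg.trans_lt hst)), rfl⟩
  · rw [interior_vadd, mem_vadd_set_iff_neg_vadd_mem]
    apply hint
    rw [Metric.mem_ball, dist_eq_norm]
    rw [dist_eq_norm] at hst
    have : (-t +ᵥ (s + v)) - v = s - t := by
      simp only [vadd_eq_add]
      abel
    rwa [this]

theorem finite_positions_inter_closedBall (hX : HasPrototiles X D) {q : Set (Set (E d))}
    (hq : IsSubpatch X q) (hne : q.Nonempty) {x : Tiling d} (hx : x ∈ X) (R : ℝ) :
    (positions q x.tiles ∩ Metric.closedBall 0 R).Finite := by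
  obtain ⟨P, hP⟩ := hne
  obtain ⟨ρ, hρ⟩ := hq.isBounded_supp.subset_closedBall 0
  refine (finite_positions (isTile_of_mem_tilesOf (hq.mem_tilesOf hP)) hP
    (hX.finite_ballPatch hx (R + ρ))).subset ?_
  rintro s ⟨hs, hsR⟩ _ ⟨Q, hQ, rfl⟩
  obtain ⟨u, hu⟩ := (isTile_of_mem_tilesOf (hq.mem_tilesOf hQ)).nonempty
  refine ⟨hs ⟨Q, hQ, rfl⟩, s + u, ⟨u, hu, rfl⟩, ?_⟩
  have h1 := hρ (subset_supp hQ hu)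
  rw [mem_closedBall_zero_iff] at hsR h1 ⊢
  linarith [norm_add_le s u]

/-- The volume of the vectors in a ball which move `x` into a cylinder. -/
theorem volume_setOf_shift_mem_cyl (hX : HasPrototiles X D) {q : Set (Set (E d))}
    (hq : IsSubpatch X q) {η : ℝ} (hη : ∃ P ∈ q, ∃ v, Metric.closedBall v η ⊆ P) {x : Tiling d}
    (hx : x ∈ X) {U : Set (E d)} (hUm : MeasurableSet U) {κ : ℝ} (hκ : U ⊆ Metric.closedBall 0 κ)
    (hU : ∀ u ∈ U, ∀ v ∈ U, dist u v < η) (R : ℝ) :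
    (positions q x.tiles ∩ Metric.closedBall 0 (R - κ)).ncard * volume U ≤
      volume.restrict (Metric.closedBall 0 R) {s : E d | x.shift s ∈ cyl q U} ∧
    volume.restrict (Metric.closedBall 0 R) {s : E d | x.shift s ∈ cyl q U} ≤
      (positions q x.tiles ∩ Metric.closedBall 0 (R + κ)).ncard * volume U := by
  have hne : q.Nonempty := let ⟨P, hP, _⟩ := hη; ⟨P, hP⟩
  have hfin := fun r => finite_positions_inter_closedBall hX hq hne hx r
  have hvol : ∀ p : E d, volume ((fun s => s + p) ⁻¹' U) = volume U := fun p =>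
    measure_preimage_add_right _ _ _
  -- The vectors `s` form the union of the sets `U - p` over the positions `p`, disjoint because `U`
  -- is small. Those with `‖p‖ ≤ R - κ` lie in the ball, and only those with `‖p‖ ≤ R + κ` can meet
  -- it.
  constructor
  · calc ((positions q x.tiles ∩ Metric.closedBall 0 (R - κ)).ncard : ENNReal) * volume U
        = ∑ p ∈ (hfin (R - κ)).toFinset, volume ((fun s => s + p) ⁻¹' U) := by
          rw [Finset.sum_congr rfl fun p _ => hvol p, Finset.sum_const, nsmul_eq_mul,
            Set.ncard_eq_toFinset_card _ (hfin _)]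
      _ = volume (⋃ p ∈ (hfin (R - κ)).toFinset, (fun s => s + p) ⁻¹' U) := by
          rw [measure_biUnion_finset]
          · intro p hp p' hp' hne
            refine disjoint_left.2 fun s hs hs' => hne ?_
            rw [SetLike.mem_coe, Set.Finite.mem_toFinset] at hp hp'
            refine eq_of_dist_lt_of_mem_positions hη hp.1 hp'.1 ?_
            simpa using hU _ hs _ hs'
          · exact fun p _ => (measurable_add_const p) hUm
      _ ≤ volume ({s : E d | x.shift s ∈ cyl q U} ∩ Metric.closedBall 0 R) := by
          refine measure_mono (iUnion₂_subset fun p hp s hs => ?_)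
          rw [Set.Finite.mem_toFinset] at hp
          refine ⟨mem_cyl_shift.2 ⟨p, hs, hp.1⟩, ?_⟩
          have h1 := hκ hs
          have h2 := hp.2
          rw [mem_closedBall_zero_iff] at h1 h2 ⊢
          have := norm_sub_le (s + p) p
          rw [add_sub_cancel_right] at this
          linarith
      _ ≤ _ := Measure.le_restrict_apply _ _
  · rw [Measure.restrict_apply' Metric.isClosed_closedBall.measurableSet]
    calc volume ({s : E d | x.shift s ∈ cyl q U} ∩ Metric.closedBall 0 R)
        ≤ volume (⋃ p ∈ (hfin (R + κ)).toFinset, (fun s => s + p) ⁻¹' U) := by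
          refine measure_mono ?_
          rintro s ⟨hs, hsR⟩
          obtain ⟨p, hp, hpx⟩ := mem_cyl_shift.1 hs
          simp only [mem_iUnion, Set.Finite.mem_toFinset]
          refine ⟨p, ⟨hpx, ?_⟩, hp⟩
          have h1 := hκ hp
          rw [mem_closedBall_zero_iff] at h1 hsR ⊢
          have := norm_sub_le (s + p) s
          rw [add_sub_cancel_left] at this
          linarith
      _ ≤ ∑ p ∈ (hfin (R + κ)).toFinset, volume ((fun s => s + p) ⁻¹' U) :=
          measure_biUnion_finset_le _ _
      _ = _ := by
          rw [Finset.sum_congr rfl fun p _ => hvol p, Finset.sum_const, nsmul_eq_mul,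
            Set.ncard_eq_toFinset_card _ (hfin _)]

/-- Tonelli's theorem requires measurability for the product σ-algebra. A countable basis of `ℝ^d`
alone exhibits the set as a countable union of open rectangles. -/
theorem measurableSet_setOf_shift_mem_cyl {q : Set (Set (E d))} (hq : q.Finite) {U : Set (E d)}
    (hU : IsOpen U) : MeasurableSet {p : E d × Tiling d | p.2.shift p.1 ∈ cyl q U} := by
  have : {p : E d × Tiling d | p.2.shift p.1 ∈ cyl q U} =
      ⋃ B ∈ {B : Set (E d) × Set (E d) | B ∈ TopologicalSpace.countableBasis (E d) ×ˢ
        TopologicalSpace.countableBasis (E d) ∧ ∀ s ∈ B.1, ∀ t ∈ B.2, s + t ∈ U},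
        B.1 ×ˢ cyl q B.2 := by
    ext ⟨s, x⟩
    simp only [mem_ofPred_eq, mem_iUnion, mem_prod, exists_prop, Prod.exists]
    rw [mem_cyl_shift]
    constructor
    · rintro ⟨t, ht, htx⟩
      obtain ⟨U₁, U₂, hU₁, hU₂, hs, ht', hsub⟩ := isOpen_prod_iff.1
        (hU.preimage (continuous_add : Continuous fun p : E d × E d => p.1 + p.2)) s t ht
      obtain ⟨B₁, hB₁, hsB, hB₁U⟩ := (TopologicalSpace.isBasis_countableBasis
        (E d)).exists_subset_of_mem_open hs hU₁
      obtain ⟨B₂, hB₂, htB, hB₂U⟩ := (TopologicalSpace.isBasis_countableBasis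
        (E d)).exists_subset_of_mem_open ht' hU₂
      exact ⟨B₁, B₂, ⟨⟨hB₁, hB₂⟩, fun s' hs' t' ht' => hsub (mk_mem_prod (hB₁U hs') (hB₂U ht'))⟩,
        hsB, t, htB, htx⟩
    · rintro ⟨B₁, B₂, ⟨-, h⟩, hs, t, ht, htx⟩
      exact ⟨t, h s hs t ht, htx⟩
  rw [this]
  refine MeasurableSet.biUnion (Countable.mono (fun B hB => hB.1)
    ((TopologicalSpace.countable_countableBasis _).prod
      (TopologicalSpace.countable_countableBasis _))) ?_
  rintro ⟨B₁, B₂⟩ ⟨⟨h₁, h₂⟩, -⟩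
  exact (TopologicalSpace.isOpen_of_mem_countableBasis h₁).measurableSet.prod
    (isOpen_cyl hq (TopologicalSpace.isOpen_of_mem_countableBasis h₂)).measurableSet

/-- Integrating over `x` first, invariance makes the inner integral equal to `ν (cyl q U)` for every
`s`. -/
theorem IsInvariantProb.lintegral_shift {ν : Measure (Tiling d)} (hν : IsInvariantProb Y ν)
    {q : Set (Set (E d))} (hq : q.Finite) {U : Set (E d)} (hU : IsOpen U) (B : Set (E d)) :
    ∫⁻ x, volume.restrict B {s : E d | x.shift s ∈ cyl q U} ∂ν = ν (cyl q U) * volume B := by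
  have := hν.prob
  have hG := measurableSet_setOf_shift_mem_cyl hq hU
  have h1 := Measure.prod_apply (μ := volume.restrict B) (ν := ν) hG
  rw [Measure.prod_apply_symm hG] at h1
  refine Eq.trans h1 ?_
  have h2 : ∀ s : E d, ν (Prod.mk s ⁻¹' {p : E d × Tiling d | p.2.shift p.1 ∈ cyl q U}) =
      ν (cyl q U) := fun s => hν.invariant s _ (isOpen_cyl hq hU).measurableSet
  simp only [h2, lintegral_const, Measure.restrict_apply_univ]

/-- The measure of an open cylinder is the volume times the patch frequency. -/
theorem IsSystem.measureReal_cyl [Finite J] [Nonempty J] (hd : 0 < d) (h : IsSystem X D S lam)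
    {D₀ : Set (E d)} (hD₀ : D₀ ∈ tilesOf X) {a : ℕ → J} {N : ℕ} {q : Set (Set (E d))}
    (hq : q ∈ patchesOf X N) {f : ℝ}
    (hf : ∀ i, Tendsto (fun n => density S a n q (D i)) atTop (𝓝 f))
    {ν : Measure (Tiling d)} (hν : IsInvariantProb (tilingSpace X S D₀ a) ν) {η : ℝ}
    (hη : ∃ P ∈ q, ∃ v, Metric.closedBall v η ⊆ P) {U : Set (E d)} (hU : IsOpen U)
    (hUb : Bornology.IsBounded U) (hUη : ∀ u ∈ U, ∀ v ∈ U, dist u v < η) :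
    ν.real (cyl q U) = f * volume.real U := by
  have := hν.prob
  obtain ⟨κ', hκ'⟩ := hUb.subset_closedBall 0
  have hUtop : volume U ≠ ⊤ := hUb.measure_lt_top.ne
  have hqs := isSubpatch_of_mem_patchesOf hq
  have hae : ∀ᵐ x ∂ν, x ∈ tilingSpace X S D₀ a := hν.carried
  -- The uniform counts are integrated over `ν` and divided by the volume of the ball. The margins
  -- `κ` and `κ'` disappear as `R → ∞`.
  have key : ∀ ε > 0, (f - ε) * volume.real U ≤ ν.real (cyl q U) ∧
      ν.real (cyl q U) ≤ (f + ε) * volume.real U := by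
    intro ε hε
    obtain ⟨κ, hκ⟩ := h.exists_forall_ncard_positions hd hD₀ hq hf hε
    have hupper : ∀ R : ℝ, ν.real (cyl q U) * volume.real (Metric.closedBall (0 : E d) R) ≤
        (f + ε) * volume.real (Metric.closedBall (0 : E d) (R + (κ' + κ))) * volume.real U := by
      intro R
      have h1 := hν.lintegral_shift hqs.1 hU (Metric.closedBall (0 : E d) R)
      have h2 : ∫⁻ x, volume.restrict (Metric.closedBall (0 : E d) R)
          {s : E d | x.shift s ∈ cyl q U} ∂ν ≤ ∫⁻ _, ENNReal.ofReal ((f + ε) *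
            volume.real (Metric.closedBall (0 : E d) (R + (κ' + κ))) * volume.real U) ∂ν := by
        refine lintegral_mono_ae ?_
        filter_upwards [hae] with x hx
        refine (volume_setOf_shift_mem_cyl h.proto hqs hη hx.1 hU.measurableSet hκ' hUη R).2.trans ?_
        rw [ENNReal.ofReal_mul' measureReal_nonneg, ofReal_measureReal hUtop,
          ← ENNReal.ofReal_natCast]
        gcongr
        rw [← add_assoc]
        exact (hκ x hx (R + κ')).2
      rw [h1, lintegral_const, measure_univ, mul_one] at h2
      rw [Measure.real, Measure.real, ← ENNReal.toReal_mul]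
      refine ENNReal.toReal_le_of_le_ofReal ?_ h2
      refine mul_nonneg (mul_nonneg ?_ measureReal_nonneg) measureReal_nonneg
      obtain ⟨i⟩ := h.nonempty_fin hD₀
      have hf0 : 0 ≤ f := ge_of_tendsto' (hf i) fun n => density_nonneg S a n q _
      linarith
    have hlower : ∀ R : ℝ, (f * volume.real (Metric.closedBall (0 : E d) (R + (-κ' - κ))) -
        ε * volume.real (Metric.closedBall (0 : E d) (R + -κ'))) * volume.real U ≤
          ν.real (cyl q U) * volume.real (Metric.closedBall (0 : E d) R) := by
      intro R
      have h1 := hν.lintegral_shift hqs.1 hU (Metric.closedBall (0 : E d) R)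
      have h2 : ∫⁻ _, ENNReal.ofReal ((f * volume.real (Metric.closedBall (0 : E d) (R + (-κ' - κ))) -
          ε * volume.real (Metric.closedBall (0 : E d) (R + -κ'))) * volume.real U) ∂ν ≤
          ∫⁻ x, volume.restrict (Metric.closedBall (0 : E d) R)
            {s : E d | x.shift s ∈ cyl q U} ∂ν := by
        refine lintegral_mono_ae ?_
        filter_upwards [hae] with x hx
        refine le_trans ?_
          (volume_setOf_shift_mem_cyl h.proto hqs hη hx.1 hU.measurableSet hκ' hUη R).1
        rw [ENNReal.ofReal_mul' measureReal_nonneg, ofReal_measureReal hUtop,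
          ← ENNReal.ofReal_natCast]
        gcongr
        have := (hκ x hx (R - κ')).1
        rwa [← sub_eq_add_neg, show R + (-κ' - κ) = R - κ' - κ by ring]
      rw [h1, lintegral_const, measure_univ, mul_one] at h2
      have e : ν.real (cyl q U) * volume.real (Metric.closedBall (0 : E d) R) =
          (ν (cyl q U) * volume (Metric.closedBall (0 : E d) R)).toReal := ENNReal.toReal_mul.symm
      rw [e]
      refine (ENNReal.ofReal_le_iff_le_toReal ?_).1 h2
      exact ENNReal.mul_ne_top (measure_ne_top _ _) measure_closedBall_lt_top.ne
    have hlim := fun c : ℝ => tendsto_volumeReal_closedBall_add_div (d := d) c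
    constructor
    · have h1 := (((hlim (-κ' - κ)).const_mul f).sub ((hlim (-κ')).const_mul ε)).mul_const
        (volume.real U)
      rw [mul_one, mul_one] at h1
      refine le_of_tendsto h1 ?_
      filter_upwards [eventually_gt_atTop 0] with R hR
      have hpos := volumeReal_closedBall_pos (d := d) hR
      rw [← mul_div_assoc, ← mul_div_assoc, ← sub_div, div_mul_eq_mul_div, div_le_iff₀ hpos]
      exact hlower R
    · have h1 := ((hlim (κ' + κ)).const_mul (f + ε)).mul_const (volume.real U)
      rw [mul_one] at h1
      refine ge_of_tendsto h1 ?_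
      filter_upwards [eventually_gt_atTop 0] with R hR
      have hpos := volumeReal_closedBall_pos (d := d) hR
      rw [← mul_div_assoc, div_mul_eq_mul_div, le_div_iff₀ hpos]
      exact hupper R
  have hu : (0 : ℝ) ≤ volume.real U := measureReal_nonneg
  apply le_antisymm
  · refine le_of_forall_pos_le_add fun ε hε => ?_
    have h1 := (key (ε / (volume.real U + 1)) (by positivity)).2
    have h2 : ε / (volume.real U + 1) * volume.real U ≤ ε := by
      rw [div_mul_eq_mul_div, div_le_iff₀ (by positivity)]
      nlinarith
    linarith
  · refine le_of_forall_pos_le_add fun ε hε => ?_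
    have h1 := (key (ε / (volume.real U + 1)) (by positivity)).1
    have h2 : ε / (volume.real U + 1) * volume.real U ≤ ε := by
      rw [div_mul_eq_mul_div, div_le_iff₀ (by positivity)]
      nlinarith
    linarith

end

section

variable {d l : ℕ} {J : Type*} {X Y : Set (Tiling d)} {D : Fin l → Set (E d)}
  {S : J → Set (E d) → Set (Set (E d))} {lam : J → ℝ}

/-- A position of `q` in `x` which lies in `V`, if there is one. -/
noncomputable def positionIn (q : Set (Set (E d))) (V : Set (E d)) (x : Tiling d) : E d :=
  open Classical in if h : ∃ t ∈ V, translate t q ⊆ x.tiles then h.choose else 0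

theorem positionIn_eq {q : Set (Set (E d))} {V : Set (E d)} {η : ℝ}
    (hη : ∃ P ∈ q, ∃ v, Metric.closedBall v η ⊆ P) (hV : ∀ u ∈ V, ∀ v ∈ V, dist u v < η)
    {x : Tiling d} {t : E d} (ht : t ∈ V) (htx : translate t q ⊆ x.tiles) :
    positionIn q V x = t := by
  have h : ∃ t ∈ V, translate t q ⊆ x.tiles := ⟨t, ht, htx⟩
  rw [positionIn, dif_pos h]
  exact eq_of_dist_lt_of_mem_positions hη h.choose_spec.2 htx (hV _ h.choose_spec.1 _ ht)

theorem cyl_inter_preimage_positionIn {q : Set (Set (E d))} {V : Set (E d)} {η : ℝ}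
    (hη : ∃ P ∈ q, ∃ v, Metric.closedBall v η ⊆ P) (hV : ∀ u ∈ V, ∀ v ∈ V, dist u v < η)
    (W : Set (E d)) : cyl q V ∩ positionIn q V ⁻¹' W = cyl q (V ∩ W) := by
  ext x
  constructor
  · rintro ⟨⟨t, ht, htx⟩, hxW⟩
    rw [mem_preimage, positionIn_eq hη hV ht htx] at hxW
    exact ⟨t, ⟨ht, hxW⟩, htx⟩
  · rintro ⟨t, ⟨ht, htW⟩, htx⟩
    refine ⟨⟨t, ht, htx⟩, ?_⟩
    rwa [mem_preimage, positionIn_eq hη hV ht htx]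

theorem measurable_positionIn {q : Set (Set (E d))} (hq : q.Finite) {V : Set (E d)} {η : ℝ}
    (hη : ∃ P ∈ q, ∃ v, Metric.closedBall v η ⊆ P) (hVo : IsOpen V)
    (hV : ∀ u ∈ V, ∀ v ∈ V, dist u v < η) : Measurable (positionIn q V) := by
  have hm : MeasurableSet (cyl q V) := (isOpen_cyl hq hVo).measurableSet
  refine measurable_of_isOpen fun W hW => ?_
  rw [← inter_union_compl (positionIn q V ⁻¹' W) (cyl q V), inter_comm,
    cyl_inter_preimage_positionIn hη hV]
  refine (isOpen_cyl hq (hVo.inter hW)).measurableSet.union ?_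
  have h1 : ∀ x ∈ (cyl q V)ᶜ, positionIn q V x = 0 := fun x hx => dif_neg hx
  by_cases h0 : (0 : E d) ∈ W
  · convert hm.compl using 1
    exact inter_eq_right.2 fun x hx => by rwa [mem_preimage, h1 x hx]
  · convert MeasurableSet.empty using 1
    refine eq_empty_of_forall_notMem fun x hx => h0 ?_
    rw [← h1 x hx.2]
    exact hx.1

/-- The measure of a small cylinder is the volume times the patch frequency. -/
theorem IsSystem.measureReal_cylinder [Finite J] [Nonempty J] (hd : 0 < d)
    (h : IsSystem X D S lam) {D₀ : Set (E d)} (hD₀ : D₀ ∈ tilesOf X) {a : ℕ → J} {N : ℕ}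
    {q : Set (Set (E d))} (hq : q ∈ patchesOf X N) {f : ℝ}
    (hf : ∀ i, Tendsto (fun n => density S a n q (D i)) atTop (𝓝 f))
    {ν : Measure (Tiling d)} (hν : IsInvariantProb (tilingSpace X S D₀ a) ν) {η : ℝ}
    (hη : ∃ P ∈ q, ∃ v, Metric.closedBall v η ⊆ P) {U : Set (E d)} (hU : MeasurableSet U)
    (hUη : Metric.ediam U < ENNReal.ofReal η) :
    ν.real (cylinder (tilingSpace X S D₀ a) q U) = f * volume.real U := by
  have := hν.prob
  have hf0 : 0 ≤ f := by
    obtain ⟨i⟩ := h.nonempty_fin hD₀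
    exact ge_of_tendsto' (hf i) fun n => density_nonneg S a n q _
  -- There is room to thicken `U` to an open set whose diameter is still below `η`.
  obtain ⟨r, hr, hrη⟩ : ∃ r : NNReal, 0 < r ∧ Metric.ediam U + 2 * r < ENNReal.ofReal η := by
    have h1 : Tendsto (fun r : NNReal => Metric.ediam U + 2 * (r : ENNReal)) (𝓝[>] 0)
        (𝓝 (Metric.ediam U + 2 * (0 : NNReal))) := by
      refine tendsto_nhdsWithin_of_tendsto_nhds ?_
      refine Tendsto.const_add _ (ENNReal.Tendsto.const_mul ?_ (Or.inr (by simp)))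
      exact ENNReal.tendsto_coe.2 tendsto_id
    rw [ENNReal.coe_zero, mul_zero, add_zero] at h1
    obtain ⟨r, h2, h3⟩ := ((h1.eventually (gt_mem_nhds hUη)).and self_mem_nhdsWithin).exists
    exact ⟨r, h3, h2⟩
  set V := Metric.thickening (r : ℝ) U with hVdef
  have hVo : IsOpen V := Metric.isOpen_thickening
  have hUV : U ⊆ V := Metric.self_subset_thickening (NNReal.coe_pos.2 hr) U
  have hVη : Metric.ediam V < ENNReal.ofReal η := (Metric.ediam_thickening_le r).trans_lt hrη
  have hVb : Bornology.IsBounded V := Metric.isBounded_iff_ediam_ne_top.2 (hVη.trans_le le_top).ne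
  have hV : ∀ u ∈ V, ∀ v ∈ V, dist u v < η := fun u hu v hv => by
    have h1 := (Metric.edist_le_ediam_of_mem hu hv).trans_lt hVη
    rw [edist_dist] at h1
    exact (ENNReal.ofReal_lt_ofReal_iff_of_nonneg dist_nonneg).1 h1
  have hcyl : MeasurableSet (cyl q V) := (isOpen_cyl hq.1 hVo).measurableSet
  have hmeas := measurable_positionIn hq.1 hη hVo hV
  have hVtop : volume V ≠ ⊤ := hVb.measure_lt_top.ne
  -- The image of `ν` on `cyl q V` under the unique position in `V` is compared with `f` times
  -- Lebesgue measure on `V`. Agreement on open sets gives agreement on Borel sets, in particular on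
  -- `U`.
  have hopen : ∀ W, IsOpen W → ((ν.restrict (cyl q V)).map (positionIn q V)) W =
      (ENNReal.ofReal f • volume.restrict V) W := by
    intro W hW
    rw [Measure.map_apply hmeas hW.measurableSet, Measure.restrict_apply (hmeas hW.measurableSet),
      inter_comm, cyl_inter_preimage_positionIn hη hV, Measure.smul_apply,
      Measure.restrict_apply hW.measurableSet, inter_comm W, smul_eq_mul]
    have h1 := h.measureReal_cyl hd hD₀ hq hf hν hη (hVo.inter hW) (hVb.subset inter_subset_left)
      fun u hu v hv => hV u hu.1 v hv.1
    rw [← ofReal_measureReal (measure_ne_top ν _), h1, ENNReal.ofReal_mul hf0,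
      ofReal_measureReal (hVb.subset inter_subset_left).measure_lt_top.ne]
  have hEq : (ν.restrict (cyl q V)).map (positionIn q V) = ENNReal.ofReal f • volume.restrict V :=
    ext_of_generate_finite {W | IsOpen W} BorelSpace.measurable_eq
      isPiSystem_isOpen (fun W hW => hopen W hW) (hopen _ isOpen_univ)
  have h2 := congrArg (fun m : Measure (E d) => m U) hEq
  rw [Measure.map_apply hmeas hU, Measure.restrict_apply (hmeas hU), inter_comm,
    cyl_inter_preimage_positionIn hη hV, inter_eq_right.2 hUV, Measure.smul_apply,
    Measure.restrict_apply hU, inter_eq_left.2 hUV, smul_eq_mul] at h2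
  rw [cylinder_eq, Measure.real, inter_comm, measure_inter_conull hν.carried, h2,
    ENNReal.toReal_mul, ENNReal.toReal_ofReal hf0]
  rfl

/-! ### Cylinders determine the measure -/

theorem HasPrototiles.exists_closedBall_subset (hX : HasPrototiles X D) :
    ∃ η > 0, ∀ P ∈ tilesOf X, ∃ v, Metric.closedBall v η ⊆ P := by
  have h1 : ∀ i, ∃ η > 0, ∃ v, Metric.closedBall v η ⊆ D i := by
    intro i
    obtain ⟨v, hv⟩ := (hX.isTile i).interior_nonempty
    obtain ⟨η, hη, h⟩ := Metric.nhds_basis_closedBall.mem_iff.1 (mem_interior_iff_mem_nhds.1 hv)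
    exact ⟨η, hη, v, h⟩
  choose η hη v hv using h1
  obtain ⟨η₀, hη₀, hle⟩ : ∃ η₀ > 0, ∀ i, η₀ ≤ η i := by
    rcases isEmpty_or_nonempty (Fin l) with hl | hl
    · exact ⟨1, one_pos, fun i => hl.elim i⟩
    · obtain ⟨i, hi⟩ := Finite.exists_min η
      exact ⟨_, hη i, hi⟩
  refine ⟨η₀, hη₀, fun P hP => ?_⟩
  obtain ⟨i, t, rfl⟩ := hX.complete P hP
  refine ⟨t +ᵥ v i, ?_⟩
  rw [← Metric.vadd_closedBall]
  exact vadd_set_mono ((Metric.closedBall_subset_closedBall (hle i)).trans (hv i))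

/-- In this piece of `X` the position of `P` in `B` is unique, so cylinders over patches `q` and
`q'` containing `P` intersect in the cylinder over `q ∪ q'`. They form a π-system which is also a
basis of the topology and hence generates the Borel sets. -/
theorem HasPrototiles.restrict_cyl_eq (hX : HasPrototiles X D) {P : Set (E d)}
    (hP : P ∈ tilesOf X) {η : ℝ} (hη : ∃ v, Metric.closedBall v η ⊆ P) {B : Set (E d)}
    (hB : IsOpen B) (hBη : ∀ u ∈ B, ∀ v ∈ B, dist u v < η) {ν₁ ν₂ : Measure (Tiling d)}
    [IsProbabilityMeasure ν₁] [IsProbabilityMeasure ν₂] (h₁ : ν₁ Xᶜ = 0) (h₂ : ν₂ Xᶜ = 0)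
    (heq : ∀ N, ∀ q ∈ patchesOf X N, P ∈ q → ∀ U ⊆ B, IsOpen U → ν₁ (cyl q U) = ν₂ (cyl q U)) :
    ν₁.restrict (X ∩ cyl {P} B) = ν₂.restrict (X ∩ cyl {P} B) := by
  set W := X ∩ cyl {P} B with hW
  have hWm : MeasurableSet W := hX.space.closed.measurableSet.inter
    (isOpen_cyl (finite_singleton P) hB).measurableSet
  have := hX.secondCountableTopology
  have : SecondCountableTopology W :=
    (Topology.IsEmbedding.inclusion (inter_subset_left : W ⊆ X)).secondCountableTopology
  let C : Set (Set W) := {s | ∃ N, ∃ q ∈ patchesOf X N, P ∈ q ∧ ∃ U ⊆ B, IsOpen U ∧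
    s = Subtype.val ⁻¹' cyl q U}
  have hpos : ∀ {q : Set (Set (E d))}, P ∈ q → ∃ P ∈ q, ∃ v, Metric.closedBall v η ⊆ P :=
    fun hPq => ⟨P, hPq, hη⟩
  have hsingle : ∀ {q : Set (Set (E d))}, P ∈ q → ∀ {t : E d} {x : Tiling d},
      translate t q ⊆ x.tiles → t ∈ positions {P} x.tiles := fun hPq t x h =>
    (translate_mono t (singleton_subset_iff.2 hPq)).trans h
  have hbasis : TopologicalSpace.IsTopologicalBasis C := by
    refine TopologicalSpace.isTopologicalBasis_of_isOpen_of_nhds ?_ ?_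
    · rintro s ⟨N, q, hq, -, U, -, hU, rfl⟩
      exact (isOpen_cyl hq.1 hU).preimage continuous_subtype_val
    · rintro ⟨x, hx, s, hsB, hsx⟩ V hxV hV
      obtain ⟨V', hV', rfl⟩ := isOpen_induced_iff.1 hV
      obtain ⟨N, q, hq, hqx, ε, hε, hsub⟩ := hX.exists_cyl_subset hx hV' hxV
      have hsP : s +ᵥ P ∈ x.tiles := hsx ⟨P, rfl, rfl⟩
      -- The patch is enlarged to a ball patch that also contains `s +ᵥ P`, and is then moved by
      -- `-s` so that `P` itself belongs to it.
      have hfin : (insert (s +ᵥ P) q).Finite := hq.1.insert _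
      have hqx' : insert (s +ᵥ P) q ⊆ x.tiles := insert_subset hsP hqx
      obtain ⟨R, hR0, hR⟩ := (isBounded_supp hfin fun Q hQ =>
        x.isPatch.1 Q (hqx' hQ)).subset_closedBall_lt 0 0
      have hqR : insert (s +ᵥ P) q ⊆ ballPatch x R := by
        intro Q hQ
        obtain ⟨u, hu⟩ := (x.isPatch.1 Q (hqx' hQ)).nonempty
        exact ⟨hqx' hQ, u, hu, hR (subset_supp hQ hu)⟩
      obtain ⟨M, hM⟩ := hX.exists_ballPatch_mem hR0.le
      obtain ⟨k, -, hk⟩ := hM x hx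
      refine ⟨_, ⟨k, _, hX.space.translate_mem_patchesOf hk (-s), ?_,
        B ∩ Metric.ball s ε, inter_subset_left, hB.inter Metric.isOpen_ball, rfl⟩,
        ⟨s, ⟨hsB, Metric.mem_ball_self hε⟩, ?_⟩, ?_⟩
      · rw [mem_translate, neg_neg]
        exact hqR (mem_insert _ _)
      · rw [translate_translate, add_neg_cancel, translate_zero]
        exact ballPatch_subset x R
      · rintro y ⟨t, ⟨-, ht⟩, hty⟩
        refine hsub ⟨t - s, ?_, ?_⟩
        · rwa [mem_ball_zero_iff, ← dist_eq_norm]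
        · rw [translate_translate, ← sub_eq_add_neg] at hty
          exact (translate_mono _ ((subset_insert _ _).trans hqR)).trans hty
  have hpi : IsPiSystem C := by
    rintro _ ⟨N, q, hq, hPq, U, hUB, hU, rfl⟩ _ ⟨N', q', hq', hPq', U', hUB', hU', rfl⟩
      ⟨⟨x, hx, hxc⟩, ⟨t, ht, htx⟩, ⟨t', ht', htx'⟩⟩
    have hunion : ∀ {t t' : E d} {x : Tiling d}, t ∈ U → t' ∈ U' → translate t q ⊆ x.tiles →
        translate t' q' ⊆ x.tiles → t = t' := fun ht ht' htx htx' =>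
      eq_of_dist_lt_of_mem_positions (hpos (mem_singleton P)) (hsingle hPq htx) (hsingle hPq' htx')
        (hBη _ (hUB ht) _ (hUB' ht'))
    obtain rfl := hunion ht ht' htx htx'
    have hmem : q ∪ q' ∈ patchesOf X (q ∪ q').ncard := by
      refine ⟨hq.1.union hq'.1, rfl, ?_, x.shift (-t), hX.space.invariant x hx _, ?_⟩
      · rw [supp, sUnion_union]
        obtain ⟨v, hv⟩ := (isTile_of_mem_tilesOf hP).nonempty
        exact IsConnected.union ⟨v, ⟨P, hPq, hv⟩, ⟨P, hPq', hv⟩⟩ hq.2.2.1 hq'.2.2.1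
      · show q ∪ q' ⊆ translate (-t) x.tiles
        rw [← translate_subset_iff, translate, image_union]
        exact union_subset htx htx'
    refine ⟨_, q ∪ q', hmem, Or.inl hPq, U ∩ U', inter_subset_left.trans hUB, hU.inter hU', ?_⟩
    ext y
    constructor
    · rintro ⟨⟨t, ht, htx⟩, ⟨t', ht', htx'⟩⟩
      obtain rfl := hunion ht ht' htx htx'
      refine ⟨t, ⟨ht, ht'⟩, ?_⟩
      rw [translate, image_union]
      exact union_subset htx htx'
    · rintro ⟨t, ⟨ht, ht'⟩, htx⟩
      exact ⟨⟨t, ht, (translate_mono t subset_union_left).trans htx⟩,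
        ⟨t, ht', (translate_mono t subset_union_right).trans htx⟩⟩
  have hcomap : ∀ ν : Measure (Tiling d), ν Xᶜ = 0 → ∀ q, P ∈ q → ∀ U ⊆ B,
      ν.comap (Subtype.val : W → Tiling d) (Subtype.val ⁻¹' cyl q U) = ν (cyl q U) := by
    intro ν hν q hPq U hUB
    rw [(MeasurableEmbedding.subtype_coe hWm).comap_apply, Subtype.image_preimage_coe]
    have : W ∩ cyl q U = cyl q U ∩ X := by
      ext x
      constructor
      · exact fun hx => ⟨hx.2, hx.1.1⟩
      · rintro ⟨⟨t, ht, htx⟩, hx⟩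
        exact ⟨⟨hx, t, hUB ht, hsingle hPq htx⟩, t, ht, htx⟩
    rw [this, measure_inter_conull hν]
  have hfin : ∀ ν : Measure (Tiling d), IsProbabilityMeasure ν →
      IsFiniteMeasure (ν.comap (Subtype.val : W → Tiling d)) := fun ν hν => by
    refine ⟨?_⟩
    rw [(MeasurableEmbedding.subtype_coe hWm).comap_apply]
    exact measure_lt_top ν _
  have := hfin ν₁ inferInstance
  have := hfin ν₂ inferInstance
  have hC : ∀ s ∈ C, ν₁.comap (Subtype.val : W → Tiling d) s =
      ν₂.comap (Subtype.val : W → Tiling d) s := by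
    rintro _ ⟨N, q, hq, hPq, U, hUB, hU, rfl⟩
    rw [hcomap ν₁ h₁ q hPq U hUB, hcomap ν₂ h₂ q hPq U hUB, heq N q hq hPq U hUB hU]
  have huniv : univ ∈ C := ⟨1, {P}, singleton_mem_patchesOf hP, rfl, B, Subset.rfl, hB,
    (eq_univ_of_forall fun x => x.2.2).symm⟩
  have hEq := ext_of_generate_finite C
    ((BorelSpace.measurable_eq (α := W)).trans hbasis.borel_eq_generateFrom) hpi hC (hC _ huniv)
  rw [← map_comap_subtype_coe hWm, ← map_comap_subtype_coe hWm, hEq]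

/-- A probability measure on a tiling space is determined by the measures of small cylinders. -/
theorem HasPrototiles.measure_ext (hX : HasPrototiles X D) (hD : ∀ i, D i ∈ tilesOf X) {η : ℝ}
    (hη0 : 0 < η) (hη : ∀ P ∈ tilesOf X, ∃ v, Metric.closedBall v η ⊆ P)
    {ν₁ ν₂ : Measure (Tiling d)} [IsProbabilityMeasure ν₁] [IsProbabilityMeasure ν₂]
    (h₁ : ν₁ Xᶜ = 0) (h₂ : ν₂ Xᶜ = 0)
    (heq : ∀ N, ∀ q ∈ patchesOf X N, ∀ U, IsOpen U → (∀ u ∈ U, ∀ v ∈ U, dist u v < η) →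
      ν₁ (cyl q U) = ν₂ (cyl q U)) : ν₁ = ν₂ := by
  let I : Set (Fin l × Set (E d)) := {p | p.2 ∈ TopologicalSpace.countableBasis (E d) ∧
    ∀ u ∈ p.2, ∀ v ∈ p.2, dist u v < η}
  have hI : I.Countable := by
    refine Countable.mono (fun p hp => ?_) ((countable_univ (α := Fin l)).prod
      (TopologicalSpace.countable_countableBasis (E d)))
    exact ⟨mem_univ _, hp.1⟩
  -- Countably many prototile cylinders over small basic sets cover `X`, so equality of measures can
  -- be checked on each of them.
  have hcov : X ⊆ ⋃ p ∈ I, X ∩ cyl {D p.1} p.2 := by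
    intro x hx
    obtain ⟨P, hP, -⟩ : (0 : E d) ∈ supp x.tiles := by rw [x.covers]; trivial
    obtain ⟨i, t, rfl⟩ := hX.complete P ⟨x, hx, hP⟩
    obtain ⟨B, hB, htB, hBt⟩ := (TopologicalSpace.isBasis_countableBasis
      (E d)).exists_subset_of_mem_open (Metric.mem_ball_self (half_pos hη0) : t ∈ Metric.ball t (η / 2))
      Metric.isOpen_ball
    simp only [mem_iUnion]
    refine ⟨(i, B), ⟨hB, fun u hu v hv => ?_⟩, hx, t, htB, ?_⟩
    · have h1 := Metric.mem_ball.1 (hBt hu)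
      have h2 := Metric.mem_ball'.1 (hBt hv)
      linarith [dist_triangle u t v]
    · rintro _ ⟨Q, rfl, rfl⟩
      exact hP
  have hself : ∀ ν : Measure (Tiling d), ν Xᶜ = 0 →
      ν.restrict (⋃ p ∈ I, X ∩ cyl {D p.1} p.2) = ν := fun ν hν =>
    Measure.restrict_eq_self_of_ae_mem (measure_mono_null (compl_subset_compl.2 hcov) hν)
  rw [← hself ν₁ h₁, ← hself ν₂ h₂, Measure.restrict_biUnion_congr hI]
  rintro ⟨i, B⟩ ⟨hB, hBη⟩
  exact hX.restrict_cyl_eq (hD i) (hη _ (hD i)) (TopologicalSpace.isOpen_of_mem_countableBasis hB)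
    hBη h₁ h₂ fun N q hq _ U hUB hU => heq N q hq U hU fun u hu v hv => hBη u (hUB hu) v (hUB hv)

end

/-! ### From common prefixes to the metric on sequences -/

/-- Sequences with `k` common letters have distance `1 / (k + 1)`, so `1 / δ` may exceed `k` by up
to one; this costs the factor `1 / ρ`. The added `1` makes the inequality strict. -/
theorem lt_mul_rpow_of_distSeq_lt {J : Type*} {a b : ℕ → J} {Δ C ρ δ : ℝ} (hρ : 0 < ρ)
    (hρ1 : ρ < 1) (hC : 0 ≤ C) (h : ∀ n : ℕ, (∀ r < n, a r = b r) → Δ ≤ C * ρ ^ n) (hδ : 0 < δ)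
    (hab : distSeq a b < δ) : Δ < (C / ρ + 1) * ρ ^ (1 / δ) := by
  have hpos : 0 < ρ ^ (1 / δ) := Real.rpow_pos_of_pos hρ _
  rw [distSeq] at hab
  split_ifs at hab with heq
  · have h1 : Tendsto (fun n : ℕ => C * ρ ^ n) atTop (𝓝 (C * 0)) :=
      (tendsto_pow_atTop_nhds_zero_of_lt_one hρ.le hρ1).const_mul C
    have h2 : Δ ≤ C * 0 := ge_of_tendsto' h1 fun n => h n fun r _ => by rw [heq]
    rw [mul_zero] at h2
    exact h2.trans_lt (by positivity)
  · set k := sInf {n : ℕ | a n ≠ b n} with hk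
    have h1 := h k fun r hr => by
      by_contra hne
      exact Nat.notMem_of_lt_sInf hr hne
    have h2 : 1 / δ ≤ (k + 1 : ℕ) := by
      rw [div_lt_iff₀ (by positivity)] at hab
      rw [div_le_iff₀ hδ]
      push_cast
      linarith
    have h3 : ρ ^ (k + 1) ≤ ρ ^ (1 / δ) := by
      rw [← Real.rpow_natCast]
      exact Real.rpow_le_rpow_of_exponent_ge hρ hρ1.le h2
    have h4 : C * ρ ^ k = C / ρ * ρ ^ (k + 1) := by
      rw [pow_succ]
      field_simp
    rw [h4] at h1
    have h5 := mul_le_mul_of_nonneg_left h3 (show 0 ≤ C / ρ by positivity)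
    linarith

theorem distSeq_lt_one_div {J : Type*} {a b : ℕ → J} {n : ℕ} (hn : 0 < n)
    (h : ∀ r < n, a r = b r) : distSeq a b < 1 / n := by
  have hn' : (0 : ℝ) < n := Nat.cast_pos.2 hn
  rw [distSeq]
  split_ifs with heq
  · positivity
  · have h1 : ((sInf {n : ℕ | a n ≠ b n} : ℕ) : ℝ) ≥ n := by
      have : {n : ℕ | a n ≠ b n}.Nonempty := Function.ne_iff.1 heq
      exact_mod_cast le_csInf this fun m hm => not_lt.1 fun hlt => hm (h m hlt)
    exact one_div_lt_one_div_of_lt hn' (by linarith)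

theorem distSeq_lt_two {J : Type*} (a b : ℕ → J) : distSeq a b < 2 := by
  rw [distSeq]
  split_ifs
  · exact two_pos
  · rw [div_lt_iff₀ (by positivity)]
    have : (0 : ℝ) ≤ (sInf {n : ℕ | a n ≠ b n} : ℕ) := Nat.cast_nonneg _
    linarith

theorem IsTileFrequencyRate.exists_frequency {d l : ℕ} {J : Type*} {D : Fin l → Set (E d)}
    {S : J → Set (E d) → Set (Set (E d))} {θ C : ℝ} (h : IsTileFrequencyRate D S θ C)
    (hD : ∀ i, IsTile (D i)) :
    ∃ c : (ℕ → J) → Fin l → ℝ,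
      (∀ a i k, Tendsto (fun n => density S a n {D i} (D k)) atTop (𝓝 (c a i))) ∧
      ∀ (n : ℕ) (a b : ℕ → J), (∀ r < n, a r = b r) → ∀ i, |c a i - c b i| ≤ C * θ ^ n := by
  obtain ⟨hθ0, hθ1, hC, c, hc, hrate⟩ := h
  refine ⟨c, fun a i k => ?_, fun n a b hab i => ?_⟩
  · refine (hc a i k).congr fun n => ?_
    rw [copies_singleton (hD i), density]
  · rcases Nat.eq_zero_or_pos n with rfl | hn
    -- No common letters are given when `n = 0`; the value `δ = 2` exceeds every distance.
    · refine (hrate 2 two_pos a b (distSeq_lt_two a b) i).le.trans ?_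
      rw [pow_zero]
      exact mul_le_mul_of_nonneg_left (Real.rpow_le_one hθ0.le hθ1.le (by norm_num)) hC.le
    · have hn' : (0 : ℝ) < n := Nat.cast_pos.2 hn
      have h1 := hrate (1 / n) (by positivity) a b (distSeq_lt_one_div hn hab) i
      rw [one_div_one_div, Real.rpow_natCast] at h1
      exact h1.le

section

variable {d l : ℕ} {J : Type*} {X : Set (Tiling d)} {D : Fin l → Set (E d)}
  {S : J → Set (E d) → Set (Set (E d))} {lam : J → ℝ}

/-- `X_a` carries at most one invariant probability measure. -/
theorem IsSystem.isInvariantProb_unique [Finite J] [Nonempty J] (hd : 0 < d)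
    (h : IsSystem X D S lam) {D₀ : Set (E d)} (hD₀ : D₀ ∈ tilesOf X) {a : ℕ → J}
    {f : Set (Set (E d)) → ℝ} (hf : ∀ N, ∀ q ∈ patchesOf X N, ∀ i,
      Tendsto (fun n => density S a n q (D i)) atTop (𝓝 (f q)))
    {ν₁ ν₂ : Measure (Tiling d)} (h₁ : IsInvariantProb (tilingSpace X S D₀ a) ν₁)
    (h₂ : IsInvariantProb (tilingSpace X S D₀ a) ν₂) : ν₁ = ν₂ := by
  have := h₁.prob
  have := h₂.prob
  obtain ⟨η, hη0, hη⟩ := h.proto.exists_closedBall_subset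
  have hsub := compl_subset_compl.2 (tilingSpace_subset X S D₀ a)
  refine h.proto.measure_ext h.family.mem hη0 hη (measure_mono_null hsub h₁.carried)
    (measure_mono_null hsub h₂.carried) fun N q hq U hU hUη => ?_
  obtain ⟨P, hP⟩ := nonempty_of_mem_patchesOf hq
  have hηq : ∃ P ∈ q, ∃ v, Metric.closedBall v η ⊆ P :=
    ⟨P, hP, hη P ((isSubpatch_of_mem_patchesOf hq).mem_tilesOf hP)⟩
  have hUb : Bornology.IsBounded U :=
    Metric.isBounded_iff.2 ⟨η, fun u hu v hv => (hUη u hu v hv).le⟩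
  have e1 := h.measureReal_cyl hd hD₀ hq (hf N q hq) h₁ hηq hU hUb hUη
  have e2 := h.measureReal_cyl hd hD₀ hq (hf N q hq) h₂ hηq hU hUb hUη
  rw [← ofReal_measureReal (measure_ne_top ν₁ _), ← ofReal_measureReal (measure_ne_top ν₂ _), e1, e2]

/-- `U` lies in a ball of radius `η` around any of its points, and `P` contains a ball of equal
volume. This makes the final constant independent of `η` and `U`. -/
theorem volumeReal_le_of_ediam_lt {P U : Set (E d)} {η : ℝ} (hP : IsTile P)
    (hη : ∃ v, Metric.closedBall v η ⊆ P) (hU : Metric.ediam U < ENNReal.ofReal η) :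
    volume.real U ≤ volume.real P := by
  rcases U.eq_empty_or_nonempty with rfl | ⟨u, hu⟩
  · rw [measureReal_empty]
    exact measureReal_nonneg
  · obtain ⟨v, hv⟩ := hη
    calc volume.real U ≤ volume.real (Metric.closedBall u η) := by
          refine measureReal_mono (fun w hw => ?_) measure_closedBall_lt_top.ne
          have h1 := (Metric.edist_le_ediam_of_mem hw hu).trans_lt hU
          rw [edist_dist] at h1
          exact ((ENNReal.ofReal_lt_ofReal_iff_of_nonneg dist_nonneg).1 h1).le
      _ = volume.real (Metric.closedBall v η) :=
          (volumeReal_closedBall_center u η).trans (volumeReal_closedBall_center v η).symm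
      _ ≤ volume.real P := measureReal_mono hv hP.isBounded.measure_lt_top.ne

end

end MultiSubst

/-! ### Unique ergodicity and the rate for cylinders -/

theorem mainTheorem4 {d l : ℕ} (hd : 0 < d) {J : Type*} [Finite J] [Nonempty J]
    (X : Set (MultiSubst.Tiling d)) (hX : MultiSubst.IsTilingSpace X)
    (D : Fin l → Set (MultiSubst.E d)) (hD : MultiSubst.IsPrototileFamily X D)
    (S : J → Set (MultiSubst.E d) → Set (Set (MultiSubst.E d))) (lam : J → ℝ)
    (hS : ∀ j, MultiSubst.IsSubstitution X (S j) (lam j))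
    (hprim : MultiSubst.IsPrimitive D S)
    (D₀ : Set (MultiSubst.E d)) (hD₀ : D₀ ∈ MultiSubst.tilesOf X) :
    -- rates `θ` for the tile frequencies exist
    (∃ θ C : ℝ, MultiSubst.IsTileFrequencyRate D S θ C) ∧
    -- each `X_a` is uniquely ergodic, with measure `μ a`
    ∃ μ : (ℕ → J) → Measure (MultiSubst.Tiling d),
      (∀ a, MultiSubst.IsInvariantProb (MultiSubst.tilingSpace X S D₀ a) (μ a) ∧
        ∀ ν, MultiSubst.IsInvariantProb (MultiSubst.tilingSpace X S D₀ a) ν → ν = μ a) ∧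
      ∀ θ C : ℝ, MultiSubst.IsTileFrequencyRate D S θ C →
        MultiSubst.theta₀ D lam θ < 1 ∧
        ∀ N : ℕ, 0 < N → ∃ C_N : ℝ, 0 < C_N ∧
          ∀ δ : ℝ, 0 < δ → ∀ a b : ℕ → J, MultiSubst.distSeq a b < δ →
            ∀ x' ∈ MultiSubst.patchesOf X N,
            ∀ η : ℝ, 0 < η → (∀ P ∈ MultiSubst.tilesOf X, ∃ v, Metric.closedBall v η ⊆ P) →
            ∀ U : Set (MultiSubst.E d), MeasurableSet U → Metric.ediam U < ENNReal.ofReal η →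
              |(μ a).real (MultiSubst.cylinder (MultiSubst.tilingSpace X S D₀ a) x' U)
                - (μ b).real (MultiSubst.cylinder (MultiSubst.tilingSpace X S D₀ b) x' U)|
                < C_N * MultiSubst.theta₀ D lam θ ^ (1 / δ) := by
  have hsys : MultiSubst.IsSystem X D S lam :=
    ⟨MultiSubst.HasPrototiles.of_isPrototileFamily hX hD, hD, fun j => (hS j).isInflation hX,
      fun j => (hS j).one_lt⟩
  have hne : (MultiSubst.tilesOf X).Nonempty := ⟨D₀, hD₀⟩
  have hfin := hsys.nonempty_fin hD₀
  have hDt := hsys.proto.isTile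
  obtain ⟨ρ, C, hρ0, hρ1, hC, c, hc, hrate⟩ := hsys.exists_tileFrequency hprim hne
  -- The frequency is chosen before the number of tiles, which yields one function `f`; its value
  -- `0` off the patches plays no role.
  have hfreq : ∀ (a : ℕ → J) (q : Set (Set (MultiSubst.E d))), ∃ f : ℝ,
      ∀ N, q ∈ MultiSubst.patchesOf X N → ∀ i,
        Tendsto (fun n => MultiSubst.density S a n q (D i)) atTop (𝓝 f) := by
    intro a q
    by_cases hq : ∃ N, q ∈ MultiSubst.patchesOf X N
    · obtain ⟨N, hN⟩ := hq
      obtain ⟨f, hf⟩ := hsys.exists_patchFrequency hne hc a hN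
      exact ⟨f, fun _ _ => hf⟩
    · exact ⟨0, fun N hN => absurd ⟨N, hN⟩ hq⟩
  choose f hf using hfreq
  have hf' : ∀ (a : ℕ → J) (N : ℕ), ∀ q ∈ MultiSubst.patchesOf X N, ∀ i,
      Tendsto (fun n => MultiSubst.density S a n q (D i)) atTop (𝓝 (f a q)) :=
    fun a N q hq => hf a q N hq
  have hexists : ∀ a, ∃ μ, MultiSubst.IsInvariantProb (MultiSubst.tilingSpace X S D₀ a) μ :=
    fun a => (hsys.proto.tilingSpace S D₀ a).exists_isInvariantProb
      (hsys.tilingSpace_nonempty hD₀ a)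
  choose μ hμ using hexists
  refine ⟨⟨ρ, C / ρ + 1, hρ0, hρ1, by positivity, c, fun a i k => ?_, fun δ hδ a b hab i => ?_⟩,
    μ, fun a => ⟨hμ a, fun ν hν => hsys.isInvariantProb_unique hd hD₀ (hf' a) hν (hμ a)⟩, ?_⟩
  · refine (hc a i k).congr fun n => ?_
    rw [MultiSubst.copies_singleton (hDt i), MultiSubst.density]
  · exact MultiSubst.lt_mul_rpow_of_distSeq_lt hρ0 hρ1 hC.le (fun n hn => hrate n a b hn i) hδ hab
  intro θ C hθ
  obtain ⟨c', hc', hrate'⟩ := hθ.exists_frequency hDt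
  obtain ⟨hθ0, hθ1, hC, -⟩ := hθ
  obtain ⟨hθ₀1, hθθ₀, γ, hγ, hγθ⟩ := hsys.theta₀_spec hd hθ0 hθ1
  have hθ₀0 : 0 < MultiSubst.theta₀ D lam θ := hθ0.trans_le hθθ₀
  refine ⟨hθ₀1, fun N _ => ?_⟩
  -- Limits are unique, so the given rate `θ` applies to the frequencies `f` that describe the
  -- measures.
  have hfc : ∀ a i, f a {D i} = c' a i := fun a i => tendsto_nhds_unique
    (hf' a 1 {D i} (MultiSubst.singleton_mem_patchesOf (hD.mem i)) i) (hc' a i i)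
  obtain ⟨C', hC', hpatch⟩ := hsys.exists_patchFrequency_sub_le hf' hθ0.le hθ₀0 hθθ₀ hC hθ₀1.le
    (fun n a b hab i => by rw [hfc, hfc]; exact hrate' n a b hab i)
    (fun K R hK hR => hsys.exists_mul_boundaryVolume_le hγ hγθ hK hR) N
  -- The volume of `D₀` bounds that of every admissible `U`; the added `1` gives strictness.
  refine ⟨(C' / MultiSubst.theta₀ D lam θ + 1) * (volume.real D₀ + 1), by positivity,
    fun δ hδ a b hab x' hx' η _ hη U hU hUη => ?_⟩
  obtain ⟨P, hP⟩ := MultiSubst.nonempty_of_mem_patchesOf hx'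
  have hηq : ∃ P ∈ x', ∃ v, Metric.closedBall v η ⊆ P :=
    ⟨P, hP, hη P ((MultiSubst.isSubpatch_of_mem_patchesOf hx').mem_tilesOf hP)⟩
  rw [hsys.measureReal_cylinder hd hD₀ hx' (hf' a N x' hx') (hμ a) hηq hU hUη,
    hsys.measureReal_cylinder hd hD₀ hx' (hf' b N x' hx') (hμ b) hηq hU hUη, ← sub_mul, abs_mul,
    abs_of_nonneg (measureReal_nonneg (μ := volume) (s := U))]
  have hdiff := MultiSubst.lt_mul_rpow_of_distSeq_lt hθ₀0 hθ₀1 hC'.le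
    (fun n hn => hpatch n a b hn N le_rfl x' hx') hδ hab
  have hvol : volume.real U ≤ volume.real D₀ := MultiSubst.volumeReal_le_of_ediam_lt
    (MultiSubst.isTile_of_mem_tilesOf hD₀) (hη D₀ hD₀) hUη
  have hpos : 0 < MultiSubst.theta₀ D lam θ ^ (1 / δ) := Real.rpow_pos_of_pos hθ₀0 _
  calc |f a x' - f b x'| * volume.real U
      ≤ (C' / MultiSubst.theta₀ D lam θ + 1) * MultiSubst.theta₀ D lam θ ^ (1 / δ) *
          volume.real D₀ :=
        mul_le_mul hdiff.le hvol measureReal_nonneg (by positivity)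
    _ < (C' / MultiSubst.theta₀ D lam θ + 1) * MultiSubst.theta₀ D lam θ ^ (1 / δ) *
          (volume.real D₀ + 1) :=
        mul_lt_mul_of_pos_left (lt_add_one _) (by positivity)
    _ = _ := by ring
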